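/- Let $M$ be a smooth manifold with a pair of complementary smooth distributions $\widetilde{\mathcal D}$ (rank $n$) and $\mathcal D$ (rank $p$), $TM=\widetilde{\mathcal D}\oplus\mathcal D$, with components $X=X^\top+X^\perp$. A Riemannian metric $g$ is adapted if $\widetilde{\mathcal D}\perp_g\mathcal D$; put $g^\perp(X,Y)=g(X^\perp,Y^\perp)$ and $\tilde g(X,Y)=g(X^\top,Y^\top)$. Let $\nabla$ be the Levi-Civita connection of $g$, and let $\{E_a\}$, $\{\mathcal E_i\}$ be local orthonormal frames of $\widetilde{\mathcal D}$ and $\mathcal D$. For sections $X,Y$ of $\widetilde{\mathcal D}$ put $$h(X,Y)=\tfrac12(\nabla_XY+\nabla_YX)^\perp,\quad T(X,Y)=\tfrac12[X,Y]^\perp,\quad H=\sum_a h(E_a,E_a),$$ and for sections $X,Y$ of $\mathcal D$ put $$\tilde h(X,Y)=\tfrac12(\nabla_XY+\nabla_YX)^\top,\quad \tilde T(X,Y)=\tfrac12[X,Y]^\top,\quad \tilde H=\sum_i\tilde h(\mathcal E_i,\mathcal E_i)$$ (all extended by zero to $TM$). Norms are $\|h\|^2=\sum_{a,b}\|h(E_a,E_b)\|^2$,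 $\|\tilde h\|^2=\sum_{i,j}\|\tilde h(\mathcal E_i,\mathcal E_j)\|^2$, and similarly for $T,\tilde T$. Let $\tilde A_a,\tilde T^\sharp_a$ be the operators with $g(\tilde A_aX,Y)=g(\tilde h(X,Y),E_a)$, $g(\tilde T^\sharp_aX,Y)=g(\tilde T(X,Y),E_a)$, and $$\widetilde{\mathcal T}=\sum_a(\tilde T^\sharp_a)^2,\qquad \tilde{\mathcal K}=\sum_a(\tilde T^\sharp_a\tilde A_a-\tilde A_a\tilde T^\sharp_a).$$ Let $\Phi_h,\Phi_T$ be the $\mathcal D$-truncated symmetric $(0,2)$-tensors with, for all symmetric $S$, $$\langle\Phi_h,S\rangle=S(H,H)-\sum_{a,b}S(h(E_a,E_b),h(E_a,E_b)),\qquad \langle\Phi_T,S\rangle=-\sum_{a,b}S(T(E_a,E_b),T(E_a,E_b)).$$ With $(e_c)$ an orthonormal frame of $TM$, $\langle B,S\rangle=\sum_{c,d}B(e_c,e_d)S(e_c,e_d)$ for $(0,2)$-tensors, $\langle P,S\rangle=\sum_{c,d}S(e_c,e_d)P(e_c,e_d)$ for a $(1,2)$-tensor $P$, $\operatorname{div}\xi=\operatorname{Tr}(\nabla\xi)$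 and $(\operatorname{div}P)(X,Y)=\sum_c g((\nabla_{e_c}P)(X,Y),e_c)$; $L^\flat(X,Y)=g(LX,Y)$ for a $(1,1)$-tensor $L$. Let $g_t$ $(|t|<\varepsilon)$ be a variation through adapted metrics, smooth in $(t,x)$, and $S=S_t=\partial_tg_t$. All objects below are taken with respect to $g_t$. (1) If $S$ is $\mathcal D$-truncated, i.e. $S(X,\cdot)=0$ for $X\in\widetilde{\mathcal D}$ (in particular, for every $t$, if $g_t=g_t^\perp+\tilde g_0$ is a $\mathcal D$-variation), then $$\begin{aligned} \partial_t\|\tilde h\|^2&=\langle\operatorname{div}\tilde h+\tilde{\mathcal K}^\flat,S\rangle-\operatorname{div}\langle\tilde h,S\rangle,\\ \partial_t\|\tilde H\|^2&=\langle(\operatorname{div}\tilde H)\,g,S\rangle-\operatorname{div}((\operatorname{Tr}_gS)\tilde H),\\ \partial_t(\|h\|^2-\|H\|^2)&=\langle\Phi_h,S\rangle,\\ \partial_t\|\tilde T\|^2&=\langle2\,\widetilde{\mathcal T}^\flat,S\rangle,\qquad \partial_t\|T\|^2=-\langle\Phi_T,S\rangle. \end{aligned}$$ (2) If $S=s\,g^\perp$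 with $s\in C^\infty(M)$ ($\mathcal D$-conformal variation), then $$\begin{aligned} \partial_t\|\tilde h\|^2&=s\operatorname{div}\tilde H-\operatorname{div}(s\tilde H),\qquad \partial_t\|\tilde H\|^2=p\,\big(s\operatorname{div}\tilde H-\operatorname{div}(s\tilde H)\big),\\ \partial_t\|h\|^2&=-s\|h\|^2,\qquad \partial_t\|H\|^2=-s\|H\|^2,\\ \partial_t\|\tilde T\|^2&=-2s\|\tilde T\|^2,\qquad \partial_t\|T\|^2=s\|T\|^2. \end{aligned}$$ (3) The dual formulas, with the roles of $(\widetilde{\mathcal D},n)$ and $(\mathcal D,p)$ exchanged, hold when $S$ is $\widetilde{\mathcal D}$-truncated and when $S=s\,\tilde g$, respectively. -/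

import Mathlib

set_option linter.unusedSectionVars false

open Bundle Module
open scoped Manifold ContDiff Topology

noncomputable section

section Carriers

variable (E : Type*) [NormedAddCommGroup E] [NormedSpace ℝ E] [FiniteDimensional ℝ E]
  (M : Type*) [TopologicalSpace M] [ChartedSpace E M] [IsManifold 𝓘(ℝ, E) ∞ M]

/-- (Rough) vector fields on `M`; smoothness is always stated separately. -/
abbrev VecField := (x : M) → TangentSpace 𝓘(ℝ, E) x

/-- Smooth Riemannian metrics on `M`. -/
abbrev RiemMetric :=
  ContMDiffRiemannianMetric 𝓘(ℝ, E) ∞ E (fun x : M => TangentSpace 𝓘(ℝ, E) x)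

end Carriers

variable {E : Type*} [NormedAddCommGroup E] [NormedSpace ℝ E] [FiniteDimensional ℝ E]
  {M : Type*} [TopologicalSpace M] [ChartedSpace E M] [IsManifold 𝓘(ℝ, E) ∞ M]

namespace RiemMetric

/-- A `g_x`-orthonormal basis of a subspace `F` of `T_x M`. -/
def orthonormalFrame (g : RiemMetric E M) {x : M} (F : Submodule ℝ (TangentSpace 𝓘(ℝ, E) x)) :
    Fin (finrank ℝ F) → TangentSpace 𝓘(ℝ, E) x :=
  letI : RiemannianBundle (fun x : M => TangentSpace 𝓘(ℝ, E) x) :=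
    ⟨g.toRiemannianMetric⟩
  haveI : FiniteDimensional ℝ (TangentSpace 𝓘(ℝ, E) x) := inferInstanceAs (FiniteDimensional ℝ E)
  fun i => (stdOrthonormalBasis ℝ F i : TangentSpace 𝓘(ℝ, E) x)

theorem orthonormalFrame_inner (g : RiemMetric E M) {x : M}
    (F : Submodule ℝ (TangentSpace 𝓘(ℝ, E) x)) (i j : Fin (finrank ℝ F)) :
    g.inner x (g.orthonormalFrame F i) (g.orthonormalFrame F j) = if i = j then 1 else 0 := by
  let _ : RiemannianBundle (fun x : M => TangentSpace 𝓘(ℝ, E) x) :=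
    ⟨g.toRiemannianMetric⟩
  have _ : FiniteDimensional ℝ (TangentSpace 𝓘(ℝ, E) x) := inferInstanceAs (FiniteDimensional ℝ E)
  exact orthonormal_iff_ite.1 (stdOrthonormalBasis ℝ F).orthonormal i j

theorem orthonormalFrame_mem (g : RiemMetric E M) {x : M}
    (F : Submodule ℝ (TangentSpace 𝓘(ℝ, E) x)) (i : Fin (finrank ℝ F)) :
    g.orthonormalFrame F i ∈ F := Subtype.prop _

theorem orthonormalFrame_sum (g : RiemMetric E M) {x : M}
    (F : Submodule ℝ (TangentSpace 𝓘(ℝ, E) x)) {v : TangentSpace 𝓘(ℝ, E) x} (hv : v ∈ F) :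
    ∑ i, g.inner x (g.orthonormalFrame F i) v • g.orthonormalFrame F i = v := by
  let _ : RiemannianBundle (fun x : M => TangentSpace 𝓘(ℝ, E) x) :=
    ⟨g.toRiemannianMetric⟩
  have _ : FiniteDimensional ℝ (TangentSpace 𝓘(ℝ, E) x) := inferInstanceAs (FiniteDimensional ℝ E)
  have := congrArg (Subtype.val) ((stdOrthonormalBasis ℝ F).sum_repr' ⟨v, hv⟩)
  refine Eq.trans ?_ this
  rw [AddSubmonoidClass.coe_finsetSum]
  rfl
  
/-- The right-hand side of the Koszul formula
`2 g(∇_X Y, Z) = X g(Y,Z) + Y g(Z,X) - Z g(X,Y) + g([X,Y],Z) - g([X,Z],Y) - g([Y,Z],X)`. -/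
def koszul (g : RiemMetric E M) (X Y Z : VecField E M) (x : M) : ℝ :=
  mvfderiv 𝓘(ℝ, E) (fun y => g.inner y (Y y) (Z y)) x (X x)
    + mvfderiv 𝓘(ℝ, E) (fun y => g.inner y (Z y) (X y)) x (Y x)
    - mvfderiv 𝓘(ℝ, E) (fun y => g.inner y (X y) (Y y)) x (Z x)
    + g.inner x (VectorField.mlieBracket 𝓘(ℝ, E) X Y x) (Z x)
    - g.inner x (VectorField.mlieBracket 𝓘(ℝ, E) X Z x) (Y x)
    - g.inner x (VectorField.mlieBracket 𝓘(ℝ, E) Y Z x) (X x)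

theorem mdifferentiableAt_inner (g : RiemMetric E M) {X Y : VecField E M} {x : M}
    (hX : MDiffAt (T% X) x) (hY : MDiffAt (T% Y) x) :
    MDiffAt (fun y => g.inner y (X y) (Y y)) x := by
  have h : MDifferentiableAt 𝓘(ℝ, E) (𝓘(ℝ, E).prod 𝓘(ℝ)) 
      (fun y => TotalSpace.mk' ℝ (E := Bundle.Trivial M ℝ) y (g.inner y (X y) (Y y))) x := by
    apply MDifferentiableAt.clm_bundle_apply₂ (F₁ := E) (F₂ := E)
    · exact g.contMDiff.mdifferentiableAt (by simp)
    · exact hX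
    · exact hY
  rw [mdifferentiableAt_totalSpace] at h
  exact h.2

theorem koszul_tensorial_left (g : RiemMetric E M) {Y Z : VecField E M} {x : M}
    (hY : MDiffAt (T% Y) x) (hZ : MDiffAt (T% Z) x) :
    TensorialAt 𝓘(ℝ, E) E (fun X => g.koszul X Y Z x) x where
  smul {f X} hf hX := by
    have h1 := g.mdifferentiableAt_inner hZ hX
    have h2 := g.mdifferentiableAt_inner hX hY
    have e1 : (fun y => g.inner y (Z y) ((f • X) y)) = fun y => f y * g.inner y (Z y) (X y) := by
      ext y; simp
    have e2 : (fun y => g.inner y ((f • X) y) (Y y)) = fun y => f y * g.inner y (X y) (Y y) := by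
      ext y; simp
    simp only [koszul, e1, e2, mvfderiv_fun_mul hf h1, mvfderiv_fun_mul hf h2,
      VectorField.mlieBracket_smul_left hf hX]
    simp [g.symm x (X x)]
    ring
  add {X X'} hX hX' := by
    have e1 : (fun y => g.inner y (Z y) ((X + X') y)) =
        fun y => g.inner y (Z y) (X y) + g.inner y (Z y) (X' y) := by
      ext y; simp
    have e2 : (fun y => g.inner y ((X + X') y) (Y y)) =
        fun y => g.inner y (X y) (Y y) + g.inner y (X' y) (Y y) := by
      ext y; simp
    simp only [koszul, e1, e2,
      mvfderiv_fun_add (g.mdifferentiableAt_inner hZ hX) (g.mdifferentiableAt_inner hZ hX'),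
      mvfderiv_fun_add (g.mdifferentiableAt_inner hX hY) (g.mdifferentiableAt_inner hX' hY),
      VectorField.mlieBracket_add_left hX hX']
    simp
    ring

theorem koszul_tensorial_right (g : RiemMetric E M) {X Y : VecField E M} {x : M}
    (hX : MDiffAt (T% X) x) (hY : MDiffAt (T% Y) x) :
    TensorialAt 𝓘(ℝ, E) E (fun Z => g.koszul X Y Z x) x where
  smul {f Z} hf hZ := by
    have e1 : (fun y => g.inner y ((f • Z) y) (X y)) = fun y => f y * g.inner y (Z y) (X y) := by
      ext y; simp
    have e2 : (fun y => g.inner y (Y y) ((f • Z) y)) = fun y => f y * g.inner y (Y y) (Z y) := by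
      ext y; simp
    simp only [koszul, e1, e2, mvfderiv_fun_mul hf (g.mdifferentiableAt_inner hZ hX),
      mvfderiv_fun_mul hf (g.mdifferentiableAt_inner hY hZ),
      VectorField.mlieBracket_smul_right hf hZ]
    simp [g.symm x (Z x)]
    ring
  add {Z Z'} hZ hZ' := by
    have e1 : (fun y => g.inner y ((Z + Z') y) (X y)) =
        fun y => g.inner y (Z y) (X y) + g.inner y (Z' y) (X y) := by
      ext y; simp
    have e2 : (fun y => g.inner y (Y y) ((Z + Z') y)) =
        fun y => g.inner y (Y y) (Z y) + g.inner y (Y y) (Z' y) := by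
      ext y; simp
    simp only [koszul, e1, e2,
      mvfderiv_fun_add (g.mdifferentiableAt_inner hZ hX) (g.mdifferentiableAt_inner hZ' hX),
      mvfderiv_fun_add (g.mdifferentiableAt_inner hY hZ) (g.mdifferentiableAt_inner hY hZ'),
      VectorField.mlieBracket_add_right hZ hZ']
    simp
    ring

theorem koszul_smul_mid (g : RiemMetric E M) {X Y Z : VecField E M} {f : M → ℝ} {x : M}
    (hX : MDiffAt (T% X) x) (hY : MDiffAt (T% Y) x) (hZ : MDiffAt (T% Z) x) (hf : MDiffAt f x) :
    g.koszul X (f • Y) Z x = f x * g.koszul X Y Z x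
      + 2 * (mvfderiv 𝓘(ℝ, E) f x (X x) * g.inner x (Y x) (Z x)) := by
  have e1 : (fun y => g.inner y ((f • Y) y) (Z y)) = fun y => f y * g.inner y (Y y) (Z y) := by
    ext y; simp
  have e2 : (fun y => g.inner y (X y) ((f • Y) y)) = fun y => f y * g.inner y (X y) (Y y) := by
    ext y; simp
  simp only [koszul, e1, e2, mvfderiv_fun_mul hf (g.mdifferentiableAt_inner hY hZ),
    mvfderiv_fun_mul hf (g.mdifferentiableAt_inner hX hY),
    VectorField.mlieBracket_smul_right hf hY, VectorField.mlieBracket_smul_left hf hY]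
  simp [g.symm x (X x)]
  ring

theorem koszul_add_mid (g : RiemMetric E M) {X Y Y' Z : VecField E M} {x : M}
    (hX : MDiffAt (T% X) x) (hY : MDiffAt (T% Y) x) (hY' : MDiffAt (T% Y') x)
    (hZ : MDiffAt (T% Z) x) :
    g.koszul X (Y + Y') Z x = g.koszul X Y Z x + g.koszul X Y' Z x := by
  have e1 : (fun y => g.inner y ((Y + Y') y) (Z y)) =
      fun y => g.inner y (Y y) (Z y) + g.inner y (Y' y) (Z y) := by
    ext y; simp
  have e2 : (fun y => g.inner y (X y) ((Y + Y') y)) =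
      fun y => g.inner y (X y) (Y y) + g.inner y (X y) (Y' y) := by
    ext y; simp
  simp only [koszul, e1, e2,
    mvfderiv_fun_add (g.mdifferentiableAt_inner hY hZ) (g.mdifferentiableAt_inner hY' hZ),
    mvfderiv_fun_add (g.mdifferentiableAt_inner hX hY) (g.mdifferentiableAt_inner hX hY'),
    VectorField.mlieBracket_add_right hY hY', VectorField.mlieBracket_add_left hY hY']
  simp
  ring

/-- The bilinear form `(X, Z) ↦ 2 g(∇_X Y, Z)` on `T_x M`, for a vector field `Y` that is
differentiable at `x`. -/
def koszulForm (g : RiemMetric E M) (Y : VecField E M) {x : M} (hY : MDiffAt (T% Y) x) :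
    TangentSpace 𝓘(ℝ, E) x →L[ℝ] TangentSpace 𝓘(ℝ, E) x →L[ℝ] ℝ :=
  TensorialAt.mkHom₂ (fun X Z => g.koszul X Y Z x) x
    (fun _ hZ => g.koszul_tensorial_left hY hZ) (fun _ hX => g.koszul_tensorial_right hX hY)

/-- The musical isomorphism `♯`: the vector `φ♯` with `g(φ♯, v) = φ(v)`, see `inner_sharp`. -/
def sharp (g : RiemMetric E M) (x : M) :
    (TangentSpace 𝓘(ℝ, E) x →L[ℝ] ℝ) →ₗ[ℝ] TangentSpace 𝓘(ℝ, E) x where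
  toFun φ := ∑ c, φ (g.orthonormalFrame ⊤ c) • g.orthonormalFrame ⊤ c
  map_add' φ ψ := by simp [add_smul, Finset.sum_add_distrib]
  map_smul' r φ := by simp [mul_smul, Finset.smul_sum]

theorem inner_sharp (g : RiemMetric E M) {x : M} (φ : TangentSpace 𝓘(ℝ, E) x →L[ℝ] ℝ)
    (v : TangentSpace 𝓘(ℝ, E) x) : g.inner x (g.sharp x φ) v = φ v := by
  conv_rhs => rw [← g.orthonormalFrame_sum ⊤ (Submodule.mem_top (x := v))]
  simp [sharp, mul_comm]

theorem ext_inner (g : RiemMetric E M) {x : M} {v w : TangentSpace 𝓘(ℝ, E) x}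
    (h : ∀ z, g.inner x v z = g.inner x w z) : v = w := by
  by_contra hne
  have := g.pos x (v - w) (sub_ne_zero.2 hne)
  rw [map_sub] at this
  simp [h] at this

open scoped Classical in
/-- `∇Y` for the Levi-Civita connection: `v ↦ ∇_v Y`, by the Koszul formula (with the value `0` at
points where `Y` is not differentiable). -/
def leviCivitaFun (g : RiemMetric E M) (Y : VecField E M) (x : M) :
    TangentSpace 𝓘(ℝ, E) x →L[ℝ] TangentSpace 𝓘(ℝ, E) x :=
  haveI : FiniteDimensional ℝ (TangentSpace 𝓘(ℝ, E) x) := inferInstanceAs (FiniteDimensional ℝ E)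
  haveI : T2Space (TangentSpace 𝓘(ℝ, E) x) := inferInstanceAs (T2Space E)
  if hY : MDiffAt (T% Y) x then
    LinearMap.toContinuousLinearMap
      ((1 / 2 : ℝ) • g.sharp x ∘ₗ (g.koszulForm Y hY).toLinearMap)
  else 0

theorem two_inner_leviCivitaFun (g : RiemMetric E M) {X Y Z : VecField E M} {x : M}
    (hX : MDiffAt (T% X) x) (hY : MDiffAt (T% Y) x) (hZ : MDiffAt (T% Z) x) :
    2 * g.inner x (g.leviCivitaFun Y x (X x)) (Z x) = g.koszul X Y Z x := by
  have h : g.koszulForm Y hY (X x) (Z x) = g.koszul X Y Z x :=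
    TensorialAt.mkHom₂_apply _ _ hX hZ
  simp [leviCivitaFun, hY, g.inner_sharp, h]

/-- The Levi-Civita connection of `g`. The Mathlib convention is `g.leviCivita Y x (X x) = (∇_X Y)(x)`.
It is torsion-free and metric, see `leviCivita_torsion` and `leviCivita_metric`. -/
def leviCivita (g : RiemMetric E M) :
    CovariantDerivative 𝓘(ℝ, E) E (fun x : M => TangentSpace 𝓘(ℝ, E) x) where
  toFun := g.leviCivitaFun
  isCovariantDerivativeOnUniv :=
    { add := fun {Y Y' x} hY hY' _ => by
        refine ContinuousLinearMap.ext fun v => g.ext_inner fun z => ?_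
        have hv := FiberBundle.mdifferentiableAt_extend 𝓘(ℝ, E) E v
        have hz := FiberBundle.mdifferentiableAt_extend 𝓘(ℝ, E) E z
        have h1 := g.two_inner_leviCivitaFun hv (mdifferentiableAt_add_section hY hY') hz
        have h2 := g.two_inner_leviCivitaFun hv hY hz
        have h3 := g.two_inner_leviCivitaFun hv hY' hz
        rw [g.koszul_add_mid hv hY hY' hz] at h1
        simp only [FiberBundle.extend_apply_self] at h1 h2 h3
        simp
        linarith
      leibniz := fun {Y f x} hY hf _ => by
        refine ContinuousLinearMap.ext fun v => g.ext_inner fun z => ?_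
        have hv := FiberBundle.mdifferentiableAt_extend 𝓘(ℝ, E) E v
        have hz := FiberBundle.mdifferentiableAt_extend 𝓘(ℝ, E) E z
        have h1 := g.two_inner_leviCivitaFun hv (hf.smul_section hY) hz
        have h2 := g.two_inner_leviCivitaFun hv hY hz
        rw [g.koszul_smul_mid hv hY hz hf] at h1
        simp only [FiberBundle.extend_apply_self] at h1 h2
        simp
        linear_combination (1 / 2 : ℝ) * h1 - (f x / 2) * h2 }

theorem leviCivita_torsion (g : RiemMetric E M) : g.leviCivita.torsion = 0 := by
  rw [CovariantDerivative.torsion_eq_zero_iff]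
  intro X Y x hX hY
  refine g.ext_inner fun z => ?_
  have hz := FiberBundle.mdifferentiableAt_extend 𝓘(ℝ, E) E z
  have h1 := g.two_inner_leviCivitaFun hX hY hz
  have h2 := g.two_inner_leviCivitaFun hY hX hz
  rw [koszul] at h1 h2
  rw [VectorField.mlieBracket_swap_apply (V := Y) (W := X)] at h2
  have e (A B : VecField E M) : (fun y => g.inner y (A y) (B y)) =
      fun y => g.inner y (B y) (A y) := funext fun y => g.symm y _ _
  rw [e X, e Y, e _ Y] at h2
  simp only [FiberBundle.extend_apply_self, map_neg, neg_apply] at h1 h2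
  simp only [map_sub, sub_apply]
  have h3 : ∀ w, g.leviCivita w = g.leviCivitaFun w := fun _ => rfl
  rw [h3, h3]
  linarith

theorem leviCivita_metric (g : RiemMetric E M) {X Y Z : VecField E M} {x : M}
    (hX : MDiffAt (T% X) x) (hY : MDiffAt (T% Y) x) (hZ : MDiffAt (T% Z) x) :
    mvfderiv 𝓘(ℝ, E) (fun y => g.inner y (Y y) (Z y)) x (X x) =
      g.inner x (g.leviCivita Y x (X x)) (Z x) + g.inner x (Y x) (g.leviCivita Z x (X x)) := by
  have h1 := g.two_inner_leviCivitaFun hX hY hZ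
  have h2 := g.two_inner_leviCivitaFun hX hZ hY
  rw [koszul] at h1 h2
  have e (A B : VecField E M) : (fun y => g.inner y (A y) (B y)) =
      fun y => g.inner y (B y) (A y) := funext fun y => g.symm y _ _
  rw [VectorField.mlieBracket_swap_apply (V := Z) (W := Y), e Z Y, e Y X, e X Z] at h2
  simp only [map_neg, neg_apply] at h2
  have h3 : ∀ w, g.leviCivita w = g.leviCivitaFun w := fun _ => rfl
  rw [h3, h3, g.symm x (Y x)]
  linarith
end RiemMetric

/-- (0,2)-tensors on `M`, as families of functions on pairs of tangent vectors. -/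
abbrev Tensor02 (E M : Type*) [NormedAddCommGroup E] [NormedSpace ℝ E] [TopologicalSpace M]
    [ChartedSpace E M] :=
  (x : M) → TangentSpace 𝓘(ℝ, E) x → TangentSpace 𝓘(ℝ, E) x → ℝ

/-- (1,2)-tensors on `M`, as families of functions on pairs of tangent vectors. -/
abbrev Tensor12 (E M : Type*) [NormedAddCommGroup E] [NormedSpace ℝ E] [TopologicalSpace M]
    [ChartedSpace E M] :=
  (x : M) → TangentSpace 𝓘(ℝ, E) x → TangentSpace 𝓘(ℝ, E) x → TangentSpace 𝓘(ℝ, E) x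

namespace RiemMetric

/-- Divergence of a vector field, `div ξ = Tr(∇ξ)`. -/
def div (g : RiemMetric E M) (ξ : VecField E M) (x : M) : ℝ :=
  LinearMap.trace ℝ (TangentSpace 𝓘(ℝ, E) x) (g.leviCivita ξ x).toLinearMap

/-- `Tr_g B = ∑_c B(e_c, e_c)`, `(e_c)` an orthonormal basis of `T_x M`. -/
def trace (g : RiemMetric E M) (B : Tensor02 E M) (x : M) : ℝ :=
  ∑ c, B x (g.orthonormalFrame ⊤ c) (g.orthonormalFrame ⊤ c)

/-- The inner product `⟨B, S⟩ = ∑_{c,d} B(e_c, e_d) S(e_c, e_d)` of (0,2)-tensors. -/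
def pairing (g : RiemMetric E M) (B S : Tensor02 E M) (x : M) : ℝ :=
  ∑ c, ∑ d, B x (g.orthonormalFrame ⊤ c) (g.orthonormalFrame ⊤ d) *
    S x (g.orthonormalFrame ⊤ c) (g.orthonormalFrame ⊤ d)

/-- The vector field `⟨P, S⟩ = ∑_{c,d} S(e_c, e_d) P(e_c, e_d)`. -/
def contract (g : RiemMetric E M) (P : Tensor12 E M) (S : Tensor02 E M) : VecField E M :=
  fun x => ∑ c, ∑ d, S x (g.orthonormalFrame ⊤ c) (g.orthonormalFrame ⊤ d) •
    P x (g.orthonormalFrame ⊤ c) (g.orthonormalFrame ⊤ d)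

/-- The covariant derivative of a (1,2)-tensor:
`(∇_w P)(u, v) = ∇_w (P(U, V)) - P(∇_w U, v) - P(u, ∇_w V)`, where the vector fields `U`, `V`
extend `u`, `v`. -/
def covDeriv (g : RiemMetric E M) (P : Tensor12 E M) (x : M)
    (w u v : TangentSpace 𝓘(ℝ, E) x) : TangentSpace 𝓘(ℝ, E) x :=
  let U : VecField E M := FiberBundle.extend E u
  let V : VecField E M := FiberBundle.extend E v
  g.leviCivita (fun y => P y (U y) (V y)) x w
    - P x (g.leviCivita U x w) v - P x u (g.leviCivita V x w)

/-- Divergence of a (1,2)-tensor, `(div P)(u, v) = ∑_c g((∇_{e_c} P)(u, v), e_c)`. -/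
def divTensor (g : RiemMetric E M) (P : Tensor12 E M) : Tensor02 E M :=
  fun x u v => ∑ c, g.inner x (g.covDeriv P x (g.orthonormalFrame ⊤ c) u v)
    (g.orthonormalFrame ⊤ c)

/-- The operator `L` on `T_x M` dual to the (1,2)-tensor `P` with respect to `z`, i.e.
`g(L u, v) = g(P(u, v), z)` for all `v`. -/
def dualOp (g : RiemMetric E M) (P : Tensor12 E M) (x : M)
    (z u : TangentSpace 𝓘(ℝ, E) x) : TangentSpace 𝓘(ℝ, E) x :=
  ∑ c, g.inner x (P x u (g.orthonormalFrame ⊤ c)) z • g.orthonormalFrame ⊤ c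

end RiemMetric

/-- `F` is a smooth distribution of rank `k`: it has smooth local frames. -/
def IsSmoothDistribution (k : ℕ) (F : (x : M) → Submodule ℝ (TangentSpace 𝓘(ℝ, E) x)) : Prop :=
  ∀ x : M, ∃ U ∈ 𝓝 x, ∃ X : Fin k → VecField E M,
    (∀ i, ContMDiffOn 𝓘(ℝ, E) (𝓘(ℝ, E).prod 𝓘(ℝ, E)) ∞
      (fun y => TotalSpace.mk' E y (X i y)) U) ∧
    ∀ y ∈ U, LinearIndependent ℝ (fun i => X i y) ∧
      Submodule.span ℝ (Set.range fun i => X i y) = F y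

/-- A pair of complementary smooth distributions on `M`: `dtop` of rank `n` (written `𝒟̃` on paper)
and `dperp` of rank `p` (written `𝒟`). -/
structure AlmostProduct (E M : Type*) [NormedAddCommGroup E] [NormedSpace ℝ E]
    [TopologicalSpace M] [ChartedSpace E M] [IsManifold 𝓘(ℝ, E) ∞ M] (n p : ℕ) where
  dtop : (x : M) → Submodule ℝ (TangentSpace 𝓘(ℝ, E) x)
  dperp : (x : M) → Submodule ℝ (TangentSpace 𝓘(ℝ, E) x)
  smooth_top : IsSmoothDistribution n dtop
  smooth_perp : IsSmoothDistribution p dperp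
  isCompl : ∀ x, IsCompl (dtop x) (dperp x)

namespace AlmostProduct

variable {n p : ℕ}

/-- The same pair with the roles of `𝒟̃` and `𝒟` exchanged. Below, the quantities `h, H, T, …` of
`𝒟̃` are attached to `A`; the quantities `h̃, H̃, T̃, …` of `𝒟` are those of `A.swap`. -/
def swap (A : AlmostProduct E M n p) : AlmostProduct E M p n where
  dtop := A.dperp
  dperp := A.dtop
  smooth_top := A.smooth_perp
  smooth_perp := A.smooth_top
  isCompl x := (A.isCompl x).symm

/-- `u ↦ u^⊤`, the component along `𝒟̃`. -/
def projTop (A : AlmostProduct E M n p) (x : M) :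
    TangentSpace 𝓘(ℝ, E) x →ₗ[ℝ] TangentSpace 𝓘(ℝ, E) x :=
  (A.dtop x).projection (A.dperp x) (A.isCompl x)

/-- `u ↦ u^⊥`, the component along `𝒟`. -/
def projPerp (A : AlmostProduct E M n p) (x : M) :
    TangentSpace 𝓘(ℝ, E) x →ₗ[ℝ] TangentSpace 𝓘(ℝ, E) x :=
  (A.dperp x).projection (A.dtop x) (A.isCompl x).symm

/-- A section of `𝒟̃` with the value `u^⊤` at `x`. -/
def extendTop (A : AlmostProduct E M n p) {x : M} (u : TangentSpace 𝓘(ℝ, E) x) : VecField E M :=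
  fun y => A.projTop y (FiberBundle.extend E u y)

/-- The second fundamental form `h(X, Y) = (1/2) (∇_X Y + ∇_Y X)^⊥` of `𝒟̃` (`X, Y` sections of
`𝒟̃`), extended to all of `TM` by `h(u, v) = h(u^⊤, v^⊤)`. -/
def h (A : AlmostProduct E M n p) (g : RiemMetric E M) : Tensor12 E M :=
  fun x u v => (1 / 2 : ℝ) • A.projPerp x
    (g.leviCivita (A.extendTop v) x (A.extendTop u x)
      + g.leviCivita (A.extendTop u) x (A.extendTop v x))

/-- The integrability tensor `T(X, Y) = (1/2) [X, Y]^⊥` of `𝒟̃` (`X, Y` sections of `𝒟̃`),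
extended to all of `TM` by `T(u, v) = T(u^⊤, v^⊤)`. -/
def T (A : AlmostProduct E M n p) : Tensor12 E M :=
  fun x u v => (1 / 2 : ℝ) • A.projPerp x
    (VectorField.mlieBracket 𝓘(ℝ, E) (A.extendTop u) (A.extendTop v) x)

/-- The mean curvature vector field `H = Tr_g h` of `𝒟̃`. -/
def H (A : AlmostProduct E M n p) (g : RiemMetric E M) : VecField E M :=
  fun x => ∑ a, A.h g x (g.orthonormalFrame (A.dtop x) a) (g.orthonormalFrame (A.dtop x) a)

/-- `‖h‖² = ∑_{a,b} ‖h(E_a, E_b)‖²`, `(E_a)` an orthonormal basis of `𝒟̃_x`. -/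
def normSqh (A : AlmostProduct E M n p) (g : RiemMetric E M) (x : M) : ℝ :=
  ∑ a, ∑ b,
    g.inner x (A.h g x (g.orthonormalFrame (A.dtop x) a) (g.orthonormalFrame (A.dtop x) b))
      (A.h g x (g.orthonormalFrame (A.dtop x) a) (g.orthonormalFrame (A.dtop x) b))

/-- `‖T‖² = ∑_{a,b} ‖T(E_a, E_b)‖²`. -/
def normSqT (A : AlmostProduct E M n p) (g : RiemMetric E M) (x : M) : ℝ :=
  ∑ a, ∑ b,
    g.inner x (A.T x (g.orthonormalFrame (A.dtop x) a) (g.orthonormalFrame (A.dtop x) b))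
      (A.T x (g.orthonormalFrame (A.dtop x) a) (g.orthonormalFrame (A.dtop x) b))

/-- `‖H‖²`. -/
def normSqH (A : AlmostProduct E M n p) (g : RiemMetric E M) (x : M) : ℝ :=
  g.inner x (A.H g x) (A.H g x)

/-- The Weingarten operator `A_z` of `𝒟̃`: `g(A_z u, v) = g(h(u, v), z)`. -/
def weingarten (A : AlmostProduct E M n p) (g : RiemMetric E M) (x : M)
    (z u : TangentSpace 𝓘(ℝ, E) x) : TangentSpace 𝓘(ℝ, E) x :=
  g.dualOp (A.h g) x z u

/-- The operator `T^♯_z`: `g(T^♯_z u, v) = g(T(u, v), z)`. -/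
def Tsharp (A : AlmostProduct E M n p) (g : RiemMetric E M) (x : M)
    (z u : TangentSpace 𝓘(ℝ, E) x) : TangentSpace 𝓘(ℝ, E) x :=
  g.dualOp A.T x z u

/-- The (0,2)-tensor `𝒯^♭` of the Casorati type operator `𝒯 = ∑_i (T^♯_{ℰ_i})²`, `(ℰ_i)` an
orthonormal basis of `𝒟_x`. -/
def casoratiTFlat (A : AlmostProduct E M n p) (g : RiemMetric E M) : Tensor02 E M :=
  fun x u v => g.inner x
    (∑ i, A.Tsharp g x (g.orthonormalFrame (A.dperp x) i)
      (A.Tsharp g x (g.orthonormalFrame (A.dperp x) i) u)) v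

/-- The (0,2)-tensor `𝒦^♭` of `𝒦 = ∑_i [T^♯_{ℰ_i}, A_{ℰ_i}]`. -/
def KFlat (A : AlmostProduct E M n p) (g : RiemMetric E M) : Tensor02 E M :=
  fun x u v => g.inner x
    (∑ i, (A.Tsharp g x (g.orthonormalFrame (A.dperp x) i)
        (A.weingarten g x (g.orthonormalFrame (A.dperp x) i) u)
      - A.weingarten g x (g.orthonormalFrame (A.dperp x) i)
        (A.Tsharp g x (g.orthonormalFrame (A.dperp x) i) u))) v

/-- `Φ_h = H^♭ ⊗ H^♭ - ∑_{a,b} h(E_a,E_b)^♭ ⊗ h(E_a,E_b)^♭`, i.e. the symmetric tensor with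
`⟨Φ_h, S⟩ = S(H, H) - ∑_{a,b} S(h(E_a,E_b), h(E_a,E_b))` for all `S`. -/
def Phih (A : AlmostProduct E M n p) (g : RiemMetric E M) : Tensor02 E M :=
  fun x u v => g.inner x (A.H g x) u * g.inner x (A.H g x) v
    - ∑ a, ∑ b,
      g.inner x (A.h g x (g.orthonormalFrame (A.dtop x) a) (g.orthonormalFrame (A.dtop x) b)) u *
      g.inner x (A.h g x (g.orthonormalFrame (A.dtop x) a) (g.orthonormalFrame (A.dtop x) b)) v

/-- `Φ_T = - ∑_{a,b} T(E_a,E_b)^♭ ⊗ T(E_a,E_b)^♭`, i.e. the symmetric tensor with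
`⟨Φ_T, S⟩ = - ∑_{a,b} S(T(E_a,E_b), T(E_a,E_b))` for all `S`. -/
def PhiT (A : AlmostProduct E M n p) (g : RiemMetric E M) : Tensor02 E M :=
  fun x u v => - ∑ a, ∑ b,
      g.inner x (A.T x (g.orthonormalFrame (A.dtop x) a) (g.orthonormalFrame (A.dtop x) b)) u *
      g.inner x (A.T x (g.orthonormalFrame (A.dtop x) a) (g.orthonormalFrame (A.dtop x) b)) v

/-- `g^⊥(u, v) = g(u^⊥, v^⊥)`. -/
def metricPerp (A : AlmostProduct E M n p) (g : RiemMetric E M) : Tensor02 E M :=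
  fun x u v => g.inner x (A.projPerp x u) (A.projPerp x v)

/-- `S` is `𝒟`-truncated: `S(u, ·) = 0 = S(·, u)` for `u` in `𝒟̃`. -/
def IsPerpTruncated (A : AlmostProduct E M n p) (S : Tensor02 E M) : Prop :=
  ∀ x, ∀ u ∈ A.dtop x, ∀ v, S x u v = 0 ∧ S x v u = 0

/-- `g` is adapted: `𝒟̃` and `𝒟` are `g`-orthogonal. -/
def IsAdapted (A : AlmostProduct E M n p) (g : RiemMetric E M) : Prop :=
  ∀ x, ∀ u ∈ A.dtop x, ∀ v ∈ A.dperp x, g.inner x u v = 0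

/-- `g_t`, `|t| < ε`, is a smooth one-parameter variation through adapted metrics; smoothness is joint
in `(t, x)`. -/
structure IsAdaptedVariation (A : AlmostProduct E M n p) (ε : ℝ) (g : ℝ → RiemMetric E M) :
    Prop where
  smooth : ContMDiffOn (𝓘(ℝ, ℝ).prod 𝓘(ℝ, E)) (𝓘(ℝ, E).prod 𝓘(ℝ, E →L[ℝ] E →L[ℝ] ℝ)) ∞
    (fun q : ℝ × M => TotalSpace.mk' (E →L[ℝ] E →L[ℝ] ℝ)
      (E := fun x : M => TangentSpace 𝓘(ℝ, E) x →L[ℝ] TangentSpace 𝓘(ℝ, E) x →L[ℝ] ℝ)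
      q.2 ((g q.1).inner q.2))
    (Set.Ioo (-ε) ε ×ˢ Set.univ)
  adapted : ∀ t, |t| < ε → A.IsAdapted (g t)

end AlmostProduct

/-- `S_t = ∂_t g_t`. -/
def dtMetric (g : ℝ → RiemMetric E M) (t : ℝ) : Tensor02 E M :=
  fun x u v => deriv (fun τ => (g τ).inner x u v) t

end

/-!
The invariants `h`, `H`, `T` of `𝒟̃` (those of `𝒟` are obtained by applying everything to the swapped
pair of distributions) are computed in smooth frames `W` of `𝒟̃` and `Z` of `𝒟` that are orthonormal
for `g_t` at the time `t` under consideration (`exists_isAdaptedFrame`).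

*Differentiation in time.* The frame stays fixed while the metric moves. For sections of the
two distributions, `g(h(U, V), Z) = -(1/2) (L_Z g)(U, V)` (`IsAdapted.inner_h`), in which the
Levi-Civita connection no longer occurs. As partial derivatives in `t` and in `x` commute, it follows
that `∂_t g(h(W_a, W_b), Z_i) = -(1/2) (L_{Z_i} S)(W_a, W_b)` (`hasDerivAt_inner_h`). The tensor `T`
does not depend on the metric. The norms are taken over orthonormal bases of `g_τ`, on whose choice
nothing may be assumed; but a trace over such a basis is a double sum over the fixed frame with the
inverse Gram matrix as coefficients, and this inverse has derivative `-S` at `t`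
(`hasDerivAt_transitionSq`). Together this gives the derivatives of `‖h‖²`, `‖T‖²` and `‖H‖²` for every
adapted variation (`hasDerivAt_normSqh`, `hasDerivAt_normSqT`, `hasDerivAt_normSqH`).

*Truncated variations.* If `S` vanishes on `𝒟̃`, then `L_{Z_i} S` and the components of `S` on `𝒟̃`
vanish, and only the terms `S(h(W_a, W_b), h(W_a, W_b))`, `S(H, H)`, `S(T(W_a, W_b), T(W_a, W_b))` are
left. If `S` vanishes on `𝒟`, these terms are zero instead. Then `L_{Z_i} S` is expanded with
`g([Z_i, W_a], W_c) = g(∇_{Z_i} W_a, W_c) + g(h(W_a, W_c) + T(W_a, W_c), Z_i)`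
(`IsAdaptedFrame.inner_mlieBracket`), and `div h`, `div ⟨h, S⟩` are expanded by the Leibniz rule
(`IsAdaptedFrame.divTensor_h`, `IsAdaptedFrame.div_contract`). The derivatives of `S` and the
divergences of the fields `h(W_a, W_b)` cancel. What remains is, for each normal direction, an identity
between traces of products of matrices (`sum_connection_identity`), a consequence of the
symmetry of `h` and `S` and the skew-symmetry of `T` and of the connection matrix.

*Conformal variations.* Those along `𝒟` are truncated variations with `S(v, v) = s g(v, v)` for `v` in
`𝒟`, so that the formulas are immediate. In those along `𝒟̃`, `S(W_a, W_b) = s δ_ab`, hence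
`⟨h, S⟩ = s H` and `Tr_g S = n s`; the traces of `𝒦` and of the connection terms in `div h`
vanish, as contractions of symmetric with skew-symmetric matrices.
-/

noncomputable section

variable {E : Type*} [NormedAddCommGroup E] [NormedSpace ℝ E] [FiniteDimensional ℝ E]
  {M : Type*} [TopologicalSpace M] [ChartedSpace E M] [IsManifold 𝓘(ℝ, E) ∞ M]

/-! ### Bilinear sums over orthonormal bases -/

namespace RiemMetric

/-- The family `e` is a `g_x`-orthonormal basis of the subspace `F` of `T_x M`. Spanning is encoded
by the Fourier expansion `sum_repr`. -/
structure IsOrthonormalBasis (g : RiemMetric E M) {x : M} {ι : Type*} [Fintype ι] [DecidableEq ι]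
    (F : Submodule ℝ (TangentSpace 𝓘(ℝ, E) x)) (e : ι → TangentSpace 𝓘(ℝ, E) x) : Prop where
  mem : ∀ i, e i ∈ F
  inner : ∀ i j, g.inner x (e i) (e j) = if i = j then 1 else 0
  sum_repr : ∀ v ∈ F, ∑ i, g.inner x (e i) v • e i = v

theorem isOrthonormalBasis_orthonormalFrame (g : RiemMetric E M) {x : M}
    (F : Submodule ℝ (TangentSpace 𝓘(ℝ, E) x)) :
    g.IsOrthonormalBasis F (g.orthonormalFrame F) :=
  ⟨g.orthonormalFrame_mem F, g.orthonormalFrame_inner F, fun _ hv => g.orthonormalFrame_sum F hv⟩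

end RiemMetric

namespace IsBilinearMap

variable {V A : Type*} [AddCommGroup V] [Module ℝ V] [AddCommGroup A] [Module ℝ A]
  {β : V → V → A}

theorem map_sum_left (hβ : IsBilinearMap ℝ β) {ι : Type*} (s : Finset ι) (f : ι → V) (v : V) :
    β (∑ i ∈ s, f i) v = ∑ i ∈ s, β (f i) v := by
  have := map_sum (hβ.toLinearMap.flip v) f s
  exact this

theorem map_sum_right (hβ : IsBilinearMap ℝ β) {ι : Type*} (s : Finset ι) (f : ι → V) (v : V) :
    β v (∑ i ∈ s, f i) = ∑ i ∈ s, β v (f i) := by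
  have := map_sum (hβ.toLinearMap v) f s
  exact this

end IsBilinearMap

namespace RiemMetric

variable {A : Type*} [AddCommGroup A] [Module ℝ A]

/-- The matrix `Q_ab = ∑_c g(w_a, e_c) g(w_b, e_c)` by which a trace over the basis `e` is written
as a double sum over the basis `w`. -/
def transitionSq (g : RiemMetric E M) {x : M} {ι κ : Type*} [Fintype κ]
    (w : ι → TangentSpace 𝓘(ℝ, E) x) (e : κ → TangentSpace 𝓘(ℝ, E) x) : Matrix ι ι ℝ :=
  Matrix.of fun a b => ∑ c, g.inner x (w a) (e c) * g.inner x (w b) (e c)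

namespace IsOrthonormalBasis

variable {g g' : RiemMetric E M} {x : M} {ι κ : Type*} [Fintype ι] [DecidableEq ι]
  [Fintype κ] [DecidableEq κ] {F : Submodule ℝ (TangentSpace 𝓘(ℝ, E) x)}
  {w : ι → TangentSpace 𝓘(ℝ, E) x} {e : κ → TangentSpace 𝓘(ℝ, E) x}

/-- The expansion of `β(u, v)` in components with respect to the basis `w`. -/
theorem bilin_apply (hw : g.IsOrthonormalBasis F w)
    {β : TangentSpace 𝓘(ℝ, E) x → TangentSpace 𝓘(ℝ, E) x → A} (hβ : IsBilinearMap ℝ β)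
    {u v : TangentSpace 𝓘(ℝ, E) x} (hu : u ∈ F) (hv : v ∈ F) :
    β u v = ∑ a, ∑ b, (g.inner x (w a) u * g.inner x (w b) v) • β (w a) (w b) := by
  conv_lhs => rw [← hw.sum_repr u hu, ← hw.sum_repr v hv]
  simp only [hβ.map_sum_left, hβ.map_sum_right, hβ.smul_left, hβ.smul_right, mul_smul]

theorem linearIndependent (hw : g.IsOrthonormalBasis F w) : LinearIndependent ℝ w := by
  rw [Fintype.linearIndependent_iff]
  intro c hc i
  have h := congrArg (g.inner x (w i)) hc
  simpa [hw.inner] using h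

/-- The trace of `β` over a basis `e` that is orthonormal for another metric `g'`, written in the
fixed basis `w`: all dependence on `e` is in the matrix `transitionSq`. -/
theorem sum_diag (hw : g.IsOrthonormalBasis F w) (he : g'.IsOrthonormalBasis F e)
    {β : TangentSpace 𝓘(ℝ, E) x → TangentSpace 𝓘(ℝ, E) x → A} (hβ : IsBilinearMap ℝ β) :
    ∑ c, β (e c) (e c) = ∑ a, ∑ b, g.transitionSq w e a b • β (w a) (w b) := by
  simp only [fun c => hw.bilin_apply hβ (he.mem c) (he.mem c)]
  rw [Finset.sum_comm]
  refine Finset.sum_congr rfl fun a _ => ?_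
  rw [Finset.sum_comm]
  simp [transitionSq, Finset.sum_smul]

/-- The transition matrix inverts the Gram matrix of the old basis in the new metric. -/
theorem transitionSq_mul_gram (hw : g.IsOrthonormalBasis F w) (he : g'.IsOrthonormalBasis F e) :
    g.transitionSq w e * Matrix.of (fun a b => g'.inner x (w a) (w b)) = 1 := by
  ext a d
  have h : ∀ c, ∑ b, g.inner x (w b) (e c) * g'.inner x (w b) (w d) = g'.inner x (e c) (w d) := by
    intro c
    conv_rhs => rw [← hw.sum_repr (e c) (he.mem c)]
    simp
  calc _ = ∑ c, g.inner x (w a) (e c) * ∑ b, g.inner x (w b) (e c) * g'.inner x (w b) (w d) := by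
        simp only [Matrix.mul_apply, transitionSq, Matrix.of_apply, Finset.sum_mul, Finset.mul_sum,
          mul_assoc]
        exact Finset.sum_comm
    _ = g.inner x (w a) (∑ c, g'.inner x (e c) (w d) • e c) := by
        simp [h, mul_comm]
    _ = _ := by
        rw [he.sum_repr _ (hw.mem d), hw.inner, Matrix.one_apply]

theorem transitionSq_self (hw : g.IsOrthonormalBasis F w) (he : g.IsOrthonormalBasis F e) :
    g.transitionSq w e = 1 := by
  have h := hw.transitionSq_mul_gram he
  have h1 : Matrix.of (fun a b => g.inner x (w a) (w b)) = (1 : Matrix ι ι ℝ) := by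
    ext a b
    simp [hw.inner, Matrix.one_apply]
  rwa [h1, mul_one] at h

/-- The trace of a bilinear map does not depend on the orthonormal basis. -/
theorem sum_diag_eq (hw : g.IsOrthonormalBasis F w) (he : g.IsOrthonormalBasis F e)
    {β : TangentSpace 𝓘(ℝ, E) x → TangentSpace 𝓘(ℝ, E) x → A} (hβ : IsBilinearMap ℝ β) :
    ∑ c, β (e c) (e c) = ∑ a, β (w a) (w a) := by
  rw [hw.sum_diag he hβ, hw.transitionSq_self he]
  simp [Matrix.one_apply]

/-- The double trace of a product of two bilinear maps, in terms of another basis. -/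
theorem sum_diag₂ (hw : g.IsOrthonormalBasis F w) (he : g'.IsOrthonormalBasis F e)
    {γ : TangentSpace 𝓘(ℝ, E) x → TangentSpace 𝓘(ℝ, E) x →
      TangentSpace 𝓘(ℝ, E) x → TangentSpace 𝓘(ℝ, E) x → A}
    (h₁ : ∀ v v', IsBilinearMap ℝ fun u u' => γ u v u' v')
    (h₂ : ∀ u u', IsBilinearMap ℝ fun v v' => γ u v u' v') :
    ∑ c, ∑ d, γ (e c) (e d) (e c) (e d) = ∑ a, ∑ a', ∑ b, ∑ b',
      (g.transitionSq w e a a' * g.transitionSq w e b b') • γ (w a) (w b) (w a') (w b') := by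
  have h3 : IsBilinearMap ℝ fun u u' => ∑ d, γ u (e d) u' (e d) :=
    { add_left := fun u₁ u₂ u' => by simp only [(h₁ _ _).add_left, Finset.sum_add_distrib]
      smul_left := fun r u u' => by simp only [(h₁ _ _).smul_left, Finset.smul_sum]
      add_right := fun u u₁ u₂ => by simp only [(h₁ _ _).add_right, Finset.sum_add_distrib]
      smul_right := fun r u u' => by simp only [(h₁ _ _).smul_right, Finset.smul_sum] }
  rw [hw.sum_diag he h3]
  simp only [fun u u' => hw.sum_diag he (h₂ u u'), Finset.smul_sum, mul_smul]

end IsOrthonormalBasis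

/-! ### Smooth orthonormal frames -/

theorem contMDiffAt_inner (g : RiemMetric E M) {X Y : VecField E M} {x : M}
    (hX : CMDiffAt ∞ (T% X) x) (hY : CMDiffAt ∞ (T% Y) x) :
    CMDiffAt ∞ (fun y => g.inner y (X y) (Y y)) x := by
  have h : ContMDiffAt 𝓘(ℝ, E) (𝓘(ℝ, E).prod 𝓘(ℝ)) ∞
      (fun y => TotalSpace.mk' ℝ (E := Bundle.Trivial M ℝ) y (g.inner y (X y) (Y y))) x := by
    apply ContMDiffAt.clm_bundle_apply₂ (F₁ := E) (F₂ := E)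
    · exact g.contMDiff.contMDiffAt
    · exact hX
    · exact hY
  rw [contMDiffAt_totalSpace] at h
  exact h.2

/-- The Gram–Schmidt process applied pointwise to a family of vector fields. -/
def gramSchmidtField (g : RiemMetric E M) {k : ℕ} (X : Fin k → VecField E M) (i : Fin k) :
    VecField E M := fun y =>
  letI : RiemannianBundle (fun x : M => TangentSpace 𝓘(ℝ, E) x) := ⟨g.toRiemannianMetric⟩
  InnerProductSpace.gramSchmidt ℝ (fun j => X j y) i

theorem gramSchmidtField_apply (g : RiemMetric E M) {k : ℕ} (X : Fin k → VecField E M) (i : Fin k)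
    (y : M) : g.gramSchmidtField X i y = X i y - ∑ j ∈ Finset.Iio i,
      (g.inner y (g.gramSchmidtField X j y) (X i y) /
        g.inner y (g.gramSchmidtField X j y) (g.gramSchmidtField X j y)) •
        g.gramSchmidtField X j y := by
  let _ : RiemannianBundle (fun x : M => TangentSpace 𝓘(ℝ, E) x) := ⟨g.toRiemannianMetric⟩
  have h := InnerProductSpace.gramSchmidt_def'' ℝ (fun j => X j y) i
  rw [eq_sub_iff_add_eq]
  refine Eq.trans ?_ h.symm
  congr 1
  refine Finset.sum_congr rfl fun j _ => ?_
  congr 2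
  exact real_inner_self_eq_norm_sq (F := TangentSpace 𝓘(ℝ, E) y) _

theorem gramSchmidtField_ne_zero (g : RiemMetric E M) {k : ℕ} {X : Fin k → VecField E M} {y : M}
    (hli : LinearIndependent ℝ fun i => X i y) (i : Fin k) : g.gramSchmidtField X i y ≠ 0 := by
  let _ : RiemannianBundle (fun x : M => TangentSpace 𝓘(ℝ, E) x) := ⟨g.toRiemannianMetric⟩
  exact InnerProductSpace.gramSchmidt_ne_zero i hli

theorem contMDiffAt_gramSchmidtField (g : RiemMetric E M) {k : ℕ} {X : Fin k → VecField E M}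
    {x : M} (hX : ∀ i, CMDiffAt ∞ (T% (X i)) x) (hli : LinearIndependent ℝ fun i => X i x)
    (i : Fin k) : CMDiffAt ∞ (T% (g.gramSchmidtField X i)) x := by
  induction i using WellFoundedLT.induction with
  | ind i ih =>
    have h1 : CMDiffAt ∞ (T% (fun y => ∑ j ∈ Finset.Iio i,
        (g.inner y (g.gramSchmidtField X j y) (X i y) /
          g.inner y (g.gramSchmidtField X j y) (g.gramSchmidtField X j y)) •
          g.gramSchmidtField X j y)) x := by
      refine ContMDiffAt.sum_section fun j hj => ?_
      have hj := ih j (Finset.mem_Iio.1 hj)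
      exact ((g.contMDiffAt_inner hj (hX i)).div₀ (g.contMDiffAt_inner hj hj)
        (g.pos x _ (g.gramSchmidtField_ne_zero hli j)).ne').smul_section hj
    exact ((hX i).sub_section h1).congr_of_eventuallyEq
      (.of_forall fun y => by simp [g.gramSchmidtField_apply X i y])

/-- The normalized Gram–Schmidt process applied pointwise to a family of vector fields. -/
def gramSchmidtNormedField (g : RiemMetric E M) {k : ℕ} (X : Fin k → VecField E M) (i : Fin k) :
    VecField E M :=
  (fun y => (√(g.inner y (g.gramSchmidtField X i y) (g.gramSchmidtField X i y)))⁻¹) •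
    g.gramSchmidtField X i

theorem contMDiffAt_gramSchmidtNormedField (g : RiemMetric E M) {k : ℕ} {X : Fin k → VecField E M}
    {x : M} (hX : ∀ i, CMDiffAt ∞ (T% (X i)) x) (hli : LinearIndependent ℝ fun i => X i x)
    (i : Fin k) : CMDiffAt ∞ (T% (g.gramSchmidtNormedField X i)) x := by
  have h1 := g.contMDiffAt_gramSchmidtField hX hli i
  have hpos := g.pos x _ (g.gramSchmidtField_ne_zero hli i)
  refine ContMDiffAt.smul_section (ContMDiffAt.inv₀ ?_ (Real.sqrt_pos.2 hpos).ne') h1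
  exact (Real.contDiffAt_sqrt hpos.ne').contMDiffAt.comp x (g.contMDiffAt_inner h1 h1)

theorem isOrthonormalBasis_gramSchmidtNormedField (g : RiemMetric E M) {k : ℕ}
    {X : Fin k → VecField E M} {y : M} {F : Submodule ℝ (TangentSpace 𝓘(ℝ, E) y)}
    (hli : LinearIndependent ℝ fun i => X i y)
    (hspan : Submodule.span ℝ (Set.range fun i => X i y) = F) :
    g.IsOrthonormalBasis F (fun i => g.gramSchmidtNormedField X i y) := by
  let _ : RiemannianBundle (fun x : M => TangentSpace 𝓘(ℝ, E) x) := ⟨g.toRiemannianMetric⟩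
  have hV : (fun i => g.gramSchmidtNormedField X i y) =
      InnerProductSpace.gramSchmidtNormed ℝ (fun i => X i y) := by
    ext i
    have h1 : √(g.inner y (g.gramSchmidtField X i y) (g.gramSchmidtField X i y)) =
      ‖g.gramSchmidtField X i y‖ := (norm_eq_sqrt_real_inner (F := TangentSpace 𝓘(ℝ, E) y) _).symm
    simp only [gramSchmidtNormedField, Pi.smul_apply', h1]
    rfl
  have ho := InnerProductSpace.gramSchmidtNormed_orthonormal hli
  have hs := (InnerProductSpace.span_gramSchmidtNormed_range (𝕜 := ℝ) (fun i => X i y)).trans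
    ((InnerProductSpace.span_gramSchmidt ℝ _).trans hspan)
  rw [← hV] at ho hs
  have hin : ∀ i j, g.inner y (g.gramSchmidtNormedField X i y) (g.gramSchmidtNormedField X j y) =
      if i = j then 1 else 0 := orthonormal_iff_ite.1 ho
  refine ⟨fun i => hs ▸ Submodule.subset_span ⟨i, rfl⟩, hin, fun v hv => ?_⟩
  rw [← hs] at hv
  obtain ⟨c, rfl⟩ := (Submodule.mem_span_range_iff_exists_fun ℝ).1 hv
  simp [hin]

end RiemMetric

/-- Every smooth distribution has smooth orthonormal frames near each point. -/
theorem IsSmoothDistribution.exists_orthonormal_frame {k : ℕ}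
    {F : (x : M) → Submodule ℝ (TangentSpace 𝓘(ℝ, E) x)} (hF : IsSmoothDistribution k F)
    (g : RiemMetric E M) (x : M) :
    ∃ U : Set M, IsOpen U ∧ x ∈ U ∧ ∃ W : Fin k → VecField E M, ∀ y ∈ U,
      (∀ i, CMDiffAt ∞ (T% (W i)) y) ∧ g.IsOrthonormalBasis (F y) fun i => W i y := by
  obtain ⟨U, hU, X, hX, hXF⟩ := hF x
  refine ⟨interior U, isOpen_interior, mem_interior_iff_mem_nhds.2 hU,
    g.gramSchmidtNormedField X, fun y hy => ?_⟩
  have hyU := mem_interior_iff_mem_nhds.1 hy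
  obtain ⟨hli, hspan⟩ := hXF y (interior_subset hy)
  exact ⟨fun i => g.contMDiffAt_gramSchmidtNormedField (fun j => (hX j).contMDiffAt hyU) hli i,
    g.isOrthonormalBasis_gramSchmidtNormedField hli hspan⟩

/-! ### Time derivatives -/

theorem ContDiffAt.eventually_differentiableAt {f : ℝ × E → ℝ} {q : ℝ × E}
    (hf : ContDiffAt ℝ ∞ f q) : ∀ᶠ q' in 𝓝 q, DifferentiableAt ℝ f q' :=
  ((hf.of_le (m := 2) ENat.LEInfty.out).eventually (by simp)).mono fun _ hq =>
    hq.differentiableAt (by norm_num)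

theorem ContDiffAt.differentiableAt_fderiv {f : ℝ × E → ℝ} {q : ℝ × E} (hf : ContDiffAt ℝ ∞ f q) :
    DifferentiableAt ℝ (fderiv ℝ f) q :=
  ((hf.of_le (m := 2) ENat.LEInfty.out).fderiv_right (m := 1) (by norm_num)).differentiableAt
    (by norm_num)

theorem ContDiffAt.eventuallyEq_deriv_left {f : ℝ × E → ℝ} {t : ℝ} {x : E}
    (hf : ContDiffAt ℝ ∞ f (t, x)) :
    (fun y => deriv (fun τ => f (τ, y)) t) =ᶠ[𝓝 x] fun y => fderiv ℝ f (t, y) (1, 0) := by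
  have hy : ContinuousAt (fun y : E => (t, y)) x := by fun_prop
  filter_upwards [hy.eventually hf.eventually_differentiableAt] with y h
  have := (h.hasFDerivAt.comp t (hasFDerivAt_prodMk_left t y)).hasDerivAt
  rw [show (fun τ => f (τ, y)) = f ∘ fun τ => (τ, y) from rfl, this.deriv]
  simp

/-- The spatial derivative of `∂_t f`, with `∂_t f` written as `Df (1, 0)`. -/
theorem ContDiffAt.hasFDerivAt_deriv_left {f : ℝ × E → ℝ} {t : ℝ} {x : E}
    (hf : ContDiffAt ℝ ∞ f (t, x)) :
    HasFDerivAt (fun y => fderiv ℝ f (t, y) (1, 0))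
      (((fderiv ℝ (fderiv ℝ f) (t, x)).comp (.inr ℝ ℝ E)).flip (1, 0)) x := by
  have h := (HasFDerivAt.comp (g := fderiv ℝ f) x hf.differentiableAt_fderiv.hasFDerivAt
    (hasFDerivAt_prodMk_right t x)).clm_apply (hasFDerivAt_const ((1 : ℝ), (0 : E)) x)
  simpa using h

theorem ContDiffAt.differentiableAt_deriv_left {f : ℝ × E → ℝ} {t : ℝ} {x : E}
    (hf : ContDiffAt ℝ ∞ f (t, x)) :
    DifferentiableAt ℝ (fun y => deriv (fun τ => f (τ, y)) t) x :=
  hf.hasFDerivAt_deriv_left.differentiableAt.congr_of_eventuallyEq hf.eventuallyEq_deriv_left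

/-- Partial derivatives in time and in space commute, in a normed space. -/
theorem ContDiffAt.hasDerivAt_fderiv_comm {f : ℝ × E → ℝ} {t : ℝ} {x : E}
    (hf : ContDiffAt ℝ ∞ f (t, x)) (v : E) :
    HasDerivAt (fun τ => fderiv ℝ (fun y => f (τ, y)) x v)
      (fderiv ℝ (fun y => deriv (fun τ => f (τ, y)) t) x v) t := by
  have hsymm := (hf.of_le (m := 2) ENat.LEInfty.out).isSymmSndFDerivAt (by simp)
  have hτ : ContinuousAt (fun τ : ℝ => (τ, x)) t := by fun_prop
  have e1 : (fun τ => fderiv ℝ (fun y => f (τ, y)) x v) =ᶠ[𝓝 t]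
      fun τ => fderiv ℝ f (τ, x) (0, v) := by
    filter_upwards [hτ.eventually hf.eventually_differentiableAt] with τ h
    have := h.hasFDerivAt.comp x (hasFDerivAt_prodMk_right τ x)
    rw [show (fun y => f (τ, y)) = f ∘ fun y => (τ, y) from rfl, this.fderiv]
    simp
  have h1 := (HasFDerivAt.comp (g := fderiv ℝ f) t hf.differentiableAt_fderiv.hasFDerivAt
    (hasFDerivAt_prodMk_left t x)).clm_apply (hasFDerivAt_const ((0 : ℝ), v) t)
  rw [hf.eventuallyEq_deriv_left.fderiv_eq, hf.hasFDerivAt_deriv_left.fderiv]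
  refine (h1.hasDerivAt.congr_of_eventuallyEq e1).congr_deriv ?_
  simpa using hsymm (1, 0) (0, v)

/-- A smooth function on `ℝ × M` is smooth in the coordinates of a chart of `M`. -/
theorem ContMDiffAt.contDiffAt_comp_extChartAt_symm {f : ℝ × M → ℝ} {t : ℝ} {x : M}
    (hf : ContMDiffAt (𝓘(ℝ, ℝ).prod 𝓘(ℝ, E)) 𝓘(ℝ, ℝ) ∞ f (t, x)) :
    ContDiffAt ℝ ∞ (fun q : ℝ × E => f (q.1, (extChartAt 𝓘(ℝ, E) x).symm q.2))
      (t, extChartAt 𝓘(ℝ, E) x x) := by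
  rw [← contMDiffAt_iff_contDiffAt]
  have h1 : ContMDiffAt 𝓘(ℝ, ℝ × E) 𝓘(ℝ, E) ∞
      (fun q : ℝ × E => (extChartAt 𝓘(ℝ, E) x).symm q.2) (t, extChartAt 𝓘(ℝ, E) x x) := by
    have h2 := (contMDiffOn_extChartAt_symm (I := 𝓘(ℝ, E)) (n := ∞) x).contMDiffAt
      (extChartAt_target_mem_nhds x)
    exact h2.comp (f := fun q : ℝ × E => q.2) (t, extChartAt 𝓘(ℝ, E) x x)
      contDiffAt_snd.contMDiffAt
  refine ContMDiffAt.comp (g := f) (f := fun q : ℝ × E => (q.1, (extChartAt 𝓘(ℝ, E) x).symm q.2))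
    (t, extChartAt 𝓘(ℝ, E) x x) ?_ (contDiffAt_fst.contMDiffAt.prodMk h1)
  simpa using hf

theorem ContMDiffAt.mdifferentiableAt_deriv_left {f : ℝ × M → ℝ} {t : ℝ} {x : M}
    (hf : ContMDiffAt (𝓘(ℝ, ℝ).prod 𝓘(ℝ, E)) 𝓘(ℝ, ℝ) ∞ f (t, x)) :
    MDiffAt (fun y => deriv (fun τ => f (τ, y)) t) x := by
  have h := hf.contDiffAt_comp_extChartAt_symm
  have h1 := h.differentiableAt_deriv_left
  have h2 : MDiffAt ((fun ξ => deriv (fun τ => f (τ, (extChartAt 𝓘(ℝ, E) x).symm ξ)) t) ∘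
      extChartAt 𝓘(ℝ, E) x) x :=
    h1.mdifferentiableAt.comp x (mdifferentiableAt_extChartAt (mem_chart_source E x))
  refine h2.congr_of_eventuallyEq ?_
  filter_upwards [extChartAt_source_mem_nhds (I := 𝓘(ℝ, E)) x] with y hy
  simp only [Function.comp_apply, (extChartAt 𝓘(ℝ, E) x).left_inv hy]

theorem mvfderiv_eq_fderiv_extChartAt {f : M → ℝ} {x : M} (hf : MDiffAt f x) :
    mvfderiv 𝓘(ℝ, E) f x = fderiv ℝ (f ∘ (extChartAt 𝓘(ℝ, E) x).symm) (extChartAt 𝓘(ℝ, E) x x) := by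
  rw [hf.mvfderiv]
  simp only [writtenInExtChartAt, extChartAt_model_space_eq_id, PartialEquiv.refl_coe,
    Function.id_comp, modelWithCornersSelf_coe, Set.range_id, fderivWithin_univ]
  rfl

/-- Partial derivatives in time and in space commute. -/
theorem ContMDiffAt.hasDerivAt_mvfderiv_comm {f : ℝ × M → ℝ} {t : ℝ} {x : M}
    (hf : ContMDiffAt (𝓘(ℝ, ℝ).prod 𝓘(ℝ, E)) 𝓘(ℝ, ℝ) ∞ f (t, x)) (v : TangentSpace 𝓘(ℝ, E) x) :
    HasDerivAt (fun τ => mvfderiv 𝓘(ℝ, E) (fun y => f (τ, y)) x v)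
      (mvfderiv 𝓘(ℝ, E) (fun y => deriv (fun τ => f (τ, y)) t) x v) t := by
  have h := hf.contDiffAt_comp_extChartAt_symm.hasDerivAt_fderiv_comm v
  rw [mvfderiv_eq_fderiv_extChartAt hf.mdifferentiableAt_deriv_left]
  refine h.congr_of_eventuallyEq ?_
  have hτ : ContinuousAt (fun τ : ℝ => (τ, x)) t := by fun_prop
  have hf1 : ContMDiffAt (𝓘(ℝ, ℝ).prod 𝓘(ℝ, E)) 𝓘(ℝ, ℝ) 1 f (t, x) :=
    hf.of_le ENat.LEInfty.out
  filter_upwards [hτ.eventually (contMDiffAt_iff_contMDiffAt_nhds (by simp) |>.1 hf1)] with τ hfτ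
  have h2 : ContMDiffAt 𝓘(ℝ, E) 𝓘(ℝ, ℝ) 1 (fun y => f (τ, y)) x :=
    ContMDiffAt.comp (g := f) (f := fun y => (τ, y)) x hfτ
      (contMDiffAt_const.prodMk contMDiffAt_id)
  rw [mvfderiv_eq_fderiv_extChartAt (h2.mdifferentiableAt (by norm_num))]
  rfl

/-- The inverse `Q` of a curve `G` of matrices through the identity has `Q' = -G'` there. Since
`Q τ` is a left inverse of `G τ` for all `τ`, no regularity of `Q` is assumed. -/
theorem Matrix.hasDerivAt_inv_of_eq_one {ι : Type*} [Fintype ι] [DecidableEq ι]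
    {G Q : ℝ → Matrix ι ι ℝ} {G' : Matrix ι ι ℝ} {t : ℝ} (hQ : ∀ τ, Q τ * G τ = 1)
    (hG : ∀ a b, HasDerivAt (fun τ => G τ a b) (G' a b) t) (h1 : G t = 1) (a b : ι) :
    HasDerivAt (fun τ => Q τ a b) (-G' a b) t := by
  let _ : NormedRing (Matrix ι ι ℝ) := Matrix.linftyOpNormedRing
  let _ : NormedAlgebra ℝ (Matrix ι ι ℝ) := Matrix.linftyOpNormedAlgebra
  have hQ' : Q = fun τ => Ring.inverse (G τ) := by
    ext1 τ
    rw [← Matrix.nonsing_inv_eq_ringInverse, Matrix.inv_eq_left_inv (hQ τ)]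
  have hG1 : HasDerivAt G G' t := hasDerivAt_pi.2 fun a => hasDerivAt_pi.2 fun b => hG a b
  have h := hasFDerivAt_ringInverse (𝕜 := ℝ) (1 : (Matrix ι ι ℝ)ˣ)
  rw [Units.val_one, ← h1] at h
  have h2 := h.comp_hasDerivAt t hG1
  have h3 : (-ContinuousLinearMap.mulLeftRight ℝ (Matrix ι ι ℝ)
      ((1 : (Matrix ι ι ℝ)ˣ)⁻¹ : (Matrix ι ι ℝ)ˣ) ((1 : (Matrix ι ι ℝ)ˣ)⁻¹ : (Matrix ι ι ℝ)ˣ)) G' =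
      -G' := by
    rw [_root_.neg_apply, ContinuousLinearMap.mulLeftRight_apply, inv_one, Units.val_one, one_mul, mul_one]
  rw [h3] at h2
  rw [hQ']
  exact hasDerivAt_pi.1 (hasDerivAt_pi.1 h2 a) b

theorem RiemMetric.inner_comm (g : RiemMetric E M) (x : M) (u v : TangentSpace 𝓘(ℝ, E) x) :
    g.inner x u v = g.inner x v u := g.symm x u v

namespace AlmostProduct.IsAdaptedVariation

variable {n p : ℕ} {A : AlmostProduct E M n p} {ε t : ℝ} {g : ℝ → RiemMetric E M} {x : M}

theorem contMDiffAt_inner (hg : A.IsAdaptedVariation ε g) (ht : |t| < ε) {X Y : VecField E M}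
    (hX : CMDiffAt ∞ (T% X) x) (hY : CMDiffAt ∞ (T% Y) x) :
    ContMDiffAt (𝓘(ℝ, ℝ).prod 𝓘(ℝ, E)) 𝓘(ℝ, ℝ) ∞
      (fun q : ℝ × M => (g q.1).inner q.2 (X q.2) (Y q.2)) (t, x) := by
  have hU : Set.Ioo (-ε) ε ×ˢ (Set.univ : Set M) ∈ 𝓝 (t, x) :=
    prod_mem_nhds (Ioo_mem_nhds (abs_lt.1 ht).1 (abs_lt.1 ht).2) Filter.univ_mem
  have h : ContMDiffAt (𝓘(ℝ, ℝ).prod 𝓘(ℝ, E)) (𝓘(ℝ, E).prod 𝓘(ℝ)) ∞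
      (fun q : ℝ × M => TotalSpace.mk' ℝ (E := Bundle.Trivial M ℝ) q.2
        ((g q.1).inner q.2 (X q.2) (Y q.2))) (t, x) := by
    apply ContMDiffAt.clm_bundle_apply₂ (F₁ := E) (F₂ := E)
    · exact hg.smooth.contMDiffAt hU
    · exact ContMDiffAt.comp (g := T% X) (f := Prod.snd) (t, x) hX contMDiffAt_snd
    · exact ContMDiffAt.comp (g := T% Y) (f := Prod.snd) (t, x) hY contMDiffAt_snd
  rw [contMDiffAt_totalSpace] at h
  exact h.2

theorem mdifferentiableAt_dtMetric (hg : A.IsAdaptedVariation ε g) (ht : |t| < ε)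
    {X Y : VecField E M} (hX : CMDiffAt ∞ (T% X) x) (hY : CMDiffAt ∞ (T% Y) x) :
    MDiffAt (fun y => dtMetric g t y (X y) (Y y)) x :=
  (hg.contMDiffAt_inner ht hX hY).mdifferentiableAt_deriv_left

/-- `∂_t` of the directional derivative of `g_t(X, Y)` is the directional derivative of `S(X, Y)`. -/
theorem hasDerivAt_mvfderiv_inner (hg : A.IsAdaptedVariation ε g) (ht : |t| < ε)
    {X Y : VecField E M} (hX : CMDiffAt ∞ (T% X) x) (hY : CMDiffAt ∞ (T% Y) x)
    (v : TangentSpace 𝓘(ℝ, E) x) :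
    HasDerivAt (fun τ => mvfderiv 𝓘(ℝ, E) (fun y => (g τ).inner y (X y) (Y y)) x v)
      (mvfderiv 𝓘(ℝ, E) (fun y => dtMetric g t y (X y) (Y y)) x v) t :=
  (hg.contMDiffAt_inner ht hX hY).hasDerivAt_mvfderiv_comm v

theorem hasDerivAt_inner (hg : A.IsAdaptedVariation ε g) (ht : |t| < ε)
    (u v : TangentSpace 𝓘(ℝ, E) x) :
    HasDerivAt (fun τ => (g τ).inner x u v) (dtMetric g t x u v) t := by
  have h := hg.contMDiffAt_inner ht (FiberBundle.contMDiffAt_extend 𝓘(ℝ, E) E u)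
    (FiberBundle.contMDiffAt_extend 𝓘(ℝ, E) E v)
  have h1 : ContMDiffAt 𝓘(ℝ, ℝ) 𝓘(ℝ, ℝ) ∞ (fun τ => (g τ).inner x (FiberBundle.extend E u x)
      (FiberBundle.extend E v x)) t :=
    ContMDiffAt.comp (g := fun q : ℝ × M => (g q.1).inner q.2 (FiberBundle.extend E u q.2)
      (FiberBundle.extend E v q.2)) (f := fun τ => (τ, x)) t h
      (contMDiffAt_id.prodMk contMDiffAt_const)
  have h2 := (h1.contDiffAt.differentiableAt (by simp)).hasDerivAt
  simp only [FiberBundle.extend_apply_self] at h2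
  exact h2

theorem isBilinearMap_dtMetric (hg : A.IsAdaptedVariation ε g) (ht : |t| < ε) (x : M) :
    IsBilinearMap ℝ (dtMetric g t x) where
  add_left u u' v := by
    have h := (hg.hasDerivAt_inner ht u v).add (hg.hasDerivAt_inner ht u' v)
    exact (hg.hasDerivAt_inner ht (u + u') v).unique (h.congr_of_eventuallyEq (by simp; rfl))
  smul_left r u v := by
    have h := (hg.hasDerivAt_inner ht u v).const_smul r
    exact (hg.hasDerivAt_inner ht (r • u) v).unique (h.congr_of_eventuallyEq (by simp; rfl))
  add_right u v v' := by
    have h := (hg.hasDerivAt_inner ht u v).add (hg.hasDerivAt_inner ht u v')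
    exact (hg.hasDerivAt_inner ht u (v + v')).unique (h.congr_of_eventuallyEq (by simp; rfl))
  smul_right r u v := by
    have h := (hg.hasDerivAt_inner ht u v).const_smul r
    exact (hg.hasDerivAt_inner ht u (r • v)).unique (h.congr_of_eventuallyEq (by simp; rfl))

/-- The symmetry of `S = ∂_t g_t`. -/
theorem dtMetric_comm (u v : TangentSpace 𝓘(ℝ, E) x) :
    dtMetric g t x u v = dtMetric g t x v u := by
  simp only [dtMetric, (g _).inner_comm x u v]

theorem eventually_isAdapted (hg : A.IsAdaptedVariation ε g) (ht : |t| < ε) :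
    ∀ᶠ τ in 𝓝 t, A.IsAdapted (g τ) :=
  (continuous_abs.continuousAt.eventually_lt_const ht).mono hg.adapted

end AlmostProduct.IsAdaptedVariation

/-! ### Calculus with the Levi-Civita connection -/

theorem Filter.EventuallyEq.mvfderiv_eq {f f' : M → ℝ} {x : M} (h : f =ᶠ[𝓝 x] f') :
    mvfderiv 𝓘(ℝ, E) f x = mvfderiv 𝓘(ℝ, E) f' x := by
  ext v
  change (mfderiv 𝓘(ℝ, E) 𝓘(ℝ, ℝ) f x v : ℝ) = mfderiv 𝓘(ℝ, E) 𝓘(ℝ, ℝ) f' x v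
  rw [h.mfderiv_eq]
  rfl

namespace RiemMetric

theorem leviCivita_add (g : RiemMetric E M) {Y Y' : VecField E M} {x : M}
    (hY : MDiffAt (T% Y) x) (hY' : MDiffAt (T% Y') x) :
    g.leviCivita (Y + Y') x = g.leviCivita Y x + g.leviCivita Y' x :=
  g.leviCivita.isCovariantDerivativeOnUniv.add hY hY'

theorem leviCivita_smul (g : RiemMetric E M) {f : M → ℝ} {Y : VecField E M} {x : M}
    (hf : MDiffAt f x) (hY : MDiffAt (T% Y) x) (v : TangentSpace 𝓘(ℝ, E) x) :
    g.leviCivita (f • Y) x v =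
      f x • g.leviCivita Y x v + mvfderiv 𝓘(ℝ, E) f x v • Y x := by
  rw [g.leviCivita.isCovariantDerivativeOnUniv.leibniz hY hf]
  rfl

theorem leviCivita_congr (g : RiemMetric E M) {Y Y' : VecField E M} {x : M}
    (hY : MDiffAt (T% Y) x) (hY' : MDiffAt (T% Y') x) (h : ∀ᶠ y in 𝓝 x, Y y = Y' y) :
    g.leviCivita Y x = g.leviCivita Y' x :=
  g.leviCivita.isCovariantDerivativeOnUniv.congr_of_eventuallyEq hY hY' Filter.univ_mem h

theorem leviCivita_sub_swap (g : RiemMetric E M) {X Y : VecField E M} {x : M}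
    (hX : MDiffAt (T% X) x) (hY : MDiffAt (T% Y) x) :
    g.leviCivita Y x (X x) - g.leviCivita X x (Y x) = VectorField.mlieBracket 𝓘(ℝ, E) X Y x :=
  (CovariantDerivative.torsion_eq_zero_iff _).1 g.leviCivita_torsion hX hY

theorem mvfderiv_inner (g : RiemMetric E M) {Y Z : VecField E M} {x : M}
    (hY : MDiffAt (T% Y) x) (hZ : MDiffAt (T% Z) x) (v : TangentSpace 𝓘(ℝ, E) x) :
    mvfderiv 𝓘(ℝ, E) (fun y => g.inner y (Y y) (Z y)) x v =
      g.inner x (g.leviCivita Y x v) (Z x) + g.inner x (Y x) (g.leviCivita Z x v) := by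
  have h := g.leviCivita_metric (FiberBundle.mdifferentiableAt_extend 𝓘(ℝ, E) E v) hY hZ
  simpa using h

end RiemMetric

/-! ### Components along the two distributions -/

namespace AlmostProduct

variable {n p : ℕ} (A : AlmostProduct E M n p) {g : RiemMetric E M} {x : M}

theorem projTop_mem (u : TangentSpace 𝓘(ℝ, E) x) : A.projTop x u ∈ A.dtop x :=
  Submodule.projection_apply_mem _ _

theorem projPerp_mem (u : TangentSpace 𝓘(ℝ, E) x) : A.projPerp x u ∈ A.dperp x :=
  Submodule.projection_apply_mem _ _

variable {A}

theorem projTop_of_mem {u : TangentSpace 𝓘(ℝ, E) x} (hu : u ∈ A.dtop x) : A.projTop x u = u :=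
  Submodule.projection_apply_of_mem_left _ hu

theorem projPerp_of_mem {u : TangentSpace 𝓘(ℝ, E) x} (hu : u ∈ A.dperp x) : A.projPerp x u = u :=
  Submodule.projection_apply_of_mem_left _ hu

theorem projTop_of_mem_dperp {u : TangentSpace 𝓘(ℝ, E) x} (hu : u ∈ A.dperp x) :
    A.projTop x u = 0 :=
  (Submodule.projection_apply_eq_zero_iff _).2 hu

theorem projTop_add_projPerp (u : TangentSpace 𝓘(ℝ, E) x) :
    A.projTop x u + A.projPerp x u = u :=
  Submodule.projection_add_projection_eq_self _ u

theorem extendTop_apply_self (u : TangentSpace 𝓘(ℝ, E) x) : A.extendTop u x = A.projTop x u := by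
  simp [extendTop]

theorem extendTop_mem (u : TangentSpace 𝓘(ℝ, E) x) (y : M) : A.extendTop u y ∈ A.dtop y :=
  A.projTop_mem _

theorem IsAdapted.swap (hA : A.IsAdapted g) : A.swap.IsAdapted g := fun y u hu v hv => by
  rw [g.inner_comm]
  exact hA y v hv u hu

theorem IsAdapted.inner_projTop (hA : A.IsAdapted g) {u v : TangentSpace 𝓘(ℝ, E) x}
    (hu : u ∈ A.dtop x) : g.inner x u (A.projTop x v) = g.inner x u v := by
  conv_rhs => rw [← projTop_add_projPerp (A := A) v, map_add, hA x u hu _ (A.projPerp_mem v), add_zero]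

theorem IsAdapted.inner_projPerp (hA : A.IsAdapted g) (u v : TangentSpace 𝓘(ℝ, E) x) :
    g.inner x (A.projPerp x u) v = g.inner x u (A.projPerp x v) := by
  have h1 : g.inner x (A.projPerp x u) v = g.inner x (A.projPerp x u) (A.projPerp x v) :=
    (hA.swap.inner_projTop (A.projPerp_mem u)).symm
  have h2 : g.inner x (A.projPerp x v) u = g.inner x (A.projPerp x v) (A.projPerp x u) :=
    (hA.swap.inner_projTop (A.projPerp_mem v)).symm
  rw [h1, g.inner_comm x u, h2, g.inner_comm]

/-- Smooth local `g`-orthonormal frames `W` of `𝒟̃` and `Z` of `𝒟` over the open set `U`. -/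
structure IsAdaptedFrame (A : AlmostProduct E M n p) (g : RiemMetric E M) (U : Set M)
    (W : Fin n → VecField E M) (Z : Fin p → VecField E M) : Prop where
  isOpen : IsOpen U
  smooth_top : ∀ y ∈ U, ∀ a, CMDiffAt ∞ (T% (W a)) y
  smooth_perp : ∀ y ∈ U, ∀ i, CMDiffAt ∞ (T% (Z i)) y
  basis_top : ∀ y ∈ U, g.IsOrthonormalBasis (A.dtop y) fun a => W a y
  basis_perp : ∀ y ∈ U, g.IsOrthonormalBasis (A.dperp y) fun i => Z i y

theorem exists_isAdaptedFrame (A : AlmostProduct E M n p) (g : RiemMetric E M) (x : M) :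
    ∃ U : Set M, x ∈ U ∧ ∃ W Z, A.IsAdaptedFrame g U W Z := by
  obtain ⟨U, hU, hxU, W, hW⟩ := A.smooth_top.exists_orthonormal_frame g x
  obtain ⟨U', hU', hxU', Z, hZ⟩ := A.smooth_perp.exists_orthonormal_frame g x
  exact ⟨U ∩ U', ⟨hxU, hxU'⟩, W, Z, hU.inter hU', fun y hy => (hW y hy.1).1,
    fun y hy => (hZ y hy.2).1, fun y hy => (hW y hy.1).2, fun y hy => (hZ y hy.2).2⟩

theorem IsAdaptedFrame.swap {U : Set M} {W : Fin n → VecField E M} {Z : Fin p → VecField E M}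
    (hF : A.IsAdaptedFrame g U W Z) : A.swap.IsAdaptedFrame g U Z W :=
  ⟨hF.isOpen, hF.smooth_perp, hF.smooth_top, hF.basis_perp, hF.basis_top⟩

theorem IsAdapted.projTop_eq_sum (hA : A.IsAdapted g) {ι : Type*} [Fintype ι] [DecidableEq ι]
    {w : ι → TangentSpace 𝓘(ℝ, E) x} (hw : g.IsOrthonormalBasis (A.dtop x) w)
    (v : TangentSpace 𝓘(ℝ, E) x) : A.projTop x v = ∑ a, g.inner x (w a) v • w a := by
  rw [← hw.sum_repr _ (A.projTop_mem v)]
  simp only [hA.inner_projTop (hw.mem _)]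

theorem IsAdapted.contMDiffAt_projTop (hA : A.IsAdapted g) {V : VecField E M}
    (hV : CMDiffAt ∞ (T% V) x) : CMDiffAt ∞ (T% (fun y => A.projTop y (V y))) x := by
  obtain ⟨U, hxU, W, Z, hF⟩ := A.exists_isAdaptedFrame g x
  have h : CMDiffAt ∞ (T% (fun y => ∑ a, g.inner y (W a y) (V y) • W a y)) x :=
    ContMDiffAt.sum_section fun a _ =>
      (g.contMDiffAt_inner (hF.smooth_top x hxU a) hV).smul_section (hF.smooth_top x hxU a)
  refine h.congr_of_eventuallyEq ?_
  filter_upwards [hF.isOpen.mem_nhds hxU] with y hy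
  rw [hA.projTop_eq_sum (hF.basis_top y hy)]

theorem IsAdapted.contMDiffAt_extendTop (hA : A.IsAdapted g) (u : TangentSpace 𝓘(ℝ, E) x) :
    CMDiffAt ∞ (T% (A.extendTop u)) x :=
  hA.contMDiffAt_projTop (FiberBundle.contMDiffAt_extend 𝓘(ℝ, E) E u)

theorem IsAdapted.mdifferentiableAt_extendTop (hA : A.IsAdapted g) (u : TangentSpace 𝓘(ℝ, E) x) :
    MDiffAt (T% (A.extendTop u)) x :=
  (hA.contMDiffAt_extendTop u).mdifferentiableAt (by simp)

/-! ### The second fundamental form and the integrability tensor -/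

/-- `V` is differentiable at `x` and a section of `𝒟̃` near `x`. -/
structure IsTopSection (A : AlmostProduct E M n p) (V : VecField E M) (x : M) : Prop where
  mdiff : MDiffAt (T% V) x
  mem : ∀ᶠ y in 𝓝 x, V y ∈ A.dtop y

theorem IsAdapted.isTopSection_extendTop (hA : A.IsAdapted g) (u : TangentSpace 𝓘(ℝ, E) x) :
    A.IsTopSection (A.extendTop u) x :=
  ⟨hA.mdifferentiableAt_extendTop u, .of_forall (extendTop_mem u)⟩

/-- For orthogonal sections, `g(∇_u V, Z) = -g(V, ∇_u Z)`. -/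
theorem IsAdapted.inner_leviCivita (hA : A.IsAdapted g) {V Z : VecField E M}
    (hV : A.IsTopSection V x) (hZ : A.swap.IsTopSection Z x) (u : TangentSpace 𝓘(ℝ, E) x) :
    g.inner x (g.leviCivita V x u) (Z x) = -g.inner x (V x) (g.leviCivita Z x u) := by
  have h0 : (fun y => g.inner y (V y) (Z y)) =ᶠ[𝓝 x] fun _ => 0 := by
    filter_upwards [hV.mem, hZ.mem] with y h1 h2 using hA y _ h1 _ h2
  have h := g.mvfderiv_inner hV.mdiff hZ.mdiff u
  rw [h0.mvfderiv_eq, mvfderiv_const] at h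
  simp at h
  linarith

/-- The component of `∇_u V` along `𝒟`, for a section `V` of `𝒟̃`, depends only on `V x`. -/
theorem IsAdapted.projPerp_leviCivita_eq (hA : A.IsAdapted g) {V V' : VecField E M}
    (hV : A.IsTopSection V x) (hV' : A.IsTopSection V' x) (h : V x = V' x)
    (u : TangentSpace 𝓘(ℝ, E) x) :
    A.projPerp x (g.leviCivita V x u) = A.projPerp x (g.leviCivita V' x u) := by
  refine g.ext_inner fun z => ?_
  have hZ := hA.swap.isTopSection_extendTop z
  have hz : A.swap.extendTop z x = A.projPerp x z := extendTop_apply_self z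
  rw [hA.inner_projPerp, hA.inner_projPerp, ← hz, hA.inner_leviCivita hV hZ,
    hA.inner_leviCivita hV' hZ, h]

/-- The bilinear form `(∇_X Y)^⊥` of `𝒟̃`, whose symmetric part is `h` and whose skew-symmetric part
is `T`. -/
def secondForm (A : AlmostProduct E M n p) (g : RiemMetric E M) : Tensor12 E M :=
  fun x u v => A.projPerp x (g.leviCivita (A.extendTop v) x (A.projTop x u))

theorem IsAdapted.secondForm_apply (hA : A.IsAdapted g) {V : VecField E M}
    (hV : A.IsTopSection V x) {u : TangentSpace 𝓘(ℝ, E) x} (hu : u ∈ A.dtop x) :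
    A.secondForm g x u (V x) = A.projPerp x (g.leviCivita V x u) := by
  rw [secondForm, projTop_of_mem hu]
  refine hA.projPerp_leviCivita_eq (hA.isTopSection_extendTop _) hV ?_ u
  rw [extendTop_apply_self, projTop_of_mem hV.mem.self_of_nhds]

theorem IsAdapted.isBilinearMap_secondForm (hA : A.IsAdapted g) (x : M) :
    IsBilinearMap ℝ (A.secondForm g x) where
  add_left u u' v := by simp [secondForm]
  smul_left r u v := by simp [secondForm]
  add_right u v v' := by
    have h := hA.isTopSection_extendTop v
    have h' := hA.isTopSection_extendTop v'
    have hs : A.IsTopSection (A.extendTop v + A.extendTop v') x :=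
      ⟨mdifferentiableAt_add_section h.mdiff h'.mdiff, by
        filter_upwards [h.mem, h'.mem] with y h1 h2 using add_mem h1 h2⟩
    rw [secondForm, hA.projPerp_leviCivita_eq (hA.isTopSection_extendTop _) hs
      (by simp [extendTop_apply_self]), g.leviCivita_add h.mdiff h'.mdiff]
    simp [secondForm]
  smul_right r u v := by
    have h := hA.isTopSection_extendTop v
    have hr : MDiffAt (fun _ : M => r) x := mdifferentiableAt_const
    have hs : A.IsTopSection ((fun _ => r) • A.extendTop v) x :=
      ⟨hr.smul_section h.mdiff, by
        filter_upwards [h.mem] with y h1 using Submodule.smul_mem _ _ h1⟩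
    rw [secondForm, hA.projPerp_leviCivita_eq (hA.isTopSection_extendTop _) hs
      (by simp [extendTop_apply_self]), g.leviCivita_smul hr h.mdiff, mvfderiv_const]
    simp [secondForm]

theorem h_eq (A : AlmostProduct E M n p) (g : RiemMetric E M) (x : M)
    (u v : TangentSpace 𝓘(ℝ, E) x) :
    A.h g x u v = (1 / 2 : ℝ) • (A.secondForm g x u v + A.secondForm g x v u) := by
  simp [h, secondForm, extendTop_apply_self]

theorem IsAdapted.T_eq (hA : A.IsAdapted g) (u v : TangentSpace 𝓘(ℝ, E) x) :
    A.T x u v = (1 / 2 : ℝ) • (A.secondForm g x u v - A.secondForm g x v u) := by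
  rw [T, ← g.leviCivita_sub_swap (hA.mdifferentiableAt_extendTop u)
    (hA.mdifferentiableAt_extendTop v)]
  simp [secondForm, extendTop_apply_self]

theorem IsAdapted.isBilinearMap_h (hA : A.IsAdapted g) (x : M) : IsBilinearMap ℝ (A.h g x) where
  add_left u u' v := by
    simp only [h_eq, (hA.isBilinearMap_secondForm x).add_left,
      (hA.isBilinearMap_secondForm x).add_right]
    module
  smul_left r u v := by
    simp only [h_eq, (hA.isBilinearMap_secondForm x).smul_left,
      (hA.isBilinearMap_secondForm x).smul_right]
    module
  add_right u v v' := by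
    simp only [h_eq, (hA.isBilinearMap_secondForm x).add_left,
      (hA.isBilinearMap_secondForm x).add_right]
    module
  smul_right r u v := by
    simp only [h_eq, (hA.isBilinearMap_secondForm x).smul_left,
      (hA.isBilinearMap_secondForm x).smul_right]
    module

theorem IsAdapted.isBilinearMap_T (hA : A.IsAdapted g) (x : M) : IsBilinearMap ℝ (A.T x) where
  add_left u u' v := by
    simp only [hA.T_eq, (hA.isBilinearMap_secondForm x).add_left,
      (hA.isBilinearMap_secondForm x).add_right]
    module
  smul_left r u v := by
    simp only [hA.T_eq, (hA.isBilinearMap_secondForm x).smul_left,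
      (hA.isBilinearMap_secondForm x).smul_right]
    module
  add_right u v v' := by
    simp only [hA.T_eq, (hA.isBilinearMap_secondForm x).add_left,
      (hA.isBilinearMap_secondForm x).add_right]
    module
  smul_right r u v := by
    simp only [hA.T_eq, (hA.isBilinearMap_secondForm x).smul_left,
      (hA.isBilinearMap_secondForm x).smul_right]
    module

theorem h_mem (A : AlmostProduct E M n p) (g : RiemMetric E M) (u v : TangentSpace 𝓘(ℝ, E) x) :
    A.h g x u v ∈ A.dperp x :=
  Submodule.smul_mem _ _ (A.projPerp_mem _)

theorem T_mem (A : AlmostProduct E M n p) (u v : TangentSpace 𝓘(ℝ, E) x) :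
    A.T x u v ∈ A.dperp x :=
  Submodule.smul_mem _ _ (A.projPerp_mem _)

theorem h_comm (A : AlmostProduct E M n p) (g : RiemMetric E M) (u v : TangentSpace 𝓘(ℝ, E) x) :
    A.h g x u v = A.h g x v u := by
  rw [h_eq, h_eq, add_comm]

theorem IsAdapted.T_swap (hA : A.IsAdapted g) (u v : TangentSpace 𝓘(ℝ, E) x) :
    A.T x v u = -A.T x u v := by
  rw [hA.T_eq, hA.T_eq, ← smul_neg, neg_sub]

theorem IsAdapted.h_add_T (hA : A.IsAdapted g) (u v : TangentSpace 𝓘(ℝ, E) x) :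
    A.h g x u v + A.T x u v = A.secondForm g x u v := by
  rw [hA.T_eq, h_eq]
  module

theorem IsAdapted.secondForm_right_of_mem_dperp (hA : A.IsAdapted g) {u v : TangentSpace 𝓘(ℝ, E) x}
    (hv : v ∈ A.dperp x) : A.secondForm g x u v = 0 := by
  have h0 : A.IsTopSection (0 : VecField E M) x :=
    ⟨mdifferentiable_zeroSection .., .of_forall fun y => zero_mem _⟩
  rw [secondForm, hA.projPerp_leviCivita_eq (hA.isTopSection_extendTop v) h0
    (by simp [extendTop_apply_self, projTop_of_mem_dperp hv])]
  simp

theorem IsAdapted.h_of_mem_dperp (hA : A.IsAdapted g) {u v : TangentSpace 𝓘(ℝ, E) x}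
    (hv : v ∈ A.dperp x) : A.h g x u v = 0 := by
  have h1 : A.secondForm g x v u = 0 := by simp [secondForm, projTop_of_mem_dperp hv]
  rw [h_eq, h1, hA.secondForm_right_of_mem_dperp hv, add_zero, smul_zero]

theorem IsAdapted.T_of_mem_dperp (hA : A.IsAdapted g) {u v : TangentSpace 𝓘(ℝ, E) x}
    (hv : v ∈ A.dperp x) : A.T x u v = 0 := by
  have h1 : A.secondForm g x v u = 0 := by simp [secondForm, projTop_of_mem_dperp hv]
  rw [hA.T_eq, h1, hA.secondForm_right_of_mem_dperp hv, sub_zero, smul_zero]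

/-- The Lie derivative `(L_Z S)(U, V)` of a (0,2)-tensor. -/
def lieDeriv (S : Tensor02 E M) (Z U V : VecField E M) (x : M) : ℝ :=
  mvfderiv 𝓘(ℝ, E) (fun y => S y (U y) (V y)) x (Z x)
    - S x (VectorField.mlieBracket 𝓘(ℝ, E) Z U x) (V x)
    - S x (U x) (VectorField.mlieBracket 𝓘(ℝ, E) Z V x)

theorem IsAdapted.inner_secondForm (hA : A.IsAdapted g) {V Z : VecField E M}
    {u : TangentSpace 𝓘(ℝ, E) x} (hu : u ∈ A.dtop x)
    (hV : A.IsTopSection V x) (hZ : A.swap.IsTopSection Z x) :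
    g.inner x (A.secondForm g x u (V x)) (Z x) = g.inner x (g.leviCivita V x u) (Z x) := by
  rw [hA.secondForm_apply hV hu, hA.inner_projPerp, projPerp_of_mem hZ.mem.self_of_nhds]

/-- The Weingarten formula: the `𝒟̃`-component of `∇_u Z`, for a section `Z` of `𝒟`, is given by
`h + T`. -/
theorem IsAdapted.inner_leviCivita_perp (hA : A.IsAdapted g) {V Z : VecField E M}
    {u : TangentSpace 𝓘(ℝ, E) x} (hu : u ∈ A.dtop x)
    (hV : A.IsTopSection V x) (hZ : A.swap.IsTopSection Z x) :
    g.inner x (g.leviCivita Z x u) (V x) = -g.inner x (A.secondForm g x u (V x)) (Z x) := by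
  rw [hA.inner_secondForm hu hV hZ, hA.inner_leviCivita hV hZ, neg_neg, g.inner_comm]

/-- For sections of the two distributions, `g(h(U, V), Z) = -(1/2) (L_Z g)(U, V)`. The connection
has disappeared from the right-hand side, so that this can be differentiated in the time `t`. -/
theorem IsAdapted.inner_h (hA : A.IsAdapted g) {U V Z : VecField E M} (hU : A.IsTopSection U x)
    (hV : A.IsTopSection V x) (hZ : A.swap.IsTopSection Z x) :
    g.inner x (A.h g x (U x) (V x)) (Z x) =
      -(1 / 2) * lieDeriv (fun y u v => g.inner y u v) Z U V x := by
  have h1 := hA.inner_leviCivita_perp hU.mem.self_of_nhds hV hZ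
  have h2 := hA.inner_leviCivita_perp hV.mem.self_of_nhds hU hZ
  rw [lieDeriv, g.mvfderiv_inner hU.mdiff hV.mdiff, ← g.leviCivita_sub_swap hZ.mdiff hU.mdiff,
    ← g.leviCivita_sub_swap hZ.mdiff hV.mdiff, h_eq]
  simp only [map_smul, map_add, map_sub, sub_apply, add_apply, smul_apply, smul_eq_mul]
  rw [h1, g.inner_comm x (U x) (g.leviCivita Z x (V x)), h2]
  ring

end AlmostProduct

/-! ### General variations of the extrinsic invariants -/

/-- The derivative of a double trace `∑ Q_aa' Q_bb' K_aba'b'` at a time where `Q` is the identity and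
`Q' = -S`. -/
theorem hasDerivAt_doubleTrace {ι : Type*} [Fintype ι] [DecidableEq ι] {t : ℝ}
    {Q : ℝ → Matrix ι ι ℝ} {S : Matrix ι ι ℝ} (hQ : ∀ a b, HasDerivAt (fun τ => Q τ a b) (-S a b) t)
    (h1 : Q t = 1) {K : ℝ → ι → ι → ι → ι → ℝ} {K' : ι → ι → ι → ι → ℝ}
    (hK : ∀ a b a' b', HasDerivAt (fun τ => K τ a b a' b') (K' a b a' b') t) :
    HasDerivAt (fun τ => ∑ a, ∑ a', ∑ b, ∑ b', (Q τ a a' * Q τ b b') • K τ a b a' b')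
      (∑ a, ∑ b, K' a b a b - ∑ a, ∑ a', ∑ b, S a a' * K t a b a' b
        - ∑ a, ∑ b, ∑ b', S b b' * K t a b a b') t := by
  have h := HasDerivAt.fun_sum (u := Finset.univ) fun a _ =>
    HasDerivAt.fun_sum (u := Finset.univ) fun a' _ =>
      HasDerivAt.fun_sum (u := Finset.univ) fun b _ =>
        HasDerivAt.fun_sum (u := Finset.univ) fun b' _ =>
          ((hQ a a').mul (hQ b b')).mul (hK a b a' b')
  refine h.congr_deriv ?_
  simp only [Pi.mul_apply, h1, Matrix.one_apply, add_mul, Finset.sum_add_distrib, mul_ite, mul_one, mul_zero,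
    ite_mul, zero_mul, one_mul, Finset.sum_ite_eq, Finset.mem_univ, if_true, neg_mul,
    Finset.sum_neg_distrib, Finset.sum_const_zero, Finset.sum_ite_irrel]
  ring

/-- The derivative of a trace `∑ Q_ab φ_ab` at a time where `Q` is the identity and `Q' = -S`. -/
theorem hasDerivAt_trace {ι : Type*} [Fintype ι] [DecidableEq ι] {t : ℝ}
    {Q : ℝ → Matrix ι ι ℝ} {S : Matrix ι ι ℝ} (hQ : ∀ a b, HasDerivAt (fun τ => Q τ a b) (-S a b) t)
    (h1 : Q t = 1) {φ : ℝ → ι → ι → ℝ} {φ' : ι → ι → ℝ}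
    (hφ : ∀ a b, HasDerivAt (fun τ => φ τ a b) (φ' a b) t) :
    HasDerivAt (fun τ => ∑ a, ∑ b, Q τ a b • φ τ a b)
      (∑ a, φ' a a - ∑ a, ∑ b, S a b * φ t a b) t := by
  have h := HasDerivAt.fun_sum (u := Finset.univ) fun a _ =>
    HasDerivAt.fun_sum (u := Finset.univ) fun b _ => (hQ a b).mul (hφ a b)
  refine h.congr_deriv ?_
  simp only [h1, Matrix.one_apply, Finset.sum_add_distrib, ite_mul, zero_mul, one_mul,
    Finset.sum_ite_eq, Finset.mem_univ, if_true, neg_mul, Finset.sum_neg_distrib]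
  ring

namespace AlmostProduct

variable {n p : ℕ} {A : AlmostProduct E M n p} {ε t : ℝ} {g : ℝ → RiemMetric E M} {x : M}

theorem IsAdaptedFrame.isTopSection {g : RiemMetric E M} {U : Set M} {W : Fin n → VecField E M}
    {Z : Fin p → VecField E M} (hF : A.IsAdaptedFrame g U W Z) (hx : x ∈ U) (a : Fin n) :
    A.IsTopSection (W a) x :=
  ⟨(hF.smooth_top x hx a).mdifferentiableAt (by simp), by
    filter_upwards [hF.isOpen.mem_nhds hx] with y hy using (hF.basis_top y hy).mem a⟩

namespace IsAdaptedVariation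

theorem swap (hg : A.IsAdaptedVariation ε g) : A.swap.IsAdaptedVariation ε g :=
  ⟨hg.smooth, fun t ht => (hg.adapted t ht).swap⟩

/-- The transition matrix from a fixed basis, orthonormal at time `t`, to bases orthonormal for `g_τ`
has derivative `-S`. The bases `e τ` may depend on `τ` in any way. -/
theorem hasDerivAt_transitionSq (hg : A.IsAdaptedVariation ε g) (ht : |t| < ε)
    {ι κ : Type*} [Fintype ι] [DecidableEq ι] [Fintype κ] [DecidableEq κ]
    {F : Submodule ℝ (TangentSpace 𝓘(ℝ, E) x)} {w : ι → TangentSpace 𝓘(ℝ, E) x}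
    {e : ℝ → κ → TangentSpace 𝓘(ℝ, E) x} (hw : (g t).IsOrthonormalBasis F w)
    (he : ∀ τ, (g τ).IsOrthonormalBasis F (e τ)) (a b : ι) :
    HasDerivAt (fun τ => (g t).transitionSq w (e τ) a b) (-dtMetric g t x (w a) (w b)) t :=
  Matrix.hasDerivAt_inv_of_eq_one (G' := Matrix.of fun a b => dtMetric g t x (w a) (w b))
    (fun τ => hw.transitionSq_mul_gram (he τ)) (fun a b => hg.hasDerivAt_inner ht (w a) (w b))
    (by ext a b; simp [hw.inner, Matrix.one_apply]) a b

/-- The derivative of `g_τ(P_τ, P'_τ)` for curves `P`, `P'` in `𝒟_x` that are known through their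
`g_τ`-inner products with a fixed basis `z`. -/
theorem hasDerivAt_inner_of_components (hg : A.IsAdaptedVariation ε g) (ht : |t| < ε)
    {ι : Type*} [Fintype ι] [DecidableEq ι]
    {F : Submodule ℝ (TangentSpace 𝓘(ℝ, E) x)} {z : ι → TangentSpace 𝓘(ℝ, E) x}
    (hz : (g t).IsOrthonormalBasis F z) {P P' : ℝ → TangentSpace 𝓘(ℝ, E) x}
    (hP : ∀ τ, P τ ∈ F) (hP' : ∀ τ, P' τ ∈ F) {ψ ψ' : ι → ℝ}
    (hψ : ∀ i, HasDerivAt (fun τ => (g τ).inner x (P τ) (z i)) (ψ i) t)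
    (hψ' : ∀ i, HasDerivAt (fun τ => (g τ).inner x (P' τ) (z i)) (ψ' i) t) :
    HasDerivAt (fun τ => (g τ).inner x (P τ) (P' τ))
      (∑ i, (ψ i * (g t).inner x (P' t) (z i) + (g t).inner x (P t) (z i) * ψ' i)
        - dtMetric g t x (P t) (P' t)) t := by
  have he := fun τ => (g τ).isOrthonormalBasis_orthonormalFrame F
  have h := hasDerivAt_trace (fun i j => hg.hasDerivAt_transitionSq ht hz he i j)
    (hz.transitionSq_self (he t)) fun i j => (hψ i).mul (hψ' j)
  have h1 : ∀ τ, (g τ).inner x (P τ) (P' τ) = ∑ i, ∑ j,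
      (g t).transitionSq z ((g τ).orthonormalFrame F) i j •
        ((g τ).inner x (P τ) (z i) * (g τ).inner x (P' τ) (z j)) := by
    intro τ
    have hβ : IsBilinearMap ℝ fun u v => (g τ).inner x (P τ) u * (g τ).inner x (P' τ) v :=
      { add_left := fun _ _ _ => by simp [add_mul]
        smul_left := fun _ _ _ => by simp [mul_assoc]
        add_right := fun _ _ _ => by simp [mul_add]
        smul_right := fun _ _ _ => by simp [mul_left_comm] }
    rw [← hz.sum_diag (he τ) hβ]
    conv_lhs => rw [← (he τ).sum_repr _ (hP' τ)]
    simp only [map_sum, map_smul, smul_eq_mul]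
    exact Finset.sum_congr rfl fun c _ => by
      rw [(g τ).inner_comm x (P' τ), mul_comm]
  have h2 : dtMetric g t x (P t) (P' t) = ∑ i, ∑ j, dtMetric g t x (z i) (z j) *
      ((g t).inner x (P t) (z i) * (g t).inner x (P' t) (z j)) := by
    rw [hz.bilin_apply (hg.isBilinearMap_dtMetric ht x) (hP t) (hP' t)]
    refine Finset.sum_congr rfl fun i _ => Finset.sum_congr rfl fun j _ => ?_
    rw [(g t).inner_comm x (z i), (g t).inner_comm x (z j), smul_eq_mul, mul_comm]
  simp only [h1, h2]
  exact h

section Frame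

variable {U : Set M} {W : Fin n → VecField E M} {Z : Fin p → VecField E M}

/-- `∂_t g(h(W_a, W_b), Z_i) = -(1/2) (L_{Z_i} S)(W_a, W_b)`. -/
theorem hasDerivAt_inner_h (hg : A.IsAdaptedVariation ε g) (ht : |t| < ε)
    (hF : A.IsAdaptedFrame (g t) U W Z) (hx : x ∈ U) (a b : Fin n) (i : Fin p) :
    HasDerivAt (fun τ => (g τ).inner x (A.h (g τ) x (W a x) (W b x)) (Z i x))
      (-(1 / 2) * lieDeriv (dtMetric g t) (Z i) (W a) (W b) x) t := by
  have h : HasDerivAt (fun τ => -(1 / 2) *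
      lieDeriv (fun y u v => (g τ).inner y u v) (Z i) (W a) (W b) x)
      (-(1 / 2) * lieDeriv (dtMetric g t) (Z i) (W a) (W b) x) t :=
    (((hg.hasDerivAt_mvfderiv_inner ht (hF.smooth_top x hx a) (hF.smooth_top x hx b) (Z i x)).sub
      (hg.hasDerivAt_inner ht _ _)).sub (hg.hasDerivAt_inner ht _ _)).const_mul _
  refine h.congr_of_eventuallyEq ?_
  filter_upwards [hg.eventually_isAdapted ht] with τ hτ
  exact hτ.inner_h (hF.isTopSection hx a) (hF.isTopSection hx b) (hF.swap.isTopSection hx i)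

/-- The derivative of `‖h‖²` in an adapted frame of `g_t`: the three contributions come from
`∂_t g(h(W_a, W_b), Z_i)`, from the metric on `𝒟`, and from the change of the orthonormal bases
of `𝒟̃`. -/
theorem hasDerivAt_normSqh (hg : A.IsAdaptedVariation ε g) (ht : |t| < ε)
    (hF : A.IsAdaptedFrame (g t) U W Z) (hx : x ∈ U) :
    HasDerivAt (fun τ => A.normSqh (g τ) x)
      (∑ a, ∑ b, (-(∑ i, (g t).inner x (A.h (g t) x (W a x) (W b x)) (Z i x) *
            lieDeriv (dtMetric g t) (Z i) (W a) (W b) x)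
          - dtMetric g t x (A.h (g t) x (W a x) (W b x)) (A.h (g t) x (W a x) (W b x)))
        - 2 * ∑ a, ∑ c, ∑ b, dtMetric g t x (W a x) (W c x) *
          (g t).inner x (A.h (g t) x (W a x) (W b x)) (A.h (g t) x (W c x) (W b x))) t := by
  have hw := hF.basis_top x hx
  have he := fun τ => (g τ).isOrthonormalBasis_orthonormalFrame (A.dtop x)
  have h := hasDerivAt_doubleTrace (hg.hasDerivAt_transitionSq ht hw he)
    (hw.transitionSq_self (he t)) fun a b a' b' =>
      hg.hasDerivAt_inner_of_components ht (hF.basis_perp x hx)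
        (fun τ => A.h_mem (g τ) (W a x) (W b x)) (fun τ => A.h_mem (g τ) (W a' x) (W b' x))
        (fun i => hg.hasDerivAt_inner_h ht hF hx a b i)
        (fun i => hg.hasDerivAt_inner_h ht hF hx a' b' i)
  refine (h.congr_deriv ?_).congr_of_eventuallyEq ?_
  · have h3 : ∑ a, ∑ b, ∑ c, dtMetric g t x (W b x) (W c x) *
          (g t).inner x (A.h (g t) x (W a x) (W b x)) (A.h (g t) x (W a x) (W c x)) =
        ∑ a, ∑ c, ∑ b, dtMetric g t x (W a x) (W c x) *
          (g t).inner x (A.h (g t) x (W a x) (W b x)) (A.h (g t) x (W c x) (W b x)) := by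
      rw [Finset.sum_comm]
      refine Finset.sum_congr rfl fun b _ => ?_
      rw [Finset.sum_comm]
      simp only [fun a c => A.h_comm (g t) (W a x) (W c x)]
    rw [h3, two_mul, sub_sub]
    congr 1
    refine Finset.sum_congr rfl fun a _ => Finset.sum_congr rfl fun b _ => ?_
    rw [← Finset.sum_neg_distrib]
    congr 1
    exact Finset.sum_congr rfl fun i _ => by ring
  · filter_upwards [hg.eventually_isAdapted ht] with τ hτ
    have hb := hτ.isBilinearMap_h x
    rw [normSqh]
    exact hw.sum_diag₂ (he τ)
      (γ := fun u v u' v' => (g τ).inner x (A.h (g τ) x u v) (A.h (g τ) x u' v'))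
      (fun v v' => ⟨by simp [hb.add_left], by simp [hb.smul_left], by simp [hb.add_left],
        by simp [hb.smul_left]⟩)
      (fun u u' => ⟨by simp [hb.add_right], by simp [hb.smul_right], by simp [hb.add_right],
        by simp [hb.smul_right]⟩)

/-- The derivative of `‖T‖²` in an adapted frame of `g_t`. As `T` does not depend on the metric, only
the metric on `𝒟` and the orthonormal bases of `𝒟̃` contribute. -/
theorem hasDerivAt_normSqT (hg : A.IsAdaptedVariation ε g) (ht : |t| < ε)
    (hF : A.IsAdaptedFrame (g t) U W Z) (hx : x ∈ U) :
    HasDerivAt (fun τ => A.normSqT (g τ) x)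
      (∑ a, ∑ b, dtMetric g t x (A.T x (W a x) (W b x)) (A.T x (W a x) (W b x))
        - 2 * ∑ a, ∑ c, ∑ b, dtMetric g t x (W a x) (W c x) *
          (g t).inner x (A.T x (W a x) (W b x)) (A.T x (W c x) (W b x))) t := by
  have hw := hF.basis_top x hx
  have he := fun τ => (g τ).isOrthonormalBasis_orthonormalFrame (A.dtop x)
  have hb := (hg.adapted t ht).isBilinearMap_T x
  have h := hasDerivAt_doubleTrace (hg.hasDerivAt_transitionSq ht hw he)
    (hw.transitionSq_self (he t)) fun a b a' b' =>
      hg.hasDerivAt_inner ht (A.T x (W a x) (W b x)) (A.T x (W a' x) (W b' x))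
  refine (h.congr_deriv ?_).congr_of_eventuallyEq (.of_forall fun τ => ?_)
  · have h3 : ∑ a, ∑ b, ∑ c, dtMetric g t x (W b x) (W c x) *
          (g t).inner x (A.T x (W a x) (W b x)) (A.T x (W a x) (W c x)) =
        ∑ a, ∑ c, ∑ b, dtMetric g t x (W a x) (W c x) *
          (g t).inner x (A.T x (W a x) (W b x)) (A.T x (W c x) (W b x)) := by
      rw [Finset.sum_comm]
      refine Finset.sum_congr rfl fun b _ => ?_
      rw [Finset.sum_comm]
      refine Finset.sum_congr rfl fun c _ => Finset.sum_congr rfl fun a _ => ?_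
      rw [(hg.adapted t ht).T_swap (W b x), (hg.adapted t ht).T_swap (W c x)]
      simp
    rw [h3, two_mul, sub_sub]
  · change A.normSqT (g τ) x = _
    rw [normSqT]
    exact hw.sum_diag₂ (he τ)
      (γ := fun u v u' v' => (g τ).inner x (A.T x u v) (A.T x u' v'))
      (fun v v' => ⟨by simp [hb.add_left], by simp [hb.smul_left], by simp [hb.add_left],
        by simp [hb.smul_left]⟩)
      (fun u u' => ⟨by simp [hb.add_right], by simp [hb.smul_right], by simp [hb.add_right],
        by simp [hb.smul_right]⟩)

/-- The derivative of `‖H‖²` in an adapted frame of `g_t`. -/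
theorem hasDerivAt_normSqH (hg : A.IsAdaptedVariation ε g) (ht : |t| < ε)
    (hF : A.IsAdaptedFrame (g t) U W Z) (hx : x ∈ U) :
    HasDerivAt (fun τ => A.normSqH (g τ) x)
      (-(∑ i, (g t).inner x (A.H (g t) x) (Z i x) *
          ∑ a, lieDeriv (dtMetric g t) (Z i) (W a) (W a) x)
        - 2 * ∑ a, ∑ b, dtMetric g t x (W a x) (W b x) *
          (g t).inner x (A.h (g t) x (W a x) (W b x)) (A.H (g t) x)
        - dtMetric g t x (A.H (g t) x) (A.H (g t) x)) t := by
  have hw := hF.basis_top x hx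
  have hz := hF.basis_perp x hx
  have he := fun τ => (g τ).isOrthonormalBasis_orthonormalFrame (A.dtop x)
  have hmem : ∀ τ, A.H (g τ) x ∈ A.dperp x := fun τ => Submodule.sum_mem _ fun c _ => A.h_mem _ _ _
  have hη : ∀ i, HasDerivAt (fun τ => (g τ).inner x (A.H (g τ) x) (Z i x))
      (∑ a, -(1 / 2) * lieDeriv (dtMetric g t) (Z i) (W a) (W a) x
        - ∑ a, ∑ b, dtMetric g t x (W a x) (W b x) *
          (g t).inner x (A.h (g t) x (W a x) (W b x)) (Z i x)) t := by
    intro i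
    refine (hasDerivAt_trace (hg.hasDerivAt_transitionSq ht hw he)
      (hw.transitionSq_self (he t)) fun a b =>
        hg.hasDerivAt_inner_h ht hF hx a b i).congr_of_eventuallyEq ?_
    filter_upwards [hg.eventually_isAdapted ht] with τ hτ
    rw [H, hw.sum_diag (he τ) (hτ.isBilinearMap_h x)]
    simp
  refine (hg.hasDerivAt_inner_of_components ht hz hmem hmem hη hη).congr_deriv ?_
  have h2 : ∀ a b, (g t).inner x (A.h (g t) x (W a x) (W b x)) (A.H (g t) x) =
      ∑ i, (g t).inner x (A.h (g t) x (W a x) (W b x)) (Z i x) *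
        (g t).inner x (A.H (g t) x) (Z i x) := by
    intro a b
    conv_lhs => rw [← hz.sum_repr _ (hmem t)]
    simp only [map_sum, map_smul, smul_eq_mul]
    exact Finset.sum_congr rfl fun i _ => by rw [(g t).inner_comm x (Z i x), mul_comm]
  have h3 : ∑ a, ∑ b, dtMetric g t x (W a x) (W b x) *
      (g t).inner x (A.h (g t) x (W a x) (W b x)) (A.H (g t) x) =
      ∑ i, (g t).inner x (A.H (g t) x) (Z i x) * ∑ a, ∑ b, dtMetric g t x (W a x) (W b x) *
          (g t).inner x (A.h (g t) x (W a x) (W b x)) (Z i x) := by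
    simp only [h2, Finset.mul_sum]
    rw [Finset.sum_comm (s := (Finset.univ : Finset (Fin p)))]
    refine Finset.sum_congr rfl fun a _ => ?_
    rw [Finset.sum_comm (s := (Finset.univ : Finset (Fin p)))]
    exact Finset.sum_congr rfl fun b _ => Finset.sum_congr rfl fun i _ => by ring
  rw [h3, Finset.mul_sum, ← Finset.sum_neg_distrib, ← Finset.sum_sub_distrib]
  congr 1
  refine Finset.sum_congr rfl fun i _ => ?_
  rw [← Finset.mul_sum]
  ring

end Frame

end IsAdaptedVariation

end AlmostProduct

/-! ### Divergences in an orthonormal frame -/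

namespace RiemMetric

variable {g : RiemMetric E M} {x : M}

theorem leviCivita_sum (g : RiemMetric E M) {ι : Type*} (s : Finset ι) {Y : ι → VecField E M}
    (hY : ∀ i ∈ s, MDiffAt (T% (Y i)) x) :
    g.leviCivita (fun y => ∑ i ∈ s, Y i y) x = ∑ i ∈ s, g.leviCivita (Y i) x := by
  classical
  induction s using Finset.induction_on with
  | empty =>
    simp only [Finset.sum_empty]
    exact g.leviCivita.isCovariantDerivativeOnUniv.zero (Set.mem_univ x)
  | insert a s ha ih =>
    simp only [Finset.sum_insert ha]
    rw [← ih fun i hi => hY i (Finset.mem_insert_of_mem hi)]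
    exact g.leviCivita_add (hY a (Finset.mem_insert_self a s))
      (.sum_section fun i hi => hY i (Finset.mem_insert_of_mem hi))

theorem div_smul (g : RiemMetric E M) {f : M → ℝ} {Y : VecField E M}
    (hf : MDiffAt f x) (hY : MDiffAt (T% Y) x) :
    g.div (fun y => f y • Y y) x = f x * g.div Y x + mvfderiv 𝓘(ℝ, E) f x (Y x) := by
  have _ : FiniteDimensional ℝ (TangentSpace 𝓘(ℝ, E) x) := inferInstanceAs (FiniteDimensional ℝ E)
  have h : (g.leviCivita (fun y => f y • Y y) x).toLinearMap =
      f x • (g.leviCivita Y x).toLinearMap +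
        (mvfderiv 𝓘(ℝ, E) f x).toLinearMap.smulRight (Y x) :=
    LinearMap.ext fun v => g.leviCivita_smul hf hY v
  rw [div, h, map_add, map_smul, LinearMap.trace_smulRight]
  rfl

theorem div_sum (g : RiemMetric E M) {ι : Type*} (s : Finset ι) {Y : ι → VecField E M}
    (hY : ∀ i ∈ s, MDiffAt (T% (Y i)) x) :
    g.div (fun y => ∑ i ∈ s, Y i y) x = ∑ i ∈ s, g.div (Y i) x := by
  simp only [div]
  rw [g.leviCivita_sum s hY, ← map_sum]
  congr 1
  ext v
  simp

/-- The divergence is local. -/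
theorem div_congr (g : RiemMetric E M) {Y Y' : VecField E M} (hY : MDiffAt (T% Y) x)
    (h : ∀ᶠ y in 𝓝 x, Y' y = Y y) : g.div Y' x = g.div Y x := by
  have hY' : MDiffAt (T% Y') x := hY.congr_of_eventuallyEq (h.mono fun y hy => by simp [hy])
  rw [div, div, g.leviCivita_congr hY' hY h]

theorem IsOrthonormalBasis.trace_eq {ι : Type*} [Fintype ι] [DecidableEq ι]
    {e : ι → TangentSpace 𝓘(ℝ, E) x} (he : g.IsOrthonormalBasis ⊤ e)
    (L : TangentSpace 𝓘(ℝ, E) x →ₗ[ℝ] TangentSpace 𝓘(ℝ, E) x) :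
    LinearMap.trace ℝ _ L = ∑ c, g.inner x (L (e c)) (e c) := by
  have hspan : ⊤ ≤ Submodule.span ℝ (Set.range e) := fun v hv => by
    rw [← he.sum_repr v hv]
    exact Submodule.sum_mem _ fun i _ => Submodule.smul_mem _ _ (Submodule.subset_span ⟨i, rfl⟩)
  let b := Basis.mk he.linearIndependent hspan
  have hb : ∀ c, b c = e c := fun c => Basis.mk_apply _ _ c
  have hrepr : ∀ v c, b.repr v c = g.inner x (e c) v := by
    intro v c
    conv_lhs => rw [← he.sum_repr v Submodule.mem_top]
    simp only [← hb]
    rw [b.repr_sum_self]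
  rw [LinearMap.trace_eq_matrix_trace ℝ b, Matrix.trace]
  refine Finset.sum_congr rfl fun c _ => ?_
  rw [Matrix.diag_apply, LinearMap.toMatrix_apply, hrepr, hb, g.inner_comm]

theorem div_eq_sum {ι : Type*} [Fintype ι] [DecidableEq ι] {e : ι → TangentSpace 𝓘(ℝ, E) x}
    (he : g.IsOrthonormalBasis ⊤ e) (Y : VecField E M) :
    g.div Y x = ∑ c, g.inner x (g.leviCivita Y x (e c)) (e c) :=
  he.trace_eq _

theorem inner_dualOp (g : RiemMetric E M) {P : Tensor12 E M} (hP : IsBilinearMap ℝ (P x))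
    (z u v : TangentSpace 𝓘(ℝ, E) x) :
    g.inner x (g.dualOp P x z u) v = g.inner x (P x u v) z := by
  conv_rhs => rw [← g.orthonormalFrame_sum ⊤ (Submodule.mem_top (x := v)), hP.map_sum_right]
  simp [dualOp, hP.smul_right, mul_comm]

theorem isLinearMap_dualOp (g : RiemMetric E M) {P : Tensor12 E M} (hP : IsBilinearMap ℝ (P x))
    (z : TangentSpace 𝓘(ℝ, E) x) : IsLinearMap ℝ (g.dualOp P x z) where
  map_add u v := g.ext_inner fun w => by simp [g.inner_dualOp hP, hP.add_left]
  map_smul r u := g.ext_inner fun w => by simp [g.inner_dualOp hP, hP.smul_left]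

/-! ### The covariant derivative of a (1,2)-tensor -/

/-- `P` is bilinear at every point, and `P(U, V)` is differentiable at `x` for all fields `U`, `V` that
are. -/
structure IsDiffTensorAt (P : Tensor12 E M) (x : M) : Prop where
  bilin : ∀ y, IsBilinearMap ℝ (P y)
  mdiff : ∀ {U V : VecField E M}, MDiffAt (T% U) x → MDiffAt (T% V) x →
    MDiffAt (T% (fun y => P y (U y) (V y))) x

/-- `(∇_w P)(U, V)`, as a function of the fields `U` and `V`. It is tensorial in both, which shows
that `RiemMetric.covDeriv` does not depend on the extensions in its definition. -/
def covDerivField (g : RiemMetric E M) (P : Tensor12 E M) (x : M) (w : TangentSpace 𝓘(ℝ, E) x)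
    (U V : VecField E M) : TangentSpace 𝓘(ℝ, E) x :=
  g.leviCivita (fun y => P y (U y) (V y)) x w
    - P x (g.leviCivita U x w) (V x) - P x (U x) (g.leviCivita V x w)

theorem IsDiffTensorAt.tensorial_left {P : Tensor12 E M} (hP : IsDiffTensorAt P x)
    (w : TangentSpace 𝓘(ℝ, E) x) {V : VecField E M} (hV : MDiffAt (T% V) x) :
    TensorialAt 𝓘(ℝ, E) E (g.covDerivField P x w · V) x where
  smul {f U} hf hU := by
    have e : (fun y => P y ((f • U) y) (V y)) = f • fun y => P y (U y) (V y) := by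
      ext y
      exact (hP.bilin y).smul_left (f y) (U y) (V y)
    simp only [covDerivField]
    rw [e, g.leviCivita_smul hf (hP.mdiff hU hV), g.leviCivita_smul hf hU]
    simp only [Pi.smul_apply', (hP.bilin x).add_left, (hP.bilin x).smul_left]
    module
  add {U U'} hU hU' := by
    have e : (fun y => P y ((U + U') y) (V y)) =
        (fun y => P y (U y) (V y)) + fun y => P y (U' y) (V y) := by
      ext y
      exact (hP.bilin y).add_left (U y) (U' y) (V y)
    simp only [covDerivField]
    rw [e, g.leviCivita_add (hP.mdiff hU hV) (hP.mdiff hU' hV), g.leviCivita_add hU hU']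
    simp only [Pi.add_apply, add_apply, (hP.bilin x).add_left]
    module

theorem IsDiffTensorAt.tensorial_right {P : Tensor12 E M} (hP : IsDiffTensorAt P x)
    (w : TangentSpace 𝓘(ℝ, E) x) {U : VecField E M} (hU : MDiffAt (T% U) x) :
    TensorialAt 𝓘(ℝ, E) E (g.covDerivField P x w U ·) x where
  smul {f V} hf hV := by
    have e : (fun y => P y (U y) ((f • V) y)) = f • fun y => P y (U y) (V y) := by
      ext y
      exact (hP.bilin y).smul_right (f y) (U y) (V y)
    simp only [covDerivField]
    rw [e, g.leviCivita_smul hf (hP.mdiff hU hV), g.leviCivita_smul hf hV]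
    simp only [Pi.smul_apply', (hP.bilin x).add_right, (hP.bilin x).smul_right]
    module
  add {V V'} hV hV' := by
    have e : (fun y => P y (U y) ((V + V') y)) =
        (fun y => P y (U y) (V y)) + fun y => P y (U y) (V' y) := by
      ext y
      exact (hP.bilin y).add_right (U y) (V y) (V' y)
    simp only [covDerivField]
    rw [e, g.leviCivita_add (hP.mdiff hU hV) (hP.mdiff hU hV'), g.leviCivita_add hV hV']
    simp only [Pi.add_apply, add_apply, (hP.bilin x).add_right]
    module

/-- `∇P` may be computed with any differentiable extensions of its arguments. -/
theorem IsDiffTensorAt.covDeriv_apply {P : Tensor12 E M} (hP : IsDiffTensorAt P x)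
    (w : TangentSpace 𝓘(ℝ, E) x) {U V : VecField E M} (hU : MDiffAt (T% U) x)
    (hV : MDiffAt (T% V) x) :
    g.covDeriv P x w (U x) (V x) = g.leviCivita (fun y => P y (U y) (V y)) x w
      - P x (g.leviCivita U x w) (V x) - P x (U x) (g.leviCivita V x w) := by
  have hu := FiberBundle.mdifferentiableAt_extend 𝓘(ℝ, E) E (U x)
  have hv := FiberBundle.mdifferentiableAt_extend 𝓘(ℝ, E) E (V x)
  have h := TensorialAt.pointwise₂ (Φ := g.covDerivField P x w)
    (fun _ h => hP.tensorial_left w h) (fun _ h => hP.tensorial_right w h) hu hU hv hV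
    (by simp) (by simp)
  simpa [covDeriv, covDerivField] using h

theorem IsDiffTensorAt.isBilinearMap_covDeriv {P : Tensor12 E M} (hP : IsDiffTensorAt P x)
    (w : TangentSpace 𝓘(ℝ, E) x) : IsBilinearMap ℝ (g.covDeriv P x w) := by
  have _ : T2Space (TangentSpace 𝓘(ℝ, E) x) := inferInstanceAs (T2Space E)
  let B := TensorialAt.mkHom₂ (g.covDerivField P x w) x
    (fun _ h => hP.tensorial_left w h) (fun _ h => hP.tensorial_right w h)
  have h : ∀ u v, g.covDeriv P x w u v = B u v := fun u v => by
    simp [B, TensorialAt.mkHom₂_apply_eq_extend, covDeriv, covDerivField]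
  exact ⟨by simp [h], by simp [h], by simp [h], by simp [h]⟩

theorem IsDiffTensorAt.isBilinearMap_divTensor {P : Tensor12 E M} (hP : IsDiffTensorAt P x) :
    IsBilinearMap ℝ (g.divTensor P x) := by
  have h := fun w => hP.isBilinearMap_covDeriv (g := g) w
  exact
    { add_left := by simp [divTensor, (h _).add_left, Finset.sum_add_distrib]
      smul_left := by simp [divTensor, (h _).smul_left, Finset.mul_sum]
      add_right := by simp [divTensor, (h _).add_right, Finset.sum_add_distrib]
      smul_right := by simp [divTensor, (h _).smul_right, Finset.mul_sum] }

/-- `(div P)(U, V) = div (P(U, V)) - ∑_c g(P(∇_{e_c} U, V) + P(U, ∇_{e_c} V), e_c)`. -/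
theorem IsDiffTensorAt.divTensor_apply {P : Tensor12 E M} (hP : IsDiffTensorAt P x)
    {ι : Type*} [Fintype ι] [DecidableEq ι] {e : ι → TangentSpace 𝓘(ℝ, E) x}
    (he : g.IsOrthonormalBasis ⊤ e) {U V : VecField E M} (hU : MDiffAt (T% U) x)
    (hV : MDiffAt (T% V) x) :
    g.divTensor P x (U x) (V x) = g.div (fun y => P y (U y) (V y)) x
      - ∑ c, g.inner x (P x (g.leviCivita U x (e c)) (V x)) (e c)
      - ∑ c, g.inner x (P x (U x) (g.leviCivita V x (e c))) (e c) := by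
  have hb := hP.bilin x
  have h1 : IsBilinearMap ℝ fun w w' : TangentSpace 𝓘(ℝ, E) x =>
      g.inner x (g.covDeriv P x w (U x) (V x)) w' :=
    { add_left := fun w₁ w₂ w' => by
        simp only [hP.covDeriv_apply _ hU hV, map_add, hb.add_left, hb.add_right, map_sub,
          add_apply, sub_apply]
        ring
      smul_left := fun r w w' => by
        simp only [hP.covDeriv_apply _ hU hV, map_smul, hb.smul_left, hb.smul_right, map_sub,
          smul_apply, sub_apply, smul_eq_mul]
        ring
      add_right := by simp
      smul_right := by simp }
  have h2 := he.sum_diag_eq (g.isOrthonormalBasis_orthonormalFrame ⊤) h1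
  rw [divTensor, h2, div_eq_sum he, ← Finset.sum_sub_distrib, ← Finset.sum_sub_distrib]
  simp only [hP.covDeriv_apply _ hU hV, map_sub, sub_apply]

end RiemMetric

/-! ### Tensors that vanish on the second distribution -/

namespace AlmostProduct

variable {n p : ℕ} {A : AlmostProduct E M n p} {g : RiemMetric E M} {x : M}

namespace IsAdapted

variable {ι κ : Type*} [Fintype ι] [DecidableEq ι] [Fintype κ] [DecidableEq κ]
  {w : ι → TangentSpace 𝓘(ℝ, E) x} {z : κ → TangentSpace 𝓘(ℝ, E) x}
  {V : Type*} [AddCommGroup V] [Module ℝ V]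

theorem isOrthonormalBasis_sumElim (hA : A.IsAdapted g) (hw : g.IsOrthonormalBasis (A.dtop x) w)
    (hz : g.IsOrthonormalBasis (A.dperp x) z) : g.IsOrthonormalBasis ⊤ (Sum.elim w z) where
  mem _ := Submodule.mem_top
  inner := by
    rintro (a | i) (b | j)
    · simp [hw.inner]
    · simpa using hA x _ (hw.mem a) _ (hz.mem j)
    · simpa using hA.swap x _ (hz.mem i) _ (hw.mem b)
    · simp [hz.inner]
  sum_repr v _ := by
    conv_rhs => rw [← projTop_add_projPerp (A := A) v, hA.projTop_eq_sum hw]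
    have h : A.projPerp x v = ∑ i, g.inner x (z i) v • z i := hA.swap.projTop_eq_sum hz v
    simp [h]

/-- A bilinear map that vanishes on `𝒟` in its first argument only sees the components of this
argument along `𝒟̃`. -/
theorem apply_left_of_eq_zero (hA : A.IsAdapted g) (hw : g.IsOrthonormalBasis (A.dtop x) w)
    {β : TangentSpace 𝓘(ℝ, E) x → TangentSpace 𝓘(ℝ, E) x → V} (hβ : IsBilinearMap ℝ β)
    (h0 : ∀ u ∈ A.dperp x, ∀ v, β u v = 0) (u v : TangentSpace 𝓘(ℝ, E) x) :
    β u v = ∑ a, g.inner x (w a) u • β (w a) v := by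
  conv_lhs => rw [← projTop_add_projPerp (A := A) u, hβ.add_left, h0 _ (A.projPerp_mem u), add_zero,
    hA.projTop_eq_sum hw, hβ.map_sum_left]
  simp only [hβ.smul_left]

theorem apply_right_of_eq_zero (hA : A.IsAdapted g) (hw : g.IsOrthonormalBasis (A.dtop x) w)
    {β : TangentSpace 𝓘(ℝ, E) x → TangentSpace 𝓘(ℝ, E) x → V} (hβ : IsBilinearMap ℝ β)
    (h0 : ∀ u ∈ A.dperp x, ∀ v, β v u = 0) (u v : TangentSpace 𝓘(ℝ, E) x) :
    β u v = ∑ b, g.inner x (w b) v • β u (w b) := by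
  conv_lhs => rw [← projTop_add_projPerp (A := A) v, hβ.add_right, h0 _ (A.projPerp_mem v), add_zero,
    hA.projTop_eq_sum hw, hβ.map_sum_right]
  simp only [hβ.smul_right]

/-- The full contraction of two bilinear maps, one of which vanishes on `𝒟`, is a sum over an
orthonormal basis of `𝒟̃`. -/
theorem sum_smul_eq (hA : A.IsAdapted g) (hw : g.IsOrthonormalBasis (A.dtop x) w)
    {e : κ → TangentSpace 𝓘(ℝ, E) x} (he : g.IsOrthonormalBasis ⊤ e)
    {β : TangentSpace 𝓘(ℝ, E) x → TangentSpace 𝓘(ℝ, E) x → ℝ} (hβ : IsBilinearMap ℝ β)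
    (h0 : ∀ u ∈ A.dperp x, ∀ v, β u v = 0 ∧ β v u = 0)
    {P : TangentSpace 𝓘(ℝ, E) x → TangentSpace 𝓘(ℝ, E) x → V} (hP : IsBilinearMap ℝ P) :
    ∑ c, ∑ d, β (e c) (e d) • P (e c) (e d) = ∑ a, ∑ b, β (w a) (w b) • P (w a) (w b) := by
  have hz := g.isOrthonormalBasis_orthonormalFrame (A.dperp x)
  have hs := hA.isOrthonormalBasis_sumElim hw hz
  have h := hs.sum_diag₂ he (γ := fun u v u' v' => β u v • P u' v')
    (fun v v' => ⟨by simp [hβ.add_left, add_smul], by simp [hβ.smul_left, mul_smul],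
      by simp [hP.add_left], fun r u u' => by simp only [hP.smul_left, smul_comm r]⟩)
    (fun u u' => ⟨by simp [hβ.add_right, add_smul], by simp [hβ.smul_right, mul_smul],
      by simp [hP.add_right], fun r v v' => by simp only [hP.smul_right, smul_comm r]⟩)
  have h1 := fun i v => (h0 _ (hz.mem i) v).1
  have h2 := fun i v => (h0 _ (hz.mem i) v).2
  simpa [hs.transitionSq_self he, Matrix.one_apply, Fintype.sum_sum_type, h1, h2, ite_smul,
    Finset.sum_ite_irrel, apply_ite] using h

/-- The trace of a bilinear map that vanishes on `𝒟` is a trace over `𝒟̃`. -/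
theorem sum_diag_top (hA : A.IsAdapted g) (hw : g.IsOrthonormalBasis (A.dtop x) w)
    {e : κ → TangentSpace 𝓘(ℝ, E) x} (he : g.IsOrthonormalBasis ⊤ e)
    {β : TangentSpace 𝓘(ℝ, E) x → TangentSpace 𝓘(ℝ, E) x → V} (hβ : IsBilinearMap ℝ β)
    (h0 : ∀ u ∈ A.dperp x, β u u = 0) : ∑ c, β (e c) (e c) = ∑ a, β (w a) (w a) := by
  have hz := g.isOrthonormalBasis_orthonormalFrame (A.dperp x)
  rw [(hA.isOrthonormalBasis_sumElim hw hz).sum_diag_eq he hβ, Fintype.sum_sum_type]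
  simp [fun i => h0 _ (hz.mem i)]

/-- The operator dual to `P` takes values in `𝒟̃` if `P` vanishes on `𝒟`. -/
theorem dualOp_eq (hA : A.IsAdapted g) (hw : g.IsOrthonormalBasis (A.dtop x) w) {P : Tensor12 E M}
    (hP : IsBilinearMap ℝ (P x)) (h0 : ∀ u, ∀ v ∈ A.dperp x, P x u v = 0)
    (ξ u : TangentSpace 𝓘(ℝ, E) x) :
    g.dualOp P x ξ u = ∑ c, g.inner x (P x u (w c)) ξ • w c :=
  hA.sum_diag_top hw (g.isOrthonormalBasis_orthonormalFrame ⊤)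
    (β := fun v v' => g.inner x (P x u v) ξ • v')
    ⟨by simp [hP.add_right, add_smul], by simp [hP.smul_right, mul_smul], by simp,
      fun r v v' => by simp only [smul_comm r]⟩ fun v hv => by simp [h0 u v hv]

theorem KFlat_apply (hA : A.IsAdapted g) (hw : g.IsOrthonormalBasis (A.dtop x) w)
    (hz : g.IsOrthonormalBasis (A.dperp x) z) (a b : ι) :
    A.KFlat g x (w a) (w b) = ∑ i, ∑ c,
      (g.inner x (A.h g x (w a) (w c)) (z i) * g.inner x (A.T x (w c) (w b)) (z i)
        - g.inner x (A.T x (w a) (w c)) (z i) * g.inner x (A.h g x (w c) (w b)) (z i)) := by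
  have hh := hA.isBilinearMap_h x
  have hT := hA.isBilinearMap_T x
  rw [KFlat, map_sum, sum_apply]
  have h1 : ∀ ξ, g.inner x (A.Tsharp g x ξ (A.weingarten g x ξ (w a))
        - A.weingarten g x ξ (A.Tsharp g x ξ (w a))) (w b) = ∑ c,
      (g.inner x (A.h g x (w a) (w c)) ξ * g.inner x (A.T x (w c) (w b)) ξ
        - g.inner x (A.T x (w a) (w c)) ξ * g.inner x (A.h g x (w c) (w b)) ξ) := by
    intro ξ
    rw [map_sub, sub_apply, Tsharp, weingarten, weingarten, Tsharp, g.inner_dualOp hT,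
      g.inner_dualOp hh, hA.dualOp_eq hw hh fun _ _ => hA.h_of_mem_dperp,
      hA.dualOp_eq hw hT fun _ _ => hA.T_of_mem_dperp, hT.map_sum_left, hh.map_sum_left]
    simp [hh.smul_left, hT.smul_left]
  simp only [h1]
  refine hz.sum_diag_eq (g.isOrthonormalBasis_orthonormalFrame _) (β := fun ξ ξ' => ∑ c,
      (g.inner x (A.h g x (w a) (w c)) ξ * g.inner x (A.T x (w c) (w b)) ξ'
        - g.inner x (A.T x (w a) (w c)) ξ * g.inner x (A.h g x (w c) (w b)) ξ'))
    ⟨fun _ _ _ => ?_, fun _ _ _ => ?_, fun _ _ _ => ?_, fun _ _ _ => ?_⟩ <;>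
  simp only [map_add, map_smul, ← Finset.sum_add_distrib, Finset.mul_sum, smul_eq_mul] <;>
  exact Finset.sum_congr rfl fun _ _ => by ring

theorem casoratiTFlat_apply (hA : A.IsAdapted g) (hw : g.IsOrthonormalBasis (A.dtop x) w)
    (a b : ι) :
    A.casoratiTFlat g x (w a) (w b) =
      -∑ c, g.inner x (A.T x (w a) (w c)) (A.T x (w b) (w c)) := by
  have hT := hA.isBilinearMap_T x
  have hz := g.isOrthonormalBasis_orthonormalFrame (A.dperp x)
  rw [casoratiTFlat, map_sum, sum_apply]
  have h1 : ∀ ξ, g.inner x (A.Tsharp g x ξ (A.Tsharp g x ξ (w a))) (w b) = -∑ c,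
      g.inner x (A.T x (w a) (w c)) ξ * g.inner x (A.T x (w b) (w c)) ξ := by
    intro ξ
    rw [Tsharp, Tsharp, g.inner_dualOp hT, hA.dualOp_eq hw hT fun _ _ => hA.T_of_mem_dperp,
      hT.map_sum_left]
    simp [hT.smul_left, hA.T_swap (w b)]
  simp only [h1]
  rw [Finset.sum_neg_distrib, Finset.sum_comm]
  congr 1
  refine Finset.sum_congr rfl fun c _ => ?_
  conv_rhs => rw [← hz.sum_repr _ (A.T_mem (w b) (w c))]
  simp only [map_sum, map_smul, smul_eq_mul]
  exact Finset.sum_congr rfl fun i _ => by rw [g.inner_comm x _ (A.T x (w b) (w c)), mul_comm]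

end IsAdapted

/-! ### Smoothness of the second fundamental form -/

section Frame

variable {U : Set M} {W : Fin n → VecField E M} {Z : Fin p → VecField E M}

/-- The components of `h` in a smooth adapted frame are differentiable, since the formula
`g(h(U, V), Z) = -(1/2) (L_Z g)(U, V)` expresses them by Lie brackets of the frame fields. -/
theorem mdifferentiableAt_inner_h (hA : A.IsAdapted g) (hF : A.IsAdaptedFrame g U W Z) (hx : x ∈ U)
    (a b : Fin n) (i : Fin p) :
    MDiffAt (fun y => g.inner y (A.h g y (W a y) (W b y)) (Z i y)) x := by
  have _ : IsManifold 𝓘(ℝ, E) (minSmoothness ℝ 2) M := by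
    rw [minSmoothness_of_isRCLikeNormedField]
    exact .of_le (n := ∞) ENat.LEInfty.out
  have _ : IsManifold 𝓘(ℝ, E) ((2 : ℕ∞) + 1) M :=
    .of_le (n := ∞) (by exact_mod_cast (le_top : (2 + 1 : ℕ∞) ≤ ⊤))
  have h2 : (2 : ℕ∞ω) ≤ ∞ := ENat.LEInfty.out
  have h3 : minSmoothness ℝ (((1 : ℕ∞) : ℕ∞ω) + 1) ≤ ((2 : ℕ∞) : ℕ∞ω) := by
    rw [minSmoothness_of_isRCLikeNormedField]
    exact le_of_eq one_add_one_eq_two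
  have hbr : ∀ c, MDiffAt (T% (VectorField.mlieBracket 𝓘(ℝ, E) (Z i) (W c))) x := fun c =>
    (ContMDiffAt.mlieBracket_vectorField (m := 1) ((hF.smooth_perp x hx i).of_le h2)
      ((hF.smooth_top x hx c).of_le h2) h3).mdifferentiableAt (by simp)
  have hW := fun c => (hF.isTopSection hx c).mdiff
  have h : MDiffAt (fun y => (1 / 2 : ℝ) *
      (g.inner y (VectorField.mlieBracket 𝓘(ℝ, E) (Z i) (W a) y) (W b y) +
        g.inner y (W a y) (VectorField.mlieBracket 𝓘(ℝ, E) (Z i) (W b) y))) x :=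
    mdifferentiableAt_const.mul
      ((g.mdifferentiableAt_inner (hbr a) (hW b)).add (g.mdifferentiableAt_inner (hW a) (hbr b)))
  refine h.congr_of_eventuallyEq ?_
  filter_upwards [hF.isOpen.mem_nhds hx] with y hy
  have h0 : (fun y' => g.inner y' (W a y') (W b y')) =ᶠ[𝓝 y] fun _ => if a = b then 1 else 0 := by
    filter_upwards [hF.isOpen.mem_nhds hy] with y' hy' using (hF.basis_top y' hy').inner a b
  rw [hA.inner_h (hF.isTopSection hy a) (hF.isTopSection hy b) (hF.swap.isTopSection hy i),
    lieDeriv, h0.mvfderiv_eq, mvfderiv_const]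
  simp only [zero_apply]
  ring

/-- The tensor `h` is differentiable. This makes `div h` and the divergences of `H` and `⟨h, S⟩`
computable by the Leibniz rule. -/
theorem IsAdapted.isDiffTensorAt_h (hA : A.IsAdapted g) (x : M) :
    RiemMetric.IsDiffTensorAt (A.h g) x := by
  refine ⟨hA.isBilinearMap_h, fun {U V} hU hV => ?_⟩
  obtain ⟨O, hx, W, Z, hF⟩ := A.exists_isAdaptedFrame g x
  have hW := fun c => (hF.isTopSection hx c).mdiff
  have hZ := fun i => (hF.swap.isTopSection hx i).mdiff
  have h : MDiffAt (T% (fun y => ∑ a, ∑ b, ∑ i, (g.inner y (W a y) (U y) * g.inner y (W b y) (V y) *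
      g.inner y (A.h g y (W a y) (W b y)) (Z i y)) • Z i y)) x :=
    .sum_section fun a _ => .sum_section fun b _ => .sum_section fun i _ =>
      MDifferentiableAt.smul_section (((g.mdifferentiableAt_inner (hW a) hU).mul
        (g.mdifferentiableAt_inner (hW b) hV)).mul (mdifferentiableAt_inner_h hA hF hx a b i)) (hZ i)
  refine h.congr_of_eventuallyEq ?_
  filter_upwards [hF.isOpen.mem_nhds hx] with y hy
  have hb := hA.isBilinearMap_h y
  have h0 : ∀ u ∈ A.dperp y, ∀ v, A.h g y v u = 0 := fun u hu v => hA.h_of_mem_dperp hu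
  have h1 : A.h g y (U y) (V y) = ∑ a, ∑ b, ∑ i, (g.inner y (W a y) (U y) *
      g.inner y (W b y) (V y) * g.inner y (A.h g y (W a y) (W b y)) (Z i y)) • Z i y := by
    rw [hA.apply_left_of_eq_zero (hF.basis_top y hy) hb fun u hu v => by
      rw [A.h_comm, h0 u hu]]
    refine Finset.sum_congr rfl fun a _ => ?_
    rw [hA.apply_right_of_eq_zero (hF.basis_top y hy) hb h0, Finset.smul_sum]
    refine Finset.sum_congr rfl fun b _ => ?_
    conv_lhs => rw [← (hF.basis_perp y hy).sum_repr _ (A.h_mem g (W a y) (W b y))]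
    simp only [Finset.smul_sum, mul_smul, g.inner_comm y (Z _ y)]
  rw [h1]

theorem IsAdaptedFrame.H_eq (hA : A.IsAdapted g) (hF : A.IsAdaptedFrame g U W Z) {y : M}
    (hy : y ∈ U) : A.H g y = ∑ a, A.h g y (W a y) (W a y) :=
  (hF.basis_top y hy).sum_diag_eq (g.isOrthonormalBasis_orthonormalFrame _) (hA.isBilinearMap_h y)

theorem IsAdapted.mdifferentiableAt_H (hA : A.IsAdapted g) (x : M) : MDiffAt (T% (A.H g)) x := by
  obtain ⟨U, hx, W, Z, hF⟩ := A.exists_isAdaptedFrame g x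
  have hW := fun c => (hF.isTopSection hx c).mdiff
  have h : MDiffAt (T% (fun y => ∑ a, A.h g y (W a y) (W a y))) x :=
    .sum_section fun a _ => (hA.isDiffTensorAt_h x).mdiff (hW a) (hW a)
  refine h.congr_of_eventuallyEq ?_
  filter_upwards [hF.isOpen.mem_nhds hx] with y hy
  rw [hF.H_eq hA hy]

end Frame

/-! ### Lie derivatives and divergences in an adapted frame -/

/-- The pointwise identity behind the variation of `‖h‖²`. For a fixed normal direction, `φ` and `θ`
are the matrices of `h` and `T`, and `Γ` is the connection matrix of an orthonormal frame. Both sides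
are equal to `2 tr (φ Γ S) + 2 tr (φ θ S)`. -/
theorem sum_connection_identity {ι : Type*} [Fintype ι] {φ θ Γ S : ι → ι → ℝ}
    (hφ : ∀ a b, φ b a = φ a b) (hθ : ∀ a b, θ b a = -θ a b) (hΓ : ∀ a b, Γ b a = -Γ a b)
    (hS : ∀ a b, S b a = S a b) :
    ∑ a, ∑ b, φ a b * (∑ c, (Γ a c + φ a c + θ a c) * S c b + ∑ c, (Γ b c + φ b c + θ b c) * S a c)
        - 2 * ∑ a, ∑ c, ∑ b, S a c * (φ a b * φ c b) =
      ∑ a, ∑ b, S a b * (-(∑ c, Γ a c * φ c b) - (∑ c, Γ b c * φ a c)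
        + ∑ c, (φ a c * θ c b - θ a c * φ c b)) := by
  classical
  let F : Matrix ι ι ℝ := Matrix.of φ
  let Θ : Matrix ι ι ℝ := Matrix.of θ
  let G : Matrix ι ι ℝ := Matrix.of Γ
  let K : Matrix ι ι ℝ := Matrix.of S
  have hF : F.transpose = F := Matrix.ext fun a b => hφ a b
  have hT : Θ.transpose = -Θ := Matrix.ext fun a b => hθ a b
  have hG : G.transpose = -G := Matrix.ext fun a b => hΓ a b
  have hK : K.transpose = K := Matrix.ext fun a b => hS a b
  -- The matrices of `φ`, `θ`, `Γ`, `S` are `F`, `Θ`, `G`, `K`.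
  have htr : ∀ P Q : Matrix ι ι ℝ, (P.transpose * Q).trace = ∑ a, ∑ b, P a b * Q a b := fun P Q => by
    simp only [Matrix.trace, Matrix.diag_apply, Matrix.mul_apply, Matrix.transpose_apply]
    exact Finset.sum_comm
  have e1 : ∑ a, ∑ b, φ a b * (∑ c, (Γ a c + φ a c + θ a c) * S c b
      + ∑ c, (Γ b c + φ b c + θ b c) * S a c) =
      (F.transpose * ((G + F + Θ) * K + K * (G + F + Θ).transpose)).trace := by
    rw [htr]
    refine Finset.sum_congr rfl fun a _ => Finset.sum_congr rfl fun b _ => ?_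
    simp [Matrix.mul_apply, F, Θ, G, K, mul_comm]
  have e2 : ∑ a, ∑ c, ∑ b, S a c * (φ a b * φ c b) = (K.transpose * (F * F.transpose)).trace := by
    rw [htr]
    refine Finset.sum_congr rfl fun a _ => Finset.sum_congr rfl fun c _ => ?_
    simp [Matrix.mul_apply, F, K, Finset.mul_sum]
  have e3 : ∑ a, ∑ b, S a b * (-(∑ c, Γ a c * φ c b) - (∑ c, Γ b c * φ a c)
        + ∑ c, (φ a c * θ c b - θ a c * φ c b)) =
      (K.transpose * (-(G * F) - F * G.transpose + (F * Θ - Θ * F))).trace := by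
    rw [htr]
    refine Finset.sum_congr rfl fun a _ => Finset.sum_congr rfl fun b _ => ?_
    simp [Matrix.mul_apply, F, Θ, G, K, mul_comm]
  rw [e1, e2, e3]
  simp only [Matrix.transpose_add, hF, hT, hG, hK, mul_add, add_mul, mul_sub, mul_neg,
    Matrix.trace_add, Matrix.trace_sub, Matrix.trace_neg, ← mul_assoc]
  -- Bring all traces to the forms `tr (F G K)`, `tr (F Θ K)`, `tr (F F K)`, by cyclic permutation
  -- and transposition.
  have c1 := Matrix.trace_mul_cycle F G K
  have c2 := Matrix.trace_mul_cycle F Θ K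
  have c3 := Matrix.trace_mul_cycle F F K
  have c4 := Matrix.trace_mul_cycle F K F
  have c5 := Matrix.trace_mul_cycle K G F
  have c6 := Matrix.trace_mul_cycle K Θ F
  have t1 : (F * K * G).trace = -(F * G * K).trace := by
    rw [← Matrix.trace_transpose]
    simp only [Matrix.transpose_mul, hF, hG, hK, neg_mul, Matrix.trace_neg, ← mul_assoc]
    have := Matrix.trace_mul_cycle G K F
    linarith
  have t2 : (F * K * Θ).trace = -(F * Θ * K).trace := by
    rw [← Matrix.trace_transpose]
    simp only [Matrix.transpose_mul, hF, hT, hK, neg_mul, Matrix.trace_neg, ← mul_assoc]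
    have := Matrix.trace_mul_cycle Θ K F
    linarith
  linarith

section Frame

variable {U : Set M} {W : Fin n → VecField E M} {Z : Fin p → VecField E M}

/-- `g([Z_i, W_a], W_c)` is the sum of the connection form `g(∇_{Z_i} W_a, W_c)` and the components
of `h` and `T`. -/
theorem IsAdaptedFrame.inner_mlieBracket (hA : A.IsAdapted g) (hF : A.IsAdaptedFrame g U W Z)
    (hx : x ∈ U) (i : Fin p) (a c : Fin n) :
    g.inner x (W c x) (VectorField.mlieBracket 𝓘(ℝ, E) (Z i) (W a) x) =
      g.inner x (g.leviCivita (W a) x (Z i x)) (W c x)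
        + g.inner x (A.h g x (W a x) (W c x)) (Z i x)
        + g.inner x (A.T x (W a x) (W c x)) (Z i x) := by
  have hz := hF.swap.isTopSection hx i
  have ha := hF.isTopSection hx a
  have hc := hF.isTopSection hx c
  have h := hA.inner_leviCivita_perp ((hF.basis_top x hx).mem a) hc hz
  rw [← hA.h_add_T] at h
  rw [g.inner_comm, ← g.leviCivita_sub_swap hz.mdiff ha.mdiff]
  simp only [map_sub, map_add, sub_apply, add_apply] at h ⊢
  linarith

/-- The connection matrix of an orthonormal frame is skew-symmetric. -/
theorem IsAdaptedFrame.inner_leviCivita_swap (hF : A.IsAdaptedFrame g U W Z) (hx : x ∈ U)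
    (v : TangentSpace 𝓘(ℝ, E) x) (a b : Fin n) :
    g.inner x (g.leviCivita (W b) x v) (W a x) = -g.inner x (g.leviCivita (W a) x v) (W b x) := by
  have h0 : (fun y => g.inner y (W a y) (W b y)) =ᶠ[𝓝 x] fun _ => if a = b then 1 else 0 := by
    filter_upwards [hF.isOpen.mem_nhds hx] with y hy using (hF.basis_top y hy).inner a b
  have h := g.mvfderiv_inner (hF.isTopSection hx a).mdiff (hF.isTopSection hx b).mdiff v
  rw [h0.mvfderiv_eq, mvfderiv_const, g.inner_comm x (W a x)] at h
  simp at h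
  linarith

/-- The Lie derivative of a tensor that vanishes on `𝒟`, in an adapted frame. -/
theorem IsAdaptedFrame.lieDeriv_eq (hA : A.IsAdapted g) (hF : A.IsAdaptedFrame g U W Z) (hx : x ∈ U)
    {S : Tensor02 E M} (hS : IsBilinearMap ℝ (S x)) (h0 : A.swap.IsPerpTruncated S)
    (i : Fin p) (a b : Fin n) :
    lieDeriv S (Z i) (W a) (W b) x = mvfderiv 𝓘(ℝ, E) (fun y => S y (W a y) (W b y)) x (Z i x)
      - (∑ c, g.inner x (W c x) (VectorField.mlieBracket 𝓘(ℝ, E) (Z i) (W a) x) *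
          S x (W c x) (W b x)
        + ∑ c, g.inner x (W c x) (VectorField.mlieBracket 𝓘(ℝ, E) (Z i) (W b) x) *
          S x (W a x) (W c x)) := by
  rw [lieDeriv, hA.apply_left_of_eq_zero (hF.basis_top x hx) hS (fun u hu v => (h0 x u hu v).1)
    (VectorField.mlieBracket 𝓘(ℝ, E) (Z i) (W a) x),
    hA.apply_right_of_eq_zero (hF.basis_top x hx) hS (fun u hu v => (h0 x u hu v).2) _
    (VectorField.mlieBracket 𝓘(ℝ, E) (Z i) (W b) x)]
  simp only [smul_eq_mul]
  ring

/-- `div h` in an adapted frame. -/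
theorem IsAdaptedFrame.divTensor_h (hA : A.IsAdapted g) (hF : A.IsAdaptedFrame g U W Z) (hx : x ∈ U)
    (a b : Fin n) :
    g.divTensor (A.h g) x (W a x) (W b x) = g.div (fun y => A.h g y (W a y) (W b y)) x
      + ∑ i, (-(∑ c, g.inner x (g.leviCivita (W a) x (Z i x)) (W c x) *
            g.inner x (A.h g x (W c x) (W b x)) (Z i x))
        - ∑ c, g.inner x (g.leviCivita (W b) x (Z i x)) (W c x) *
            g.inner x (A.h g x (W a x) (W c x)) (Z i x)) := by
  have hw := hF.basis_top x hx
  have hb := hA.isBilinearMap_h x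
  have h0 : ∀ u v c, g.inner x (A.h g x u v) (W c x) = 0 := fun u v c =>
    hA.swap x _ (A.h_mem g u v) _ (hw.mem c)
  rw [(hA.isDiffTensorAt_h x).divTensor_apply
    (hA.isOrthonormalBasis_sumElim hw (hF.basis_perp x hx)) (hF.isTopSection hx a).mdiff
    (hF.isTopSection hx b).mdiff, Fintype.sum_sum_type, Fintype.sum_sum_type]
  simp only [Sum.elim_inl, Sum.elim_inr, h0, Finset.sum_const_zero, zero_add]
  rw [Finset.sum_sub_distrib, Finset.sum_neg_distrib, sub_sub, ← neg_add', sub_eq_add_neg]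
  congr 3
  · refine Finset.sum_congr rfl fun i _ => ?_
    rw [hA.apply_left_of_eq_zero hw hb fun u hu v => by rw [A.h_comm, hA.h_of_mem_dperp hu]]
    simp [g.inner_comm x (W _ x)]
  · refine Finset.sum_congr rfl fun i _ => ?_
    rw [hA.apply_right_of_eq_zero hw hb fun u hu v => hA.h_of_mem_dperp hu]
    simp [g.inner_comm x (W _ x)]

/-- The Leibniz rule for `div ⟨h, S⟩` in an adapted frame. -/
theorem IsAdaptedFrame.div_contract (hA : A.IsAdapted g) (hF : A.IsAdaptedFrame g U W Z)
    (hx : x ∈ U) {S : Tensor02 E M} (hS : ∀ y, IsBilinearMap ℝ (S y))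
    (h0 : A.swap.IsPerpTruncated S) (hd : ∀ a b, MDiffAt (fun y => S y (W a y) (W b y)) x) :
    g.div (g.contract (A.h g) S) x = ∑ a, ∑ b,
      (S x (W a x) (W b x) * g.div (fun y => A.h g y (W a y) (W b y)) x
        + mvfderiv 𝓘(ℝ, E) (fun y => S y (W a y) (W b y)) x (A.h g x (W a x) (W b x))) := by
  have hW := fun c => (hF.isTopSection hx c).mdiff
  have hh := fun a b => (hA.isDiffTensorAt_h x).mdiff (hW a) (hW b)
  have hsm : ∀ a b, MDiffAt (T% (fun y => S y (W a y) (W b y) • A.h g y (W a y) (W b y))) x :=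
    fun a b => (hd a b).smul_section (hh a b)
  rw [g.div_congr (Y := fun y => ∑ a, ∑ b, S y (W a y) (W b y) • A.h g y (W a y) (W b y))
    (.sum_section fun a _ => .sum_section fun b _ => hsm a b), g.div_sum _ fun a _ =>
      .sum_section fun b _ => hsm a b]
  · refine Finset.sum_congr rfl fun a _ => ?_
    rw [g.div_sum _ fun b _ => hsm a b]
    exact Finset.sum_congr rfl fun b _ => g.div_smul (hd a b) (hh a b)
  · filter_upwards [hF.isOpen.mem_nhds hx] with y hy
    exact hA.sum_smul_eq (hF.basis_top y hy) (g.isOrthonormalBasis_orthonormalFrame ⊤) (hS y)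
      (fun u hu v => h0 y u hu v) (hA.isBilinearMap_h y)

end Frame

theorem IsAdapted.pairing_eq (hA : A.IsAdapted g) {ι : Type*} [Fintype ι] [DecidableEq ι]
    {w : ι → TangentSpace 𝓘(ℝ, E) x} (hw : g.IsOrthonormalBasis (A.dtop x) w)
    {B S : Tensor02 E M} (hB : IsBilinearMap ℝ (B x)) (hS : IsBilinearMap ℝ (S x))
    (h0 : A.swap.IsPerpTruncated S) :
    g.pairing B S x = ∑ a, ∑ b, S x (w a) (w b) * B x (w a) (w b) := by
  have h := hA.sum_smul_eq hw (g.isOrthonormalBasis_orthonormalFrame ⊤) hS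
    (fun u hu v => h0 x u hu v) hB
  simp only [smul_eq_mul] at h
  rw [← h, RiemMetric.pairing]
  simp only [mul_comm]

theorem IsAdapted.trace_eq (hA : A.IsAdapted g) {ι : Type*} [Fintype ι] [DecidableEq ι]
    {w : ι → TangentSpace 𝓘(ℝ, E) x} (hw : g.IsOrthonormalBasis (A.dtop x) w)
    {S : Tensor02 E M} (hS : IsBilinearMap ℝ (S x))
    (h0 : A.swap.IsPerpTruncated S) : g.trace S x = ∑ a, S x (w a) (w a) :=
  hA.sum_diag_top hw (g.isOrthonormalBasis_orthonormalFrame ⊤) hS fun u hu => (h0 x u hu u).1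

theorem IsAdapted.isBilinearMap_KFlat (hA : A.IsAdapted g) (x : M) :
    IsBilinearMap ℝ (A.KFlat g x) := by
  have h1 := fun ξ => g.isLinearMap_dualOp (hA.isBilinearMap_T x) ξ
  have h2 := fun ξ => g.isLinearMap_dualOp (hA.isBilinearMap_h x) ξ
  refine ⟨fun u u' v => ?_, fun r u v => ?_, fun u v v' => ?_, fun r u v => ?_⟩
  · simp only [KFlat, Tsharp, weingarten, (h1 _).map_add, (h2 _).map_add, add_sub_add_comm,
      Finset.sum_add_distrib, map_add, add_apply]
  · simp only [KFlat, Tsharp, weingarten, (h1 _).map_smul, (h2 _).map_smul, ← smul_sub,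
      ← Finset.smul_sum, map_smul, smul_apply]
  · simp only [KFlat, map_add]
  · simp only [KFlat, map_smul]

theorem IsAdapted.isBilinearMap_casoratiTFlat (hA : A.IsAdapted g) (x : M) :
    IsBilinearMap ℝ (A.casoratiTFlat g x) := by
  have h1 := fun ξ => g.isLinearMap_dualOp (hA.isBilinearMap_T x) ξ
  refine ⟨fun u u' v => ?_, fun r u v => ?_, fun u v v' => ?_, fun r u v => ?_⟩
  · simp only [casoratiTFlat, Tsharp, (h1 _).map_add, Finset.sum_add_distrib, map_add, add_apply]
  · simp only [casoratiTFlat, Tsharp, (h1 _).map_smul, ← Finset.smul_sum, map_smul, smul_apply]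
  · simp only [casoratiTFlat, map_add]
  · simp only [casoratiTFlat, map_smul]

end AlmostProduct

/-! ### Variations along one of the distributions -/

theorem Finset.sum_sum_sum_sum_comm {ι κ : Type*} [Fintype ι] [Fintype κ]
    (f : ι → ι → κ → κ → ℝ) :
    ∑ c, ∑ d, ∑ a, ∑ b, f c d a b = ∑ a, ∑ b, ∑ c, ∑ d, f c d a b :=
  calc _ = ∑ c, ∑ a, ∑ b, ∑ d, f c d a b :=
        Finset.sum_congr rfl fun _ _ =>
          Finset.sum_comm.trans (Finset.sum_congr rfl fun _ _ => Finset.sum_comm)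
    _ = _ := Finset.sum_comm.trans (Finset.sum_congr rfl fun _ _ => Finset.sum_comm)

/-- The sum `∑_{a,b} β(P(e_a, e_b), P(e_a, e_b))` does not depend on the orthonormal basis. -/
theorem RiemMetric.IsOrthonormalBasis.sum_sum_apply_eq {g : RiemMetric E M} {x : M} {ι κ : Type*}
    [Fintype ι] [DecidableEq ι] [Fintype κ] [DecidableEq κ]
    {F : Submodule ℝ (TangentSpace 𝓘(ℝ, E) x)} {w : ι → TangentSpace 𝓘(ℝ, E) x}
    {e : κ → TangentSpace 𝓘(ℝ, E) x} (hw : g.IsOrthonormalBasis F w)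
    (he : g.IsOrthonormalBasis F e)
    {β : TangentSpace 𝓘(ℝ, E) x → TangentSpace 𝓘(ℝ, E) x → ℝ} (hβ : IsBilinearMap ℝ β)
    {P : TangentSpace 𝓘(ℝ, E) x → TangentSpace 𝓘(ℝ, E) x → TangentSpace 𝓘(ℝ, E) x}
    (hP : IsBilinearMap ℝ P) :
    ∑ c, ∑ d, β (P (e c) (e d)) (P (e c) (e d)) =
      ∑ a, ∑ b, β (P (w a) (w b)) (P (w a) (w b)) := by
  have h := hw.sum_diag₂ he (γ := fun u v u' v' => β (P u v) (P u' v'))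
    (fun v v' => ⟨by simp [hP.add_left, hβ.add_left], by simp [hP.smul_left, hβ.smul_left],
      by simp [hP.add_left, hβ.add_right], by simp [hP.smul_left, hβ.smul_right]⟩)
    (fun u u' => ⟨by simp [hP.add_right, hβ.add_left], by simp [hP.smul_right, hβ.smul_left],
      by simp [hP.add_right, hβ.add_right], by simp [hP.smul_right, hβ.smul_right]⟩)
  simpa [hw.transitionSq_self he, Matrix.one_apply, ite_and, Finset.sum_ite_irrel] using h

theorem RiemMetric.pairing_mul_inner (g : RiemMetric E M) (f : M → ℝ) (S : Tensor02 E M) (x : M) :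
    g.pairing (fun y u v => f y * g.inner y u v) S x = g.trace S x * f x := by
  simp [pairing, trace, orthonormalFrame_inner, Finset.mul_sum, mul_comm]

theorem mdifferentiableAt_fun_sum {ι : Type*} (s : Finset ι) {f : ι → M → ℝ} {x : M}
    (hf : ∀ i ∈ s, MDiffAt (f i) x) : MDiffAt (fun y => ∑ i ∈ s, f i y) x := by
  classical
  induction s using Finset.induction_on with
  | empty => simpa using mdifferentiableAt_const
  | insert a s ha ih =>
    simp only [Finset.sum_insert ha]
    exact (hf a (Finset.mem_insert_self a s)).add
      (ih fun i hi => hf i (Finset.mem_insert_of_mem hi))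

theorem mvfderiv_fun_sum {ι : Type*} (s : Finset ι) {f : ι → M → ℝ} {x : M}
    (hf : ∀ i ∈ s, MDiffAt (f i) x) :
    mvfderiv 𝓘(ℝ, E) (fun y => ∑ i ∈ s, f i y) x = ∑ i ∈ s, mvfderiv 𝓘(ℝ, E) (f i) x := by
  classical
  induction s using Finset.induction_on with
  | empty => simp [mvfderiv_const]
  | insert a s ha ih =>
    have hs := fun i hi => hf i (Finset.mem_insert_of_mem hi)
    simp only [Finset.sum_insert ha]
    rw [mvfderiv_fun_add (hf a (Finset.mem_insert_self a s)) (mdifferentiableAt_fun_sum s hs),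
      ih hs]

/-- `⟨u^♭ ⊗ u^♭, S⟩ = S(u, u)`. -/
theorem RiemMetric.sum_inner_mul_apply (g : RiemMetric E M) {x : M}
    {β : TangentSpace 𝓘(ℝ, E) x → TangentSpace 𝓘(ℝ, E) x → ℝ} (hβ : IsBilinearMap ℝ β)
    (u : TangentSpace 𝓘(ℝ, E) x) :
    ∑ c, ∑ d, g.inner x u (g.orthonormalFrame ⊤ c) * g.inner x u (g.orthonormalFrame ⊤ d) *
      β (g.orthonormalFrame ⊤ c) (g.orthonormalFrame ⊤ d) = β u u := by
  rw [(g.isOrthonormalBasis_orthonormalFrame ⊤).bilin_apply hβ (Submodule.mem_top (x := u))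
    (Submodule.mem_top (x := u))]
  simp only [g.inner_comm x u, smul_eq_mul]

namespace AlmostProduct

variable {n p : ℕ} {A : AlmostProduct E M n p}

/-- The identity `sum_connection_identity` summed over the normal directions `i`, with the terms that
contain derivatives added: `D` holds the derivatives of the components of `S`, and `d` the
divergences of the fields `h(W_a, W_b)`. -/
theorem sum_connection_identity_sum {ι κ : Type*} [Fintype ι] [Fintype κ] {φ θ Γ : κ → ι → ι → ℝ}
    {S : ι → ι → ℝ} (hφ : ∀ i a b, φ i b a = φ i a b) (hθ : ∀ i a b, θ i b a = -θ i a b)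
    (hΓ : ∀ i a b, Γ i b a = -Γ i a b) (hS : ∀ a b, S b a = S a b)
    {D : κ → ι → ι → ℝ} {d : ι → ι → ℝ} :
    ∑ a, ∑ b, -(∑ i, φ i a b * (D i a b - (∑ c, (Γ i a c + φ i a c + θ i a c) * S c b
          + ∑ c, (Γ i b c + φ i b c + θ i b c) * S a c)))
        - 2 * ∑ a, ∑ c, ∑ b, S a c * ∑ i, φ i a b * φ i c b =
      ∑ a, ∑ b, S a b * (d a b
          + ∑ i, (-(∑ c, Γ i a c * φ i c b) - ∑ c, Γ i b c * φ i a c)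
          + ∑ i, ∑ c, (φ i a c * θ i c b - θ i a c * φ i c b))
        - ∑ a, ∑ b, (S a b * d a b + ∑ i, φ i a b * D i a b) := by
  have e1 : ∀ f : ι → ι → κ → ℝ, ∑ a, ∑ b, ∑ i, f a b i = ∑ i, ∑ a, ∑ b, f a b i :=
    fun f => (Finset.sum_congr rfl fun a _ => Finset.sum_comm).trans Finset.sum_comm
  have e2 : ∀ f : ι → ι → ι → κ → ℝ,
      ∑ a, ∑ b, ∑ c, ∑ i, f a b c i = ∑ i, ∑ a, ∑ b, ∑ c, f a b c i :=
    fun f => (Finset.sum_congr rfl fun a _ => e1 (f a)).trans Finset.sum_comm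
  have key := Finset.sum_congr (rfl : (Finset.univ : Finset κ) = _) fun i _ =>
    sum_connection_identity (hφ i) (hθ i) (hΓ i) hS
  rw [Finset.sum_sub_distrib, ← Finset.mul_sum, ← e1, ← e2, ← e1] at key
  have h1 : ∑ a, ∑ b, -(∑ i, φ i a b * (D i a b - (∑ c, (Γ i a c + φ i a c + θ i a c) * S c b
          + ∑ c, (Γ i b c + φ i b c + θ i b c) * S a c))) =
      ∑ a, ∑ b, ∑ i, φ i a b * (∑ c, (Γ i a c + φ i a c + θ i a c) * S c b
          + ∑ c, (Γ i b c + φ i b c + θ i b c) * S a c) - ∑ a, ∑ b, ∑ i, φ i a b * D i a b := by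
    simp only [← Finset.sum_sub_distrib, ← Finset.sum_neg_distrib]
    exact Finset.sum_congr rfl fun a _ => Finset.sum_congr rfl fun b _ =>
      Finset.sum_congr rfl fun i _ => by ring
  have h2 : ∑ a, ∑ b, S a b * (d a b
          + ∑ i, (-(∑ c, Γ i a c * φ i c b) - ∑ c, Γ i b c * φ i a c)
          + ∑ i, ∑ c, (φ i a c * θ i c b - θ i a c * φ i c b)) =
      ∑ a, ∑ b, S a b * d a b + ∑ a, ∑ b, ∑ i, S a b * (-(∑ c, Γ i a c * φ i c b)
        - (∑ c, Γ i b c * φ i a c) + ∑ c, (φ i a c * θ i c b - θ i a c * φ i c b)) := by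
    simp only [← Finset.sum_add_distrib, ← Finset.mul_sum]
    refine Finset.sum_congr rfl fun a _ => Finset.sum_congr rfl fun b _ => ?_
    rw [Finset.sum_add_distrib]
    ring
  rw [h1, h2]
  simp only [Finset.mul_sum (s := (Finset.univ : Finset κ)), Finset.sum_add_distrib] at key ⊢
  linarith

theorem sum_mul_eq_zero_of_antisymm {ι : Type*} [Fintype ι] {θ S : ι → ι → ℝ}
    (hθ : ∀ a b, θ b a = -θ a b) (hS : ∀ a b, S b a = S a b) : ∑ a, ∑ c, θ a c * S c a = 0 := by
  have h : ∑ a, ∑ c, θ a c * S c a = -∑ a, ∑ c, θ a c * S c a := by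
    conv_lhs => rw [Finset.sum_comm]
    simp only [← Finset.sum_neg_distrib]
    exact Finset.sum_congr rfl fun a _ => Finset.sum_congr rfl fun c _ => by
      rw [hθ a c, hS a c, neg_mul]
  linarith

theorem pairing_Phih (A : AlmostProduct E M n p) (g : RiemMetric E M) {S : Tensor02 E M} {x : M}
    (hS : IsBilinearMap ℝ (S x)) : g.pairing (A.Phih g) S x = S x (A.H g x) (A.H g x)
      - ∑ a, ∑ b,
        S x (A.h g x (g.orthonormalFrame (A.dtop x) a) (g.orthonormalFrame (A.dtop x) b))
          (A.h g x (g.orthonormalFrame (A.dtop x) a) (g.orthonormalFrame (A.dtop x) b)) := by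
  simp only [RiemMetric.pairing, Phih, ← g.sum_inner_mul_apply hS, sub_mul, Finset.sum_mul,
    Finset.sum_sub_distrib]
  congr 1
  exact Finset.sum_sum_sum_sum_comm _

theorem pairing_PhiT (A : AlmostProduct E M n p) (g : RiemMetric E M) {S : Tensor02 E M} {x : M}
    (hS : IsBilinearMap ℝ (S x)) : g.pairing (A.PhiT g) S x =
      -∑ a, ∑ b,
        S x (A.T x (g.orthonormalFrame (A.dtop x) a) (g.orthonormalFrame (A.dtop x) b))
          (A.T x (g.orthonormalFrame (A.dtop x) a) (g.orthonormalFrame (A.dtop x) b)) := by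
  simp only [RiemMetric.pairing, PhiT, ← g.sum_inner_mul_apply hS, neg_mul, Finset.sum_mul,
    Finset.sum_neg_distrib]
  congr 1
  exact Finset.sum_sum_sum_sum_comm _

theorem H_mem (A : AlmostProduct E M n p) (g : RiemMetric E M) (x : M) : A.H g x ∈ A.dperp x :=
  Submodule.sum_mem _ fun _ _ => A.h_mem _ _ _

theorem IsAdapted.isBilinearMap_two_mul_casoratiTFlat {g : RiemMetric E M} (hA : A.IsAdapted g)
    (x : M) : IsBilinearMap ℝ fun u v => 2 * A.casoratiTFlat g x u v := by
  have hc := hA.isBilinearMap_casoratiTFlat x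
  exact ⟨by simp [hc.add_left, mul_add], by simp [hc.smul_left, mul_left_comm],
    by simp [hc.add_right, mul_add], by simp [hc.smul_right, mul_left_comm]⟩

theorem IsAdapted.isBilinearMap_divTensor_add_KFlat {g : RiemMetric E M} (hA : A.IsAdapted g)
    (x : M) : IsBilinearMap ℝ ((g.divTensor (A.h g) + A.KFlat g) x) := by
  have h1 := (hA.isDiffTensorAt_h x).isBilinearMap_divTensor (g := g)
  have h2 := hA.isBilinearMap_KFlat x
  refine ⟨fun u u' v => ?_, fun r u v => ?_, fun u v v' => ?_, fun r u v => ?_⟩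
  · simp only [Pi.add_apply, h1.add_left, h2.add_left, add_add_add_comm]
  · simp only [Pi.add_apply, h1.smul_left, h2.smul_left, smul_add]
  · simp only [Pi.add_apply, h1.add_right, h2.add_right, add_add_add_comm]
  · simp only [Pi.add_apply, h1.smul_right, h2.smul_right, smul_add]

namespace IsAdaptedVariation

variable {ε t : ℝ} {g : ℝ → RiemMetric E M}

/-- If `S` vanishes on `𝒟̃`, then so does its Lie derivative along sections of `𝒟`, evaluated on `𝒟̃`. -/
theorem lieDeriv_eq_zero (h0 : A.IsPerpTruncated (dtMetric g t)) {U : Set M}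
    {W : Fin n → VecField E M} {Z : Fin p → VecField E M}
    (hF : A.IsAdaptedFrame (g t) U W Z) {x : M} (hx : x ∈ U) (i : Fin p) (a b : Fin n) :
    lieDeriv (dtMetric g t) (Z i) (W a) (W b) x = 0 := by
  have h1 : (fun y => dtMetric g t y (W a y) (W b y)) =ᶠ[𝓝 x] fun _ => 0 := by
    filter_upwards [hF.isOpen.mem_nhds hx] with y hy using (h0 y _ ((hF.basis_top y hy).mem a) _).1
  rw [lieDeriv, h1.mvfderiv_eq, mvfderiv_const, (h0 x _ ((hF.basis_top x hx).mem a) _).1,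
    (h0 x _ ((hF.basis_top x hx).mem b) _).2]
  simp

theorem hasDerivAt_normSqh_of_isPerpTruncated (hg : A.IsAdaptedVariation ε g) (ht : |t| < ε)
    (h0 : A.IsPerpTruncated (dtMetric g t)) (x : M) :
    HasDerivAt (fun τ => A.normSqh (g τ) x)
      (-∑ a, ∑ b, dtMetric g t x
        (A.h (g t) x ((g t).orthonormalFrame (A.dtop x) a) ((g t).orthonormalFrame (A.dtop x) b))
        (A.h (g t) x ((g t).orthonormalFrame (A.dtop x) a)
          ((g t).orthonormalFrame (A.dtop x) b))) t := by
  obtain ⟨U, hx, W, Z, hF⟩ := A.exists_isAdaptedFrame (g t) x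
  refine (hg.hasDerivAt_normSqh ht hF hx).congr_deriv ?_
  rw [(hF.basis_top x hx).sum_sum_apply_eq ((g t).isOrthonormalBasis_orthonormalFrame _)
    (hg.isBilinearMap_dtMetric ht x) ((hg.adapted t ht).isBilinearMap_h x)]
  simp [lieDeriv_eq_zero h0 hF hx, (h0 x _ ((hF.basis_top x hx).mem _) _).1]

theorem hasDerivAt_normSqT_of_isPerpTruncated (hg : A.IsAdaptedVariation ε g) (ht : |t| < ε)
    (h0 : A.IsPerpTruncated (dtMetric g t)) (x : M) :
    HasDerivAt (fun τ => A.normSqT (g τ) x)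
      (∑ a, ∑ b, dtMetric g t x
        (A.T x ((g t).orthonormalFrame (A.dtop x) a) ((g t).orthonormalFrame (A.dtop x) b))
        (A.T x ((g t).orthonormalFrame (A.dtop x) a) ((g t).orthonormalFrame (A.dtop x) b))) t := by
  obtain ⟨U, hx, W, Z, hF⟩ := A.exists_isAdaptedFrame (g t) x
  refine (hg.hasDerivAt_normSqT ht hF hx).congr_deriv ?_
  rw [(hF.basis_top x hx).sum_sum_apply_eq ((g t).isOrthonormalBasis_orthonormalFrame _)
    (hg.isBilinearMap_dtMetric ht x) ((hg.adapted t ht).isBilinearMap_T x)]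
  simp [(h0 x _ ((hF.basis_top x hx).mem _) _).1]

theorem hasDerivAt_normSqH_of_isPerpTruncated (hg : A.IsAdaptedVariation ε g) (ht : |t| < ε)
    (h0 : A.IsPerpTruncated (dtMetric g t)) (x : M) :
    HasDerivAt (fun τ => A.normSqH (g τ) x) (-dtMetric g t x (A.H (g t) x) (A.H (g t) x)) t := by
  obtain ⟨U, hx, W, Z, hF⟩ := A.exists_isAdaptedFrame (g t) x
  refine (hg.hasDerivAt_normSqH ht hF hx).congr_deriv ?_
  simp [lieDeriv_eq_zero h0 hF hx, (h0 x _ ((hF.basis_top x hx).mem _) _).1]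

/-- The variation of `‖h‖²` when `S` vanishes on `𝒟`. -/
theorem hasDerivAt_normSqh_of_swap_isPerpTruncated (hg : A.IsAdaptedVariation ε g) (ht : |t| < ε)
    (h0 : A.swap.IsPerpTruncated (dtMetric g t)) (x : M) :
    HasDerivAt (fun τ => A.normSqh (g τ) x)
      ((g t).pairing ((g t).divTensor (A.h (g t)) + A.KFlat (g t)) (dtMetric g t) x
        - (g t).div ((g t).contract (A.h (g t)) (dtMetric g t)) x) t := by
  obtain ⟨U, hx, W, Z, hF⟩ := A.exists_isAdaptedFrame (g t) x
  have hA := hg.adapted t ht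
  have hw := hF.basis_top x hx
  have hz := hF.basis_perp x hx
  have hS := hg.isBilinearMap_dtMetric ht
  have hd := fun a b =>
    hg.mdifferentiableAt_dtMetric ht (hF.smooth_top x hx a) (hF.smooth_top x hx b)
  have hB := hA.isBilinearMap_divTensor_add_KFlat x
  have hperp : ∀ u v, dtMetric g t x (A.h (g t) x u v) (A.h (g t) x u v) = 0 := fun u v =>
    (h0 x _ (A.h_mem (g t) u v) _).1
  refine (hg.hasDerivAt_normSqh ht hF hx).congr_deriv ?_
  rw [hA.pairing_eq hw hB (hS x) h0, hF.div_contract hA hx hS h0 hd]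
  -- Expand everything in the components of `h` and `T` along the normal frame `Z`.
  have hgh : ∀ a b c, (g t).inner x (A.h (g t) x (W a x) (W b x)) (A.h (g t) x (W c x) (W b x)) =
      ∑ i, (g t).inner x (A.h (g t) x (W a x) (W b x)) (Z i x) *
        (g t).inner x (A.h (g t) x (W c x) (W b x)) (Z i x) := fun a b c => by
    conv_lhs => rw [← hz.sum_repr _ (A.h_mem (g t) (W c x) (W b x))]
    simp only [map_sum, map_smul, smul_eq_mul]
    exact Finset.sum_congr rfl fun i _ => by rw [(g t).inner_comm x (Z i x), mul_comm]
  have hdS : ∀ a b, mvfderiv 𝓘(ℝ, E) (fun y => dtMetric g t y (W a y) (W b y)) x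
      (A.h (g t) x (W a x) (W b x)) = ∑ i, (g t).inner x (A.h (g t) x (W a x) (W b x)) (Z i x) *
        mvfderiv 𝓘(ℝ, E) (fun y => dtMetric g t y (W a y) (W b y)) x (Z i x) := fun a b => by
    conv_lhs => rw [← hz.sum_repr _ (A.h_mem (g t) (W a x) (W b x))]
    simp only [map_sum, map_smul, smul_eq_mul, (g t).inner_comm x (Z _ x)]
  simp only [Pi.add_apply, hF.divTensor_h hA hx, hA.KFlat_apply hw hz, hF.lieDeriv_eq hA hx (hS x) h0,
    hF.inner_mlieBracket hA hx, hgh, hdS, hperp, sub_zero]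
  exact sum_connection_identity_sum (κ := Fin p)
    (φ := fun i a b => (g t).inner x (A.h (g t) x (W a x) (W b x)) (Z i x))
    (θ := fun i a b => (g t).inner x (A.T x (W a x) (W b x)) (Z i x))
    (Γ := fun i a b => (g t).inner x ((g t).leviCivita (W a) x (Z i x)) (W b x))
    (S := fun a b => dtMetric g t x (W a x) (W b x))
    (D := fun i a b => mvfderiv 𝓘(ℝ, E) (fun y => dtMetric g t y (W a y) (W b y)) x (Z i x))
    (d := fun a b => (g t).div (fun y => A.h (g t) y (W a y) (W b y)) x)
    (fun i a b => by rw [A.h_comm]) (fun i a b => by rw [hA.T_swap]; simp)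
    (fun i a b => hF.inner_leviCivita_swap hx _ a b) (fun a b => dtMetric_comm _ _)

/-- The variation of `‖H‖²` when `S` vanishes on `𝒟`. -/
theorem hasDerivAt_normSqH_of_swap_isPerpTruncated (hg : A.IsAdaptedVariation ε g) (ht : |t| < ε)
    (h0 : A.swap.IsPerpTruncated (dtMetric g t)) (x : M) :
    HasDerivAt (fun τ => A.normSqH (g τ) x)
      ((g t).pairing (fun y u v => (g t).div (A.H (g t)) y * (g t).inner y u v) (dtMetric g t) x
        - (g t).div (fun y => (g t).trace (dtMetric g t) y • A.H (g t) y) x) t := by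
  obtain ⟨U, hx, W, Z, hF⟩ := A.exists_isAdaptedFrame (g t) x
  have hA := hg.adapted t ht
  have hw := hF.basis_top x hx
  have hz := hF.basis_perp x hx
  have hS := hg.isBilinearMap_dtMetric ht
  have hH := hA.mdifferentiableAt_H x
  have hd := fun a b =>
    hg.mdifferentiableAt_dtMetric ht (hF.smooth_top x hx a) (hF.smooth_top x hx b)
  have hpair : (g t).pairing (fun y u v => (g t).div (A.H (g t)) y * (g t).inner y u v)
      (dtMetric g t) x = (g t).trace (dtMetric g t) x * (g t).div (A.H (g t)) x :=
    (g t).pairing_mul_inner _ _ x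
  have htr : ∀ y ∈ U, (g t).trace (dtMetric g t) y = ∑ a, dtMetric g t y (W a y) (W a y) :=
    fun y hy => hA.trace_eq (hF.basis_top y hy) (hS y) h0
  have hdtr : MDiffAt (fun y => ∑ a, dtMetric g t y (W a y) (W a y)) x :=
    mdifferentiableAt_fun_sum _ fun a _ => hd a a
  have hdiv : (g t).div (fun y => (g t).trace (dtMetric g t) y • A.H (g t) y) x =
      (g t).trace (dtMetric g t) x * (g t).div (A.H (g t)) x +
      ∑ a, mvfderiv 𝓘(ℝ, E) (fun y => dtMetric g t y (W a y) (W a y)) x (A.H (g t) x) := by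
    rw [htr x hx, (g t).div_congr (Y := fun y => (∑ a, dtMetric g t y (W a y) (W a y)) • A.H (g t) y)
      (hdtr.smul_section hH) ?_, (g t).div_smul hdtr hH, mvfderiv_fun_sum _ fun a _ => hd a a]
    · simp
    · filter_upwards [hF.isOpen.mem_nhds hx] with y hy
      rw [htr y hy]
  refine (hg.hasDerivAt_normSqH ht hF hx).congr_deriv ?_
  have hH0 : dtMetric g t x (A.H (g t) x) (A.H (g t) x) = 0 := (h0 x _ (A.H_mem (g t) x) _).1
  rw [hpair, hdiv, hH0]
  have hgh : ∀ a b, (g t).inner x (A.h (g t) x (W a x) (W b x)) (A.H (g t) x) =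
      ∑ i, (g t).inner x (A.H (g t) x) (Z i x) *
        (g t).inner x (A.h (g t) x (W a x) (W b x)) (Z i x) := fun a b => by
    conv_lhs => rw [← hz.sum_repr _ (A.H_mem (g t) x)]
    simp only [map_sum, map_smul, smul_eq_mul]
    exact Finset.sum_congr rfl fun i _ => by rw [(g t).inner_comm x (Z i x)]
  have hdS : ∀ a, mvfderiv 𝓘(ℝ, E) (fun y => dtMetric g t y (W a y) (W a y)) x (A.H (g t) x) =
      ∑ i, (g t).inner x (A.H (g t) x) (Z i x) *
        mvfderiv 𝓘(ℝ, E) (fun y => dtMetric g t y (W a y) (W a y)) x (Z i x) := fun a => by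
    conv_lhs => rw [← hz.sum_repr _ (A.H_mem (g t) x)]
    simp only [map_sum, map_smul, smul_eq_mul, (g t).inner_comm x (Z _ x)]
  -- In the trace of the Lie derivative the skew-symmetric parts of the connection cancel.
  have hL : ∀ i, ∑ a, lieDeriv (dtMetric g t) (Z i) (W a) (W a) x =
      ∑ a, mvfderiv 𝓘(ℝ, E) (fun y => dtMetric g t y (W a y) (W a y)) x (Z i x)
        - 2 * ∑ a, ∑ c, dtMetric g t x (W a x) (W c x) *
            (g t).inner x (A.h (g t) x (W a x) (W c x)) (Z i x) := fun i => by
    have hΓ := sum_mul_eq_zero_of_antisymm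
      (θ := fun a c => (g t).inner x ((g t).leviCivita (W a) x (Z i x)) (W c x))
      (S := fun a c => dtMetric g t x (W a x) (W c x))
      (fun a b => hF.inner_leviCivita_swap hx _ a b) (fun a b => dtMetric_comm _ _)
    have hθ := sum_mul_eq_zero_of_antisymm
      (θ := fun a c => (g t).inner x (A.T x (W a x) (W c x)) (Z i x))
      (S := fun a c => dtMetric g t x (W a x) (W c x))
      (fun a b => by rw [hA.T_swap]; simp) (fun a b => dtMetric_comm _ _)
    have h1 : ∀ a, lieDeriv (dtMetric g t) (Z i) (W a) (W a) x =
        mvfderiv 𝓘(ℝ, E) (fun y => dtMetric g t y (W a y) (W a y)) x (Z i x)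
          - 2 * (∑ c, (g t).inner x ((g t).leviCivita (W a) x (Z i x)) (W c x) *
              dtMetric g t x (W c x) (W a x)
            + ∑ c, dtMetric g t x (W a x) (W c x) *
                (g t).inner x (A.h (g t) x (W a x) (W c x)) (Z i x)
            + ∑ c, (g t).inner x (A.T x (W a x) (W c x)) (Z i x) *
                dtMetric g t x (W c x) (W a x)) := fun a => by
      rw [hF.lieDeriv_eq hA hx (hS x) h0]
      simp only [hF.inner_mlieBracket hA hx, ← Finset.sum_add_distrib, Finset.mul_sum]
      congr 1
      refine Finset.sum_congr rfl fun c _ => ?_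
      rw [dtMetric_comm (W a x) (W c x)]
      ring
    simp only [h1, Finset.sum_sub_distrib, ← Finset.mul_sum, Finset.sum_add_distrib, hΓ, hθ,
      zero_add, add_zero]
  have e1 : ∑ a, ∑ b, dtMetric g t x (W a x) (W b x) * ∑ i, (g t).inner x (A.H (g t) x) (Z i x) *
        (g t).inner x (A.h (g t) x (W a x) (W b x)) (Z i x) =
      ∑ i, (g t).inner x (A.H (g t) x) (Z i x) * ∑ a, ∑ b, dtMetric g t x (W a x) (W b x) *
        (g t).inner x (A.h (g t) x (W a x) (W b x)) (Z i x) := by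
    simp only [Finset.mul_sum, mul_left_comm (dtMetric g t x _ _)]
    exact (Finset.sum_congr rfl fun a _ => Finset.sum_comm).trans Finset.sum_comm
  simp only [hL, hgh, hdS, e1]
  rw [Finset.sum_comm]
  simp only [mul_sub, Finset.sum_sub_distrib, ← Finset.mul_sum, mul_left_comm _ (2 : ℝ)]
  ring

/-- The variation of `‖T‖²` when `S` vanishes on `𝒟`. -/
theorem hasDerivAt_normSqT_of_swap_isPerpTruncated (hg : A.IsAdaptedVariation ε g) (ht : |t| < ε)
    (h0 : A.swap.IsPerpTruncated (dtMetric g t)) (x : M) :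
    HasDerivAt (fun τ => A.normSqT (g τ) x)
      ((g t).pairing (fun y u v => 2 * A.casoratiTFlat (g t) y u v) (dtMetric g t) x) t := by
  obtain ⟨U, hx, W, Z, hF⟩ := A.exists_isAdaptedFrame (g t) x
  have hA := hg.adapted t ht
  have hw := hF.basis_top x hx
  have hB := hA.isBilinearMap_two_mul_casoratiTFlat x
  have hperp : ∀ u v, dtMetric g t x (A.T x u v) (A.T x u v) = 0 := fun u v =>
    (h0 x _ (A.T_mem u v) _).1
  refine (hg.hasDerivAt_normSqT ht hF hx).congr_deriv ?_
  rw [hA.pairing_eq hw hB (hg.isBilinearMap_dtMetric ht x) h0]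
  simp only [hperp, hA.casoratiTFlat_apply hw, Finset.sum_const_zero, zero_sub, Finset.mul_sum,
    mul_neg, Finset.sum_neg_distrib, mul_left_comm (2 : ℝ)]

end IsAdaptedVariation

/-! ### Conformal variations -/

theorem isPerpTruncated_metricPerp (A : AlmostProduct E M n p) (g : RiemMetric E M) (s : M → ℝ) :
    A.IsPerpTruncated fun x u v => s x * A.metricPerp g x u v := fun x u hu v => by
  have h : A.projPerp x u = 0 := projTop_of_mem_dperp (A := A.swap) hu
  simp [metricPerp, h]

theorem metricPerp_of_mem {g : RiemMetric E M} {x : M} {u v : TangentSpace 𝓘(ℝ, E) x}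
    (hu : u ∈ A.dperp x) (hv : v ∈ A.dperp x) : A.metricPerp g x u v = g.inner x u v := by
  rw [metricPerp, projPerp_of_mem hu, projPerp_of_mem hv]

/-- The rank `n` of `𝒟̃` is the dimension of its fibres; it enters through `Tr_g S = n s`. -/
theorem finrank_dtop (A : AlmostProduct E M n p) (x : M) : finrank ℝ (A.dtop x) = n := by
  obtain ⟨U, hU, X, -, h⟩ := A.smooth_top x
  obtain ⟨hli, hs⟩ := h x (mem_of_mem_nhds hU)
  rw [← hs, finrank_span_eq_card hli, Fintype.card_fin]

namespace IsAdaptedVariation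

variable {ε t : ℝ} {g : ℝ → RiemMetric E M}

section

variable {s : M → ℝ}

theorem hasDerivAt_normSqh_of_metricPerp (hg : A.IsAdaptedVariation ε g) (ht : |t| < ε)
    (hS : dtMetric g t = fun x u v => s x * A.metricPerp (g t) x u v) (x : M) :
    HasDerivAt (fun τ => A.normSqh (g τ) x) (-s x * A.normSqh (g t) x) t := by
  have h0 : A.IsPerpTruncated (dtMetric g t) := hS ▸ A.isPerpTruncated_metricPerp (g t) s
  refine (hg.hasDerivAt_normSqh_of_isPerpTruncated ht h0 x).congr_deriv ?_
  simp only [hS, metricPerp_of_mem (A.h_mem _ _ _) (A.h_mem _ _ _), ← Finset.mul_sum, neg_mul]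
  rfl

theorem hasDerivAt_normSqH_of_metricPerp (hg : A.IsAdaptedVariation ε g) (ht : |t| < ε)
    (hS : dtMetric g t = fun x u v => s x * A.metricPerp (g t) x u v) (x : M) :
    HasDerivAt (fun τ => A.normSqH (g τ) x) (-s x * A.normSqH (g t) x) t := by
  have h0 : A.IsPerpTruncated (dtMetric g t) := hS ▸ A.isPerpTruncated_metricPerp (g t) s
  refine (hg.hasDerivAt_normSqH_of_isPerpTruncated ht h0 x).congr_deriv ?_
  simp only [hS, metricPerp_of_mem (A.H_mem _ _) (A.H_mem _ _), neg_mul]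
  rfl

theorem hasDerivAt_normSqT_of_metricPerp (hg : A.IsAdaptedVariation ε g) (ht : |t| < ε)
    (hS : dtMetric g t = fun x u v => s x * A.metricPerp (g t) x u v) (x : M) :
    HasDerivAt (fun τ => A.normSqT (g τ) x) (s x * A.normSqT (g t) x) t := by
  have h0 : A.IsPerpTruncated (dtMetric g t) := hS ▸ A.isPerpTruncated_metricPerp (g t) s
  refine (hg.hasDerivAt_normSqT_of_isPerpTruncated ht h0 x).congr_deriv ?_
  simp only [hS, metricPerp_of_mem (A.T_mem _ _) (A.T_mem _ _), ← Finset.mul_sum]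
  rfl

/-- In a conformal variation along `𝒟̃`, `S(w_a, w_b) = s δ_ab`. -/
theorem apply_of_swap_metricPerp
    (hS : dtMetric g t = fun x u v => s x * A.swap.metricPerp (g t) x u v)
    {x : M} {ι : Type*} [Fintype ι] [DecidableEq ι] {w : ι → TangentSpace 𝓘(ℝ, E) x}
    (hw : (g t).IsOrthonormalBasis (A.dtop x) w) (a b : ι) :
    dtMetric g t x (w a) (w b) = if a = b then s x else 0 := by
  simp [hS, metricPerp_of_mem (A := A.swap) (hw.mem a) (hw.mem b), hw.inner]

theorem hasDerivAt_normSqh_of_swap_metricPerp (hg : A.IsAdaptedVariation ε g) (ht : |t| < ε)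
    (hS : dtMetric g t = fun x u v => s x * A.swap.metricPerp (g t) x u v) (x : M) :
    HasDerivAt (fun τ => A.normSqh (g τ) x)
      (s x * (g t).div (A.H (g t)) x - (g t).div (fun y => s y • A.H (g t) y) x) t := by
  have h0 : A.swap.IsPerpTruncated (dtMetric g t) :=
    hS ▸ A.swap.isPerpTruncated_metricPerp (g t) s
  refine (hg.hasDerivAt_normSqh_of_swap_isPerpTruncated ht h0 x).congr_deriv ?_
  obtain ⟨U, hx, W, Z, hF⟩ := A.exists_isAdaptedFrame (g t) x
  have hA := hg.adapted t ht
  have hw := hF.basis_top x hx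
  have hz := hF.basis_perp x hx
  have hc : (g t).contract (A.h (g t)) (dtMetric g t) = fun y => s y • A.H (g t) y := by
    ext1 y
    have hy := (g t).isOrthonormalBasis_orthonormalFrame (A.dtop y)
    rw [H, Finset.smul_sum]
    refine (hA.sum_smul_eq hy ((g t).isOrthonormalBasis_orthonormalFrame ⊤)
      (hg.isBilinearMap_dtMetric ht y) (fun u hu v => h0 y u hu v)
      (hA.isBilinearMap_h y)).trans ?_
    simp [apply_of_swap_metricPerp hS hy]
  have hW := fun c => (hF.isTopSection hx c).mdiff
  have hdivH : (g t).div (A.H (g t)) x =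
      ∑ a, (g t).div (fun y => A.h (g t) y (W a y) (W a y)) x := by
    rw [← (g t).div_sum _ fun a _ => (hA.isDiffTensorAt_h x).mdiff (hW a) (hW a)]
    refine (g t).div_congr (.sum_section fun a _ => (hA.isDiffTensorAt_h x).mdiff (hW a) (hW a)) ?_
    filter_upwards [hF.isOpen.mem_nhds hx] with y hy using hF.H_eq hA hy
  have hB := hA.isBilinearMap_divTensor_add_KFlat x
  -- The traces of `𝒦` and of the connection terms in `div h` vanish, being contractions of
  -- symmetric with skew-symmetric matrices.
  have hΓ := fun i => sum_mul_eq_zero_of_antisymm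
    (θ := fun a c => (g t).inner x ((g t).leviCivita (W a) x (Z i x)) (W c x))
    (S := fun a c => (g t).inner x (A.h (g t) x (W a x) (W c x)) (Z i x))
    (fun a b => hF.inner_leviCivita_swap hx _ a b) (fun a b => by rw [A.h_comm])
  have hθ := fun i => sum_mul_eq_zero_of_antisymm
    (θ := fun a c => (g t).inner x (A.T x (W a x) (W c x)) (Z i x))
    (S := fun a c => (g t).inner x (A.h (g t) x (W a x) (W c x)) (Z i x))
    (fun a b => by rw [hA.T_swap]; simp) (fun a b => by rw [A.h_comm])
  have hdiv : ∑ a, ∑ i, (-(∑ c, (g t).inner x ((g t).leviCivita (W a) x (Z i x)) (W c x) *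
            (g t).inner x (A.h (g t) x (W c x) (W a x)) (Z i x))
        - ∑ c, (g t).inner x ((g t).leviCivita (W a) x (Z i x)) (W c x) *
            (g t).inner x (A.h (g t) x (W a x) (W c x)) (Z i x)) = 0 := by
    rw [Finset.sum_comm]
    refine Finset.sum_eq_zero fun i _ => ?_
    have hΓ' : ∑ a, ∑ c, (g t).inner x ((g t).leviCivita (W a) x (Z i x)) (W c x) *
        (g t).inner x (A.h (g t) x (W a x) (W c x)) (Z i x) = 0 := by
      rw [← hΓ i]
      exact Finset.sum_congr rfl fun a _ => Finset.sum_congr rfl fun c _ => by rw [A.h_comm]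
    simp only [Finset.sum_sub_distrib, Finset.sum_neg_distrib, hΓ, hΓ', neg_zero, sub_zero]
  have hK : ∑ a, A.KFlat (g t) x (W a x) (W a x) = 0 := by
    simp only [hA.KFlat_apply hw hz]
    rw [Finset.sum_comm]
    refine Finset.sum_eq_zero fun i _ => ?_
    have e : ∀ a c, (g t).inner x (A.h (g t) x (W a x) (W c x)) (Z i x) *
          (g t).inner x (A.T x (W c x) (W a x)) (Z i x) =
        -((g t).inner x (A.T x (W a x) (W c x)) (Z i x) *
          (g t).inner x (A.h (g t) x (W c x) (W a x)) (Z i x)) := fun a c => by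
      rw [hA.T_swap (W a x), A.h_comm, map_neg, neg_apply]
      ring
    simp only [e, Finset.sum_sub_distrib, Finset.sum_neg_distrib, hθ, neg_zero, sub_zero]
  rw [hc, hA.pairing_eq hw hB (hg.isBilinearMap_dtMetric ht x) h0]
  simp only [apply_of_swap_metricPerp hS hw, ite_mul, zero_mul, Finset.sum_ite_eq, Finset.mem_univ,
    if_true, ← Finset.mul_sum, Pi.add_apply, Finset.sum_add_distrib, hK, hF.divTensor_h hA hx, hdiv,
    add_zero, hdivH]

theorem hasDerivAt_normSqH_of_swap_metricPerp (hg : A.IsAdaptedVariation ε g) (ht : |t| < ε)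
    (hs : ContMDiff 𝓘(ℝ, E) 𝓘(ℝ, ℝ) ∞ s)
    (hS : dtMetric g t = fun x u v => s x * A.swap.metricPerp (g t) x u v) (x : M) :
    HasDerivAt (fun τ => A.normSqH (g τ) x)
      (n * (s x * (g t).div (A.H (g t)) x - (g t).div (fun y => s y • A.H (g t) y) x)) t := by
  have h0 : A.swap.IsPerpTruncated (dtMetric g t) :=
    hS ▸ A.swap.isPerpTruncated_metricPerp (g t) s
  refine (hg.hasDerivAt_normSqH_of_swap_isPerpTruncated ht h0 x).congr_deriv ?_
  have hA := hg.adapted t ht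
  have hH := hA.mdifferentiableAt_H x
  have htr : (g t).trace (dtMetric g t) = fun y => n * s y := by
    ext1 y
    have hy := (g t).isOrthonormalBasis_orthonormalFrame (A.dtop y)
    rw [hA.trace_eq hy (hg.isBilinearMap_dtMetric ht y) h0]
    simp [apply_of_swap_metricPerp hS hy, A.finrank_dtop y]
  have hpair : (g t).pairing (fun y u v => (g t).div (A.H (g t)) y * (g t).inner y u v)
      (dtMetric g t) x = (g t).trace (dtMetric g t) x * (g t).div (A.H (g t)) x :=
    (g t).pairing_mul_inner _ _ x
  have h1 := (g t).div_smul (f := fun _ => (n : ℝ))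
    (Y := fun y => s y • A.H (g t) y) mdifferentiableAt_const
    (((hs x).mdifferentiableAt (by simp)).smul_section hH)
  rw [mvfderiv_const] at h1
  have h2 : (g t).div (fun y => (n * s y) • A.H (g t) y) x =
      n * (g t).div (fun y => s y • A.H (g t) y) x := by
    simp only [mul_smul]
    simpa using h1
  rw [hpair, htr, h2]
  ring

theorem hasDerivAt_normSqT_of_swap_metricPerp (hg : A.IsAdaptedVariation ε g) (ht : |t| < ε)
    (hS : dtMetric g t = fun x u v => s x * A.swap.metricPerp (g t) x u v) (x : M) :
    HasDerivAt (fun τ => A.normSqT (g τ) x) (-2 * s x * A.normSqT (g t) x) t := by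
  have h0 : A.swap.IsPerpTruncated (dtMetric g t) :=
    hS ▸ A.swap.isPerpTruncated_metricPerp (g t) s
  refine (hg.hasDerivAt_normSqT_of_swap_isPerpTruncated ht h0 x).congr_deriv ?_
  have hA := hg.adapted t ht
  have hw := (g t).isOrthonormalBasis_orthonormalFrame (A.dtop x)
  have hB := hA.isBilinearMap_two_mul_casoratiTFlat x
  rw [hA.pairing_eq hw hB (hg.isBilinearMap_dtMetric ht x) h0]
  simp only [apply_of_swap_metricPerp hS hw, hA.casoratiTFlat_apply hw, normSqT, ite_mul, zero_mul,
    Finset.sum_ite_eq, Finset.mem_univ, if_true, ← Finset.mul_sum, Finset.sum_neg_distrib]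
  ring

end

end IsAdaptedVariation

end AlmostProduct

end

theorem mainTheorem11
    {E : Type*} [NormedAddCommGroup E] [NormedSpace ℝ E] [FiniteDimensional ℝ E]
    {M : Type*} [TopologicalSpace M] [ChartedSpace E M] [IsManifold 𝓘(ℝ, E) ∞ M]
    {n p : ℕ} (A : AlmostProduct E M n p)
    (ε : ℝ) (g : ℝ → RiemMetric E M) (hg : A.IsAdaptedVariation ε g)
    (t : ℝ) (ht : |t| < ε) (S : Tensor02 E M) (hS : S = dtMetric g t) :
    -- variations along the second distribution
    (A.IsPerpTruncated S → ∀ x : M,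
      HasDerivAt (fun τ => A.swap.normSqh (g τ) x)
        ((g t).pairing ((g t).divTensor (A.swap.h (g t)) + A.swap.KFlat (g t)) S x
          - (g t).div ((g t).contract (A.swap.h (g t)) S) x) t ∧
      HasDerivAt (fun τ => A.swap.normSqH (g τ) x)
        ((g t).pairing (fun y u v => (g t).div (A.swap.H (g t)) y * (g t).inner y u v) S x
          - (g t).div (fun y => (g t).trace S y • A.swap.H (g t) y) x) t ∧
      HasDerivAt (fun τ => A.normSqh (g τ) x - A.normSqH (g τ) x)
        ((g t).pairing (A.Phih (g t)) S x) t ∧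
      HasDerivAt (fun τ => A.swap.normSqT (g τ) x)
        ((g t).pairing (fun y u v => 2 * A.swap.casoratiTFlat (g t) y u v) S x) t ∧
      HasDerivAt (fun τ => A.normSqT (g τ) x)
        (-(g t).pairing (A.PhiT (g t)) S x) t) ∧
    (∀ s : M → ℝ, ContMDiff 𝓘(ℝ, E) 𝓘(ℝ, ℝ) ∞ s →
      (S = fun x u v => s x * A.metricPerp (g t) x u v) → ∀ x : M,
      HasDerivAt (fun τ => A.swap.normSqh (g τ) x)
        (s x * (g t).div (A.swap.H (g t)) x
          - (g t).div (fun y => s y • A.swap.H (g t) y) x) t ∧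
      HasDerivAt (fun τ => A.swap.normSqH (g τ) x)
        (p * (s x * (g t).div (A.swap.H (g t)) x
          - (g t).div (fun y => s y • A.swap.H (g t) y) x)) t ∧
      HasDerivAt (fun τ => A.normSqh (g τ) x) (-s x * A.normSqh (g t) x) t ∧
      HasDerivAt (fun τ => A.normSqH (g τ) x) (-s x * A.normSqH (g t) x) t ∧
      HasDerivAt (fun τ => A.swap.normSqT (g τ) x) (-2 * s x * A.swap.normSqT (g t) x) t ∧
      HasDerivAt (fun τ => A.normSqT (g τ) x) (s x * A.normSqT (g t) x) t) ∧
    -- the dual formulas, for variations along the first distribution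
    (A.swap.IsPerpTruncated S → ∀ x : M,
      HasDerivAt (fun τ => A.normSqh (g τ) x)
        ((g t).pairing ((g t).divTensor (A.h (g t)) + A.KFlat (g t)) S x
          - (g t).div ((g t).contract (A.h (g t)) S) x) t ∧
      HasDerivAt (fun τ => A.normSqH (g τ) x)
        ((g t).pairing (fun y u v => (g t).div (A.H (g t)) y * (g t).inner y u v) S x
          - (g t).div (fun y => (g t).trace S y • A.H (g t) y) x) t ∧
      HasDerivAt (fun τ => A.swap.normSqh (g τ) x - A.swap.normSqH (g τ) x)
        ((g t).pairing (A.swap.Phih (g t)) S x) t ∧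
      HasDerivAt (fun τ => A.normSqT (g τ) x)
        ((g t).pairing (fun y u v => 2 * A.casoratiTFlat (g t) y u v) S x) t ∧
      HasDerivAt (fun τ => A.swap.normSqT (g τ) x)
        (-(g t).pairing (A.swap.PhiT (g t)) S x) t) ∧
    (∀ s : M → ℝ, ContMDiff 𝓘(ℝ, E) 𝓘(ℝ, ℝ) ∞ s →
      (S = fun x u v => s x * A.swap.metricPerp (g t) x u v) → ∀ x : M,
      HasDerivAt (fun τ => A.normSqh (g τ) x)
        (s x * (g t).div (A.H (g t)) x
          - (g t).div (fun y => s y • A.H (g t) y) x) t ∧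
      HasDerivAt (fun τ => A.normSqH (g τ) x)
        (n * (s x * (g t).div (A.H (g t)) x
          - (g t).div (fun y => s y • A.H (g t) y) x)) t ∧
      HasDerivAt (fun τ => A.swap.normSqh (g τ) x) (-s x * A.swap.normSqh (g t) x) t ∧
      HasDerivAt (fun τ => A.swap.normSqH (g τ) x) (-s x * A.swap.normSqH (g t) x) t ∧
      HasDerivAt (fun τ => A.normSqT (g τ) x) (-2 * s x * A.normSqT (g t) x) t ∧
      HasDerivAt (fun τ => A.swap.normSqT (g τ) x) (s x * A.swap.normSqT (g t) x) t) := by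
  subst hS
  -- The formulas for the invariants of `𝒟` are those for `𝒟̃` in the swapped pair.
  have hg' := hg.swap
  refine ⟨fun h0 x => ⟨?_, ?_, ?_, ?_, ?_⟩, fun s hs h0 x => ⟨?_, ?_, ?_, ?_, ?_, ?_⟩,
    fun h0 x => ⟨?_, ?_, ?_, ?_, ?_⟩, fun s hs h0 x => ⟨?_, ?_, ?_, ?_, ?_, ?_⟩⟩
  · exact hg'.hasDerivAt_normSqh_of_swap_isPerpTruncated ht h0 x
  · exact hg'.hasDerivAt_normSqH_of_swap_isPerpTruncated ht h0 x
  · refine ((hg.hasDerivAt_normSqh_of_isPerpTruncated ht h0 x).sub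
      (hg.hasDerivAt_normSqH_of_isPerpTruncated ht h0 x)).congr_deriv ?_
    rw [A.pairing_Phih (g t) (hg.isBilinearMap_dtMetric ht x)]
    ring
  · exact hg'.hasDerivAt_normSqT_of_swap_isPerpTruncated ht h0 x
  · rw [A.pairing_PhiT (g t) (hg.isBilinearMap_dtMetric ht x), neg_neg]
    exact hg.hasDerivAt_normSqT_of_isPerpTruncated ht h0 x
  · exact hg'.hasDerivAt_normSqh_of_swap_metricPerp ht h0 x
  · exact hg'.hasDerivAt_normSqH_of_swap_metricPerp ht hs h0 x
  · exact hg.hasDerivAt_normSqh_of_metricPerp ht h0 x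
  · exact hg.hasDerivAt_normSqH_of_metricPerp ht h0 x
  · exact hg'.hasDerivAt_normSqT_of_swap_metricPerp ht h0 x
  · exact hg.hasDerivAt_normSqT_of_metricPerp ht h0 x
  · exact hg.hasDerivAt_normSqh_of_swap_isPerpTruncated ht h0 x
  · exact hg.hasDerivAt_normSqH_of_swap_isPerpTruncated ht h0 x
  · refine ((hg'.hasDerivAt_normSqh_of_isPerpTruncated ht h0 x).sub
      (hg'.hasDerivAt_normSqH_of_isPerpTruncated ht h0 x)).congr_deriv ?_
    rw [A.swap.pairing_Phih (g t) (hg.isBilinearMap_dtMetric ht x)]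
    ring
  · exact hg.hasDerivAt_normSqT_of_swap_isPerpTruncated ht h0 x
  · rw [A.swap.pairing_PhiT (g t) (hg.isBilinearMap_dtMetric ht x), neg_neg]
    exact hg'.hasDerivAt_normSqT_of_isPerpTruncated ht h0 x
  · exact hg.hasDerivAt_normSqh_of_swap_metricPerp ht h0 x
  · exact hg.hasDerivAt_normSqH_of_swap_metricPerp ht hs h0 x
  · exact hg'.hasDerivAt_normSqh_of_metricPerp ht h0 x
  · exact hg'.hasDerivAt_normSqH_of_metricPerp ht h0 x
  · exact hg.hasDerivAt_normSqT_of_swap_metricPerp ht h0 x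
  · exact hg'.hasDerivAt_normSqT_of_metricPerp ht h0 x
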